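/- Let $d\ge 1$, $\lambda\in\mathbf R\setminus\{0\}$, $\sigma>0$, and let $P:\mathbf R^d\to\mathbf R$ be measurable. Assume that either $\sigma$ is an integer, or there is an integer $r$ with $2\sigma\ge r>d/2$. Consider, with $D=-i\nabla_x$, $$ i\partial_t u+P(D)u=\lambda|u|^{2\sigma}u,\qquad u_{\mid t=0}=u_0,\qquad (t,x)\in\mathbf R_+\times\mathbf R^d. \tag{E}$$ A solution of (E) on $[0,T]$ is a function $u\in C([0,T];H^{\rho}(\mathbf R^d))$, for some $\rho>d/2$, such that for all $t\in[0,T]$ $$u(t)=e^{itP(D)}u_0-i\lambda\int_0^t e^{i(t-\tau)P(D)}\bigl(|u(\tau)|^{2\sigma}u(\tau)\bigr)\,d\tau .$$ 1. Suppose that $P$ is $m$-homogeneous with a real $m\ge 1$, that is, $P(\mu\xi)=\mu^mP(\xi)$ for all $\xi\in\mathbf R^d$ and $\mu>0$, and that $s_0:=\frac d2-\frac m{2\sigma}>0$. Let $0<s<s_0$. Then there exist a family $(u_0^h)_{0<h\le 1}$ in $\mathcal S(\mathbf R^d)$ with $\|u_0^h\|_{H^s(\mathbf R^d)}\to 0$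 as $h\to 0$, times $t^h>0$ with $t^h\to 0$ as $h\to 0$, and, for each $h\in(0,1]$, a solution $u^h$ of (E) with initial datum $u_0^h$ on an interval $[0,T^h]$ with $T^h\ge t^h$, such that $$\|u^h(t^h)\|_{H^s(\mathbf R^d)}\to+\infty\quad\text{as } h\to 0.$$ 2. If $P$ is bounded, $P\in L^\infty(\mathbf R^d)$, then the same conclusion holds for every $0<s<d/2$. -/

import Mathlib

open MeasureTheory Filter Topology FourierTransform
open scoped ENNReal SchwartzMap

noncomputable section

namespace ModifiedDispersion

/-- `ℝ^d` with its Euclidean norm. -/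
abbrev Space (d : ℕ) : Type := EuclideanSpace ℝ (Fin d)

/-- `L²(ℝ^d; ℂ)`. -/
abbrev L2 (d : ℕ) : Type := Lp ℂ 2 (volume : Measure (Space d))

/-- The (possibly infinite) norm of `H^s(ℝ^d)`,
`‖f‖_{H^s} = ‖(1 + |D|²)^{s/2} f‖_{L²}`, where `D = -i∇`. Since `𝓕` is normalised with the kernel
`exp (-2πi x·ξ)`, the operator `D` corresponds to multiplication by `2πξ`. -/
def sobolevNorm {d : ℕ} (s : ℝ) (f : L2 d) : ℝ≥0∞ :=
  eLpNorm (fun ξ : Space d =>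
    (((1 + ‖(2 * Real.pi) • ξ‖ ^ 2) ^ (s / 2) : ℝ) : ℂ) * (𝓕 f : L2 d) ξ) 2 volume

/-- `P(μ ξ) = μ^m P(ξ)` for all `ξ` and all `μ > 0`. -/
def IsHomogeneousSymbol {d : ℕ} (P : Space d → ℝ) (m : ℝ) : Prop :=
  ∀ (ξ : Space d) (μ : ℝ), 0 < μ → P (μ • ξ) = μ ^ m * P ξ

lemma memLp_phase_mul {d : ℕ} {P : Space d → ℝ} (hP : AEMeasurable P volume) (t : ℝ) (f : L2 d) :
    MemLp (fun ξ : Space d =>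
      Complex.exp (Complex.I * (t * P ((2 * Real.pi) • ξ) : ℝ)) * f ξ) 2 volume := by
  have hq : Measure.QuasiMeasurePreserving (fun ξ : Space d => (2 * Real.pi) • ξ)
      volume volume := by
    refine ⟨measurable_const_smul _, ?_⟩
    rw [Measure.map_addHaar_smul volume (by positivity : (2 * Real.pi : ℝ) ≠ 0)]
    exact Measure.smul_absolutelyContinuous
  have hPm : AEMeasurable (fun ξ : Space d => P ((2 * Real.pi) • ξ)) volume :=
    hP.comp_quasiMeasurePreserving hq
  have hexp : AEMeasurable (fun ξ : Space d =>
      Complex.exp (Complex.I * (t * P ((2 * Real.pi) • ξ) : ℝ))) volume :=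
    Complex.measurable_exp.comp_aemeasurable
      ((Complex.measurable_ofReal.comp_aemeasurable (hPm.const_mul t)).const_mul _)
  refine (Lp.memLp f).of_le (hexp.aestronglyMeasurable.mul (Lp.aestronglyMeasurable f)) ?_
  refine Eventually.of_forall fun ξ => ?_
  rw [norm_mul, mul_comm Complex.I, Complex.norm_exp_ofReal_mul_I, one_mul]

/-- The free flow `exp (i t P(D))` of `i ∂ₜ u + P(D) u = 0` on `L²(ℝ^d)`: the Fourier multiplier by
`exp (i t P)`, with `D = -i∇` (hence the argument `2πξ`, see `sobolevNorm`). -/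
def freeFlow {d : ℕ} {P : Space d → ℝ} (hP : AEMeasurable P volume) (t : ℝ) (f : L2 d) : L2 d :=
  𝓕⁻ ((memLp_phase_mul hP t (𝓕 f : L2 d)).toLp)

/-- `u ∈ C([0,T]; H^r(ℝ^d))`. -/
def ContinuousInSobolev {d : ℕ} (r T : ℝ) (u : ℝ → L2 d) : Prop :=
  ∀ t₀ ∈ Set.Icc 0 T, sobolevNorm r (u t₀) < ∞ ∧
    Tendsto (fun t => sobolevNorm r (u t - u t₀)) (𝓝[Set.Icc 0 T] t₀) (𝓝 0)

/-- `u` is a solution on the time interval `[0,T]` of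
`i ∂ₜ u + P(D) u = lam |u|^{2σ} u`, `u(0) = u₀`:
it belongs to `C([0,T]; H^r(ℝ^d))` for some `r > d/2`, so that the nonlinear term `g` is a continuous
`L²`-valued function, and it satisfies Duhamel's formula
`u(t) = e^{itP(D)} u₀ - i lam ∫₀ᵗ e^{i(t-τ)P(D)} (|u|^{2σ} u)(τ) dτ` in `L²(ℝ^d)`. -/
def IsSolution {d : ℕ} {P : Space d → ℝ} (hP : AEMeasurable P volume) (lam σ : ℝ)
    (u₀ : 𝓢(Space d, ℂ)) (T : ℝ) (u : ℝ → L2 d) : Prop :=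
  (∃ r : ℝ, (d : ℝ) / 2 < r ∧ ContinuousInSobolev r T u) ∧
  ∃ g : ℝ → L2 d, ContinuousOn g (Set.Icc 0 T) ∧
    (∀ t ∈ Set.Icc 0 T,
      g t =ᵐ[volume] fun x : Space d => ((‖u t x‖ ^ (2 * σ) : ℝ) : ℂ) * u t x) ∧
    ∀ t ∈ Set.Icc 0 T,
      u t = freeFlow hP t (u₀.toLp 2 volume)
        - (Complex.I * (lam : ℂ)) • ∫ τ in (0 : ℝ)..t, freeFlow hP (t - τ) (g τ)

/-- Norm inflation in `H^s(ℝ^d)`: there are Schwartz data `u₀ h`, `0 < h ≤ 1`, tending to `0` in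
`H^s`, solutions `u h` on `[0, T h]` with these data, and times `0 < t h ≤ T h` tending to `0`, such
that the `H^s` norm of `u h (t h)` tends to infinity as `h → 0`. -/
def NormInflation {d : ℕ} {P : Space d → ℝ} (hP : AEMeasurable P volume) (lam σ s : ℝ) : Prop :=
  ∃ (u₀ : ℝ → 𝓢(Space d, ℂ)) (u : ℝ → ℝ → L2 d) (T t : ℝ → ℝ),
    (∀ h ∈ Set.Ioc (0 : ℝ) 1,
      0 < t h ∧ t h ≤ T h ∧ IsSolution hP lam σ (u₀ h) (T h) (u h)) ∧
    Tendsto (fun h => sobolevNorm s ((u₀ h).toLp 2 volume)) (𝓝[>] 0) (𝓝 0) ∧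
    Tendsto t (𝓝[>] 0) (𝓝 0) ∧
    Tendsto (fun h => sobolevNorm s (u h (t h))) (𝓝[>] 0) (𝓝 ∞)

end ModifiedDispersion

end

/-
Without dispersion the equation is an ordinary differential equation at each point `x`: the solution
of `i ∂ₜ v = lam |v|^{2σ} v` with data `a` is `v(t) = a exp (-i t lam |a|^{2σ})`, whose oscillations
become faster and faster, so that for a suitable `a` all its homogeneous norms of positive order are
unbounded in time. The rescaling `u(t, x) = A w(A^{2σ} t, c x)` turns a solution `w` of the equation
with the symbol `Q(ξ) = A^{-2σ} P(c ξ)` into a solution with the symbol `P`. With `c ≥ 1` and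
`A = κ c^{d/2 - s}` the scaling multiplies the homogeneous `H^s` norm by `κ`, does not multiply the
`H^s` norm by more than `κ`, and contracts time by `A^{2σ}`. As `c → ∞` with `κ` fixed, `Q` tends to
zero pointwise, so `w` is close to `v` on any given time interval. It remains to choose `κ` small,
then a time at which the homogeneous norm of `v` is large compared with `1/κ`, then `c` large.

For the closeness of `w` and `v` the nonlinearity is modified far from the origin, which makes it
globally Lipschitz. The operator `min (2, T |Q(D)|)` bounds the effect of the free flow up to time
`T` and tends to zero strongly, so `v` solves the integral equation of `w` up to an error that is
small in `L²`. A fixed point argument in an `L²` neighbourhood of `v`, within a ball of a stronger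
Sobolev space, then gives `w`, and interpolation between the two norms recovers the `H^s` distance.
-/

noncomputable section

namespace ModifiedDispersion

variable {d : ℕ}

section Fourier

variable {V : Type*} [NormedAddCommGroup V] [InnerProductSpace ℝ V] [FiniteDimensional ℝ V]
  [MeasurableSpace V] [BorelSpace V] {E : Type*} [NormedAddCommGroup E] [NormedSpace ℂ E]

lemma continuous_fourier {g : V → E} (hg : Integrable g) : Continuous (𝓕 g) :=
  VectorFourier.fourierIntegral_continuous Real.continuous_fourierChar
    (by exact continuous_inner) hg

lemma fourier_add_apply {f g : V → E} (hf : Integrable f) (hg : Integrable g) (ξ : V) :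
    𝓕 (fun x => f x + g x) ξ = 𝓕 f ξ + 𝓕 g ξ :=
  congrFun (VectorFourier.fourierIntegral_add (e := Real.fourierChar) (L := innerₗ V)
    Real.continuous_fourierChar (by exact continuous_inner) hf hg) ξ

lemma fourier_conj_apply (g : V → ℂ) (ξ : V) :
    𝓕 (fun x => (starRingEnd ℂ) (g x)) ξ = (starRingEnd ℂ) (𝓕 g (-ξ)) := by
  rw [Real.fourier_eq', Real.fourier_eq', ← integral_conj]
  congr 1 with x
  simp only [smul_eq_mul, map_mul, ← Complex.exp_conj]
  congr 2
  simp [show (starRingEnd ℂ) 2 = 2 from Complex.conj_ofNat 2]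

lemma norm_fourier_fderiv_apply {g : V → ℂ} (hg : Integrable g) (hdiff : Differentiable ℝ g)
    (hfderiv : Integrable (fderiv ℝ g)) (e ξ : V) :
    ‖𝓕 (fun x => fderiv ℝ g x e) ξ‖ = |inner ℝ ((2 * Real.pi) • ξ) e| * ‖𝓕 g ξ‖ := by
  rw [← Real.fourier_continuousLinearMap_apply (f := fderiv ℝ g) hfderiv,
    Real.fourier_fderiv hg hdiff hfderiv]
  have hinner : innerSL ℝ ξ e = inner ℝ ξ e := rfl
  simp [inner_smul_left, abs_mul, abs_of_pos Real.pi_pos, hinner, mul_assoc]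

lemma enorm_schwartz_le_lintegral_fourier (f : 𝓢(V, ℂ)) (x : V) :
    ‖f x‖ₑ ≤ ∫⁻ ξ, ‖𝓕 (f : V → ℂ) ξ‖ₑ := by
  have hinv : f x = 𝓕⁻ (𝓕 (f : V → ℂ)) x :=
    (congrFun (f.continuous.fourierInv_fourier_eq f.integrable
      (by simpa only [SchwartzMap.fourier_coe] using (𝓕 f).integrable)) x).symm
  rw [hinv, Real.fourierInv_eq]
  refine (enorm_integral_le_lintegral_enorm _).trans_eq (lintegral_congr fun ξ => ?_)
  rw [← ofReal_norm, ← ofReal_norm, Circle.norm_smul]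

-- Both sides are tested against smooth compactly supported functions, where the left one is
-- computed through the Fourier transform of tempered distributions.
lemma coeFn_fourier_toLp {g : V → ℂ} (h1 : Integrable g) (h2 : MemLp g 2) :
    ((𝓕 (h2.toLp g) : Lp ℂ 2 (volume : Measure V)) : V → ℂ) =ᵐ[volume] 𝓕 g := by
  apply ae_eq_of_integral_contDiff_smul_eq
  · exact (Lp.memLp _).locallyIntegrable (by norm_num)
  · exact (continuous_fourier h1).locallyIntegrable
  intro φ hφ hφc
  have hφc' : HasCompactSupport (Complex.ofRealCLM ∘ φ) := hφc.comp_left rfl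
  set Φ : 𝓢(V, ℂ) := hφc'.toSchwartzMap (by fun_prop) with hΦ
  have hΦx : ∀ x, Φ x = (φ x : ℂ) := fun x => by simp [hΦ]
  calc ∫ x, φ x • (𝓕 (h2.toLp g) : Lp ℂ 2 (volume : Measure V)) x
      = ((𝓕 (h2.toLp g) : Lp ℂ 2 (volume : Measure V)) : 𝓢'(V, ℂ)) Φ := by
        rw [Lp.toTemperedDistribution_apply]
        simp [hΦx]
    _ = ∫ x, (𝓕 Φ) x • (h2.toLp g : Lp ℂ 2 (volume : Measure V)) x := by
        rw [← Lp.fourier_toTemperedDistribution_eq, TemperedDistribution.fourier_apply,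
          Lp.toTemperedDistribution_apply]
    _ = ∫ x, (𝓕 Φ) x • g x := by
        apply integral_congr_ae
        filter_upwards [h2.coeFn_toLp] with x hx
        rw [hx]
    _ = ∫ x, Φ x • 𝓕 g x := by
        have h := VectorFourier.integral_fourierIntegral_smul_eq_flip (μ := volume) (ν := volume)
          (L := innerₗ V) (f := (Φ : V → ℂ)) (g := g) Real.continuous_fourierChar
          (by exact continuous_inner) Φ.integrable h1
        rwa [flip_innerₗ] at h
    _ = ∫ x, φ x • 𝓕 g x := by simp [hΦx]

end Fourier

section SecondMoments

variable {α : Type*} [MeasurableSpace α] {μ : Measure α}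

lemma eLpNorm_two_sq {E : Type*} [NormedAddCommGroup E] (f : α → E) :
    eLpNorm f 2 μ ^ 2 = ∫⁻ x, ‖f x‖ₑ ^ 2 ∂μ := by
  rw [eLpNorm_eq_lintegral_rpow_enorm_toReal (by norm_num) (by norm_num), ← ENNReal.rpow_natCast,
    ← ENNReal.rpow_mul]
  simp

lemma lintegral_mul_sq_le {f g : α → ℝ≥0∞} (hf : AEMeasurable f μ) (hg : AEMeasurable g μ) :
    (∫⁻ x, f x * g x ∂μ) ^ 2 ≤ (∫⁻ x, f x ^ 2 ∂μ) * ∫⁻ x, g x ^ 2 ∂μ := by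
  have hölder := ENNReal.lintegral_mul_le_Lp_mul_Lq μ Real.HolderConjugate.two_two hf hg
  simp only [Pi.mul_apply] at hölder
  calc (∫⁻ x, f x * g x ∂μ) ^ 2
      ≤ ((∫⁻ x, f x ^ (2 : ℝ) ∂μ) ^ (1 / (2 : ℝ)) *
          (∫⁻ x, g x ^ (2 : ℝ) ∂μ) ^ (1 / (2 : ℝ))) ^ 2 := by gcongr
    _ = (∫⁻ x, f x ^ 2 ∂μ) * ∫⁻ x, g x ^ 2 ∂μ := by
      rw [mul_pow, ← ENNReal.rpow_natCast, ← ENNReal.rpow_natCast, ← ENNReal.rpow_mul,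
        ← ENNReal.rpow_mul]
      norm_num

end SecondMoments

/-- The square of the Japanese bracket of the frequency, which is `2πξ` in the normalisation of
`sobolevNorm`. -/
def bracket (ξ : Space d) : ℝ := 1 + ‖(2 * Real.pi) • ξ‖ ^ 2

lemma one_le_bracket (ξ : Space d) : 1 ≤ bracket ξ :=
  le_add_of_nonneg_right (sq_nonneg _)

lemma bracket_pos (ξ : Space d) : 0 < bracket ξ := one_pos.trans_le (one_le_bracket ξ)

lemma continuous_bracket : Continuous (bracket : Space d → ℝ) := by
  unfold bracket
  fun_prop

lemma continuous_bracket_rpow (s : ℝ) : Continuous (fun ξ : Space d => bracket ξ ^ s) :=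
  continuous_bracket.rpow_const fun ξ => Or.inl (bracket_pos ξ).ne'

lemma continuous_ofReal_bracket_rpow (s : ℝ) :
    Continuous (fun ξ : Space d => ((bracket ξ ^ s : ℝ) : ℂ)) :=
  Complex.continuous_ofReal.comp (continuous_bracket_rpow s)

lemma norm_ofReal_bracket_rpow (s : ℝ) (ξ : Space d) :
    ‖((bracket ξ ^ s : ℝ) : ℂ)‖ = bracket ξ ^ s := by
  rw [Complex.norm_real, Real.norm_of_nonneg (Real.rpow_nonneg (bracket_pos ξ).le _)]

lemma enorm_ofReal_bracket_rpow (s : ℝ) (ξ : Space d) :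
    ‖((bracket ξ ^ s : ℝ) : ℂ)‖ₑ = ENNReal.ofReal (bracket ξ ^ s) := by
  rw [← ofReal_norm, norm_ofReal_bracket_rpow]

lemma ofReal_bracket_rpow_half_sq (s : ℝ) (ξ : Space d) :
    ENNReal.ofReal (bracket ξ ^ (s / 2)) ^ 2 = ENNReal.ofReal (bracket ξ ^ s) := by
  rw [← ENNReal.ofReal_pow (Real.rpow_nonneg (bracket_pos ξ).le _), ← Real.rpow_natCast,
    ← Real.rpow_mul (bracket_pos ξ).le]
  norm_num

/-- The `j`-th vector of the canonical basis of `ℝ^d`, the direction of the `j`-th partial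
derivative. -/
def basisVec (j : Fin d) : Space d := EuclideanSpace.single j (1 : ℝ)

lemma norm_basisVec (j : Fin d) : ‖basisVec j‖ = 1 := by
  simp [basisVec]

lemma norm_le_sum_abs_inner_basisVec (v : Space d) : ‖v‖ ≤ ∑ j, |inner ℝ v (basisVec j)| := by
  have hsq : ‖v‖ ^ 2 = ∑ j, |inner ℝ v (basisVec j)| ^ 2 := by
    rw [EuclideanSpace.norm_sq_eq]
    simp [basisVec, EuclideanSpace.inner_single_right]
  refine (sq_le_sq₀ (norm_nonneg v) (Finset.sum_nonneg fun j _ => abs_nonneg _)).1 ?_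
  rw [hsq]
  exact Finset.sum_sq_le_sq_sum_of_nonneg fun j _ => abs_nonneg _

lemma abs_inner_basisVec_le (ξ : Space d) (j : Fin d) :
    |inner ℝ ((2 * Real.pi) • ξ) (basisVec j)| ≤ bracket ξ ^ ((1 : ℝ) / 2) := by
  have hle := abs_real_inner_le_norm ((2 * Real.pi) • ξ) (basisVec j)
  rw [norm_basisVec, mul_one] at hle
  rw [← Real.sqrt_eq_rpow]
  refine hle.trans (Real.le_sqrt_of_sq_le ?_)
  unfold bracket
  linarith

lemma one_add_sq_rpow_succ_le {s N : ℝ} (hs : 0 ≤ s) (hN : 0 ≤ N) :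
    (1 + N ^ 2) ^ ((s + 1) / 2) ≤ 2 ^ ((s + 1) / 2) + 2 * (N * (1 + N ^ 2) ^ (s / 2)) := by
  rcases le_or_gt N 1 with h | h
  · have : (1 + N ^ 2) ^ ((s + 1) / 2) ≤ 2 ^ ((s + 1) / 2) := by
      gcongr
      nlinarith
    have : 0 ≤ 2 * (N * (1 + N ^ 2) ^ (s / 2)) := by positivity
    linarith
  · have hsqrt : (1 + N ^ 2) ^ ((1 : ℝ) / 2) ≤ 2 * N := by
      rw [← Real.sqrt_eq_rpow, Real.sqrt_le_left (by linarith)]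
      nlinarith
    calc (1 + N ^ 2) ^ ((s + 1) / 2)
        = (1 + N ^ 2) ^ ((1 : ℝ) / 2) * (1 + N ^ 2) ^ (s / 2) := by
          rw [← Real.rpow_add (by positivity)]
          congr 1
          ring
      _ ≤ 2 * N * (1 + N ^ 2) ^ (s / 2) := by gcongr
      _ = 2 * (N * (1 + N ^ 2) ^ (s / 2)) := by ring
      _ ≤ _ := le_add_of_nonneg_left (by positivity)

lemma bracket_rpow_succ_le {s : ℝ} (hs : 0 ≤ s) (ξ : Space d) :
    bracket ξ ^ ((s + 1) / 2) ≤ 2 ^ ((s + 1) / 2) +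
      2 * ∑ j, |inner ℝ ((2 * Real.pi) • ξ) (basisVec j)| * bracket ξ ^ (s / 2) := by
  have hb : 0 ≤ bracket ξ ^ (s / 2) := Real.rpow_nonneg (bracket_pos ξ).le _
  refine (one_add_sq_rpow_succ_le hs (norm_nonneg ((2 * Real.pi) • ξ))).trans ?_
  rw [← Finset.sum_mul]
  change _ + 2 * (_ * bracket ξ ^ (s / 2)) ≤ _
  gcongr
  exact norm_le_sum_abs_inner_basisVec _

/-- The `H^s` norm of an integrable function, computed with the integral Fourier transform; see
`sobolevNorm_toLp` for the comparison with `sobolevNorm`. -/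
def funSobolevNorm (s : ℝ) (g : Space d → ℂ) : ℝ≥0∞ :=
  eLpNorm (fun ξ : Space d => ((bracket ξ ^ (s / 2) : ℝ) : ℂ) * 𝓕 g ξ) 2 volume

lemma sobolevNorm_toLp {g : Space d → ℂ} (s : ℝ) (h1 : Integrable g) (h2 : MemLp g 2) :
    sobolevNorm s (h2.toLp g : L2 d) = funSobolevNorm s g := by
  apply eLpNorm_congr_ae
  filter_upwards [coeFn_fourier_toLp h1 h2] with ξ hξ
  rw [hξ]
  rfl

lemma sobolevNorm_schwartz (s : ℝ) (f : 𝓢(Space d, ℂ)) :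
    sobolevNorm s (f.toLp 2 volume) = funSobolevNorm s f :=
  sobolevNorm_toLp s f.integrable (f.memLp 2 volume)

lemma enorm_eq_eLpNorm_fourier (f : L2 d) : ‖f‖ₑ = eLpNorm (𝓕 f : L2 d) 2 volume := by
  rw [← Lp.enorm_def, ← ofReal_norm, ← ofReal_norm, Lp.norm_fourier_eq]

lemma sobolevNorm_zero (f : L2 d) : sobolevNorm 0 f = ‖f‖ₑ := by
  rw [enorm_eq_eLpNorm_fourier]
  simp [sobolevNorm]

lemma funSobolevNorm_zero {g : Space d → ℂ} (h1 : Integrable g) (h2 : MemLp g 2) :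
    funSobolevNorm 0 g = eLpNorm g 2 volume := by
  rw [← sobolevNorm_toLp 0 h1 h2, sobolevNorm_zero, Lp.enorm_toLp]

lemma funSobolevNorm_sq (s : ℝ) (g : Space d → ℂ) :
    funSobolevNorm s g ^ 2 = ∫⁻ ξ, ENNReal.ofReal (bracket ξ ^ s) * ‖𝓕 g ξ‖ₑ ^ 2 := by
  rw [funSobolevNorm, eLpNorm_two_sq]
  congr 1 with ξ
  rw [enorm_mul, mul_pow, enorm_ofReal_bracket_rpow, ofReal_bracket_rpow_half_sq]

lemma aestronglyMeasurable_weight_mul_fourier (s : ℝ) {g : Space d → ℂ} (hg : Integrable g) :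
    AEStronglyMeasurable (fun ξ : Space d => ((bracket ξ ^ s : ℝ) : ℂ) * 𝓕 g ξ) volume :=
  ((continuous_ofReal_bracket_rpow _).mul (continuous_fourier hg)).aestronglyMeasurable

lemma funSobolevNorm_add_le (s : ℝ) {f g : Space d → ℂ} (hf : Integrable f) (hg : Integrable g) :
    funSobolevNorm s (fun x => f x + g x) ≤ funSobolevNorm s f + funSobolevNorm s g := by
  refine le_trans (le_of_eq ?_) (eLpNorm_add_le (aestronglyMeasurable_weight_mul_fourier _ hf)
    (aestronglyMeasurable_weight_mul_fourier _ hg) (by norm_num))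
  unfold funSobolevNorm
  congr 1 with ξ
  rw [fourier_add_apply hf hg, Pi.add_apply, mul_add]

lemma funSobolevNorm_mono {s s' : ℝ} (h : s ≤ s') (g : Space d → ℂ) :
    funSobolevNorm s g ≤ funSobolevNorm s' g := by
  refine eLpNorm_mono fun ξ => ?_
  rw [norm_mul, norm_mul, norm_ofReal_bracket_rpow, norm_ofReal_bracket_rpow]
  gcongr
  exact one_le_bracket ξ

lemma funSobolevNorm_conj (s : ℝ) (g : Space d → ℂ) :
    funSobolevNorm s (fun x => (starRingEnd ℂ) (g x)) = funSobolevNorm s g := by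
  have hsq : funSobolevNorm s (fun x => (starRingEnd ℂ) (g x)) ^ 2 = funSobolevNorm s g ^ 2 := by
    rw [funSobolevNorm_sq, funSobolevNorm_sq, ← lintegral_neg_eq_self]
    congr 1 with ξ
    rw [fourier_conj_apply, neg_neg, ← ofReal_norm, ← ofReal_norm, RCLike.norm_conj]
    simp only [bracket, smul_neg, norm_neg]
  exact (ENNReal.pow_right_strictMono two_ne_zero).injective hsq

lemma norm_weight_mul_fourier_succ_le {s : ℝ} (hs : 0 ≤ s) {g : Space d → ℂ} (hg : Integrable g)
    (hdiff : Differentiable ℝ g) (hfderiv : Integrable (fderiv ℝ g)) (ξ : Space d) :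
    ‖((bracket ξ ^ ((s + 1) / 2) : ℝ) : ℂ) * 𝓕 g ξ‖ ≤ 2 ^ ((s + 1) / 2) * ‖𝓕 g ξ‖ +
      2 * ∑ j, ‖((bracket ξ ^ (s / 2) : ℝ) : ℂ) *
        𝓕 (fun x => fderiv ℝ g x (basisVec j)) ξ‖ := by
  have hterm : ∀ j, ‖((bracket ξ ^ (s / 2) : ℝ) : ℂ) * 𝓕 (fun x => fderiv ℝ g x (basisVec j)) ξ‖ =
      |inner ℝ ((2 * Real.pi) • ξ) (basisVec j)| * bracket ξ ^ (s / 2) * ‖𝓕 g ξ‖ := fun j => by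
    rw [norm_mul, norm_ofReal_bracket_rpow, norm_fourier_fderiv_apply hg hdiff hfderiv]
    ring
  rw [norm_mul, norm_ofReal_bracket_rpow, Finset.sum_congr rfl fun j _ => hterm j,
    ← Finset.sum_mul, ← mul_assoc, ← add_mul]
  gcongr
  exact bracket_rpow_succ_le hs ξ

lemma funSobolevNorm_succ_le {s : ℝ} (hs : 0 ≤ s) {g : Space d → ℂ} (hg : Integrable g)
    (hdiff : Differentiable ℝ g) (hfderiv : Integrable (fderiv ℝ g)) :
    funSobolevNorm (s + 1) g ≤ ENNReal.ofReal (2 ^ ((s + 1) / 2)) * funSobolevNorm 0 g +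
      2 * ∑ j : Fin d, funSobolevNorm s (fun x => fderiv ℝ g x (basisVec j)) := by
  set A : ℝ := 2 ^ ((s + 1) / 2)
  set G : Fin d → Space d → ℝ := fun j ξ => ‖((bracket ξ ^ (s / 2) : ℝ) : ℂ) *
    𝓕 (fun x => fderiv ℝ g x (basisVec j)) ξ‖
  have hG : ∀ j, AEStronglyMeasurable (G j) volume := fun j =>
    (aestronglyMeasurable_weight_mul_fourier _ (hfderiv.apply_continuousLinearMap _)).norm
  have hfourier : AEStronglyMeasurable (fun ξ => ‖𝓕 g ξ‖) volume :=
    (continuous_fourier hg).norm.aestronglyMeasurable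
  calc funSobolevNorm (s + 1) g
      ≤ eLpNorm (A • (fun ξ => ‖𝓕 g ξ‖) + (2 : ℝ) • ∑ j, G j) 2 volume :=
        eLpNorm_mono_real fun ξ => by
          simpa [G] using norm_weight_mul_fourier_succ_le hs hg hdiff hfderiv ξ
    _ ≤ eLpNorm (A • fun ξ => ‖𝓕 g ξ‖) 2 volume + eLpNorm ((2 : ℝ) • ∑ j, G j) 2 volume :=
        eLpNorm_add_le (hfourier.const_smul _)
          ((Finset.aestronglyMeasurable_sum _ fun j _ => hG j).const_smul _) (by norm_num)
    _ = ENNReal.ofReal A * funSobolevNorm 0 g + 2 * eLpNorm (∑ j, G j) 2 volume := by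
        rw [eLpNorm_const_smul, eLpNorm_const_smul, eLpNorm_norm, ← ofReal_norm, ← ofReal_norm,
          Real.norm_of_nonneg (by positivity)]
        simp [funSobolevNorm]
    _ ≤ ENNReal.ofReal A * funSobolevNorm 0 g + 2 * ∑ j, eLpNorm (G j) 2 volume := by
        gcongr
        exact eLpNorm_sum_le (fun j _ => hG j) (by norm_num)
    _ = _ := by simp only [G, eLpNorm_norm, funSobolevNorm]

lemma funSobolevNorm_fderiv_le (s : ℝ) (f : 𝓢(Space d, ℂ)) (j : Fin d) :
    funSobolevNorm s (fun x => fderiv ℝ f x (basisVec j)) ≤ funSobolevNorm (s + 1) f := by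
  refine eLpNorm_mono fun ξ => ?_
  have hb := bracket_pos ξ
  rw [norm_mul, norm_mul, norm_ofReal_bracket_rpow, norm_ofReal_bracket_rpow,
    norm_fourier_fderiv_apply f.integrable f.differentiable
      (SchwartzMap.fderivCLM ℝ (Space d) ℂ f).integrable]
  calc bracket ξ ^ (s / 2) * (|inner ℝ ((2 * Real.pi) • ξ) (basisVec j)| * ‖𝓕 (⇑f) ξ‖)
      ≤ bracket ξ ^ (s / 2) * (bracket ξ ^ ((1 : ℝ) / 2) * ‖𝓕 (⇑f) ξ‖) := by
        gcongr
        exact abs_inner_basisVec_le ξ j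
    _ = bracket ξ ^ ((s + 1) / 2) * ‖𝓕 (⇑f) ξ‖ := by
        rw [← mul_assoc, ← Real.rpow_add hb, add_div]

/-- The square of the constant in the Sobolev embedding `H^ρ ⊂ L^∞`. -/
def bracketMass (d : ℕ) (ρ : ℝ) : ℝ≥0∞ := ∫⁻ ξ : Space d, ENNReal.ofReal (bracket ξ ^ (-ρ))

lemma bracketMass_lt_top {ρ : ℝ} (hρ : (d : ℝ) / 2 < ρ) : bracketMass d ρ < ∞ := by
  have hint : Integrable (fun x : Space d => ((1 : ℝ) + ‖x‖ ^ 2) ^ (-(2 * ρ) / 2)) volume :=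
    integrable_rpow_neg_one_add_norm_sq (by simp; linarith)
  unfold bracketMass bracket
  convert (hint.comp_smul (R := 2 * Real.pi) (by positivity)).lintegral_lt_top using 5
  ring

lemma enorm_sq_le_bracketMass_mul (ρ : ℝ) (f : 𝓢(Space d, ℂ)) (x : Space d) :
    ‖f x‖ₑ ^ 2 ≤ bracketMass d ρ * funSobolevNorm ρ f ^ 2 := by
  have hm : ∀ p : ℝ, AEMeasurable (fun ξ : Space d => ENNReal.ofReal (bracket ξ ^ p)) volume :=
    fun p => (continuous_bracket_rpow p).measurable.ennreal_ofReal.aemeasurable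
  calc ‖f x‖ₑ ^ 2 ≤ (∫⁻ ξ, ‖𝓕 (f : Space d → ℂ) ξ‖ₑ) ^ 2 := by
        gcongr
        exact enorm_schwartz_le_lintegral_fourier f x
    _ = (∫⁻ ξ : Space d, ENNReal.ofReal (bracket ξ ^ (-ρ / 2)) *
          (ENNReal.ofReal (bracket ξ ^ (ρ / 2)) * ‖𝓕 (f : Space d → ℂ) ξ‖ₑ)) ^ 2 := by
        congr 2 with ξ
        have hb := bracket_pos ξ
        rw [← mul_assoc, ← ENNReal.ofReal_mul (by positivity), ← Real.rpow_add hb, neg_div,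
          neg_add_cancel, Real.rpow_zero, ENNReal.ofReal_one, one_mul]
    _ ≤ _ := lintegral_mul_sq_le (hm _)
          ((hm _).mul (continuous_fourier f.integrable).measurable.enorm.aemeasurable)
    _ = bracketMass d ρ * funSobolevNorm ρ f ^ 2 := by
        simp_rw [funSobolevNorm_sq, bracketMass, mul_pow, ofReal_bracket_rpow_half_sq]

section Product

variable {V : Type*} [NormedAddCommGroup V] [InnerProductSpace ℝ V] [FiniteDimensional ℝ V]
  [MeasurableSpace V] [BorelSpace V]

lemma fourier_schwartz_mul_apply (f g : 𝓢(V, ℂ)) (ξ : V) :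
    𝓕 (fun x => f x * g x) ξ = ∫ η, 𝓕 (f : V → ℂ) (ξ - η) * 𝓕 (g : V → ℂ) η := by
  have hinv : ∀ (u : 𝓢(V, ℂ)) (η : V), (𝓕⁻ u) η = 𝓕 (u : V → ℂ) (-η) := fun u η => by
    rw [SchwartzMap.fourierInv_coe, Real.fourierInv_eq_fourier_neg]
  have hprod : (SchwartzMap.pairing (.mul ℂ ℂ) f g : V → ℂ) = fun x => f x * g x := rfl
  calc 𝓕 (fun x => f x * g x) ξ
      = (SchwartzMap.convolution (.mul ℂ ℂ) (𝓕⁻ f) (𝓕⁻ g)) (-ξ) := by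
        simp [← hprod, SchwartzMap.convolution, hinv]
    _ = ∫ t, (𝓕⁻ f) t * (𝓕⁻ g) (-ξ - t) := SchwartzMap.convolution_apply _ _ _ _
    _ = ∫ η, (𝓕⁻ f) (η - ξ) * (𝓕⁻ g) (-ξ - (η - ξ)) :=
        (integral_sub_right_eq_self (fun t => (𝓕⁻ f) t * (𝓕⁻ g) (-ξ - t)) ξ).symm
    _ = _ := by simp [hinv]

end Product

lemma lintegral_lintegral_sub_mul {G : Type*} [AddGroup G] [MeasurableSpace G] [MeasurableAdd₂ G]
    [MeasurableNeg G] {μ : Measure G} [SFinite μ] [μ.IsAddRightInvariant] {A B : G → ℝ≥0∞}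
    (hA : Measurable A) (hB : Measurable B) :
    ∫⁻ ξ, ∫⁻ η, A (ξ - η) * B η ∂μ ∂μ = (∫⁻ ξ, A ξ ∂μ) * ∫⁻ η, B η ∂μ := by
  have hAB : Measurable (Function.uncurry fun ξ η => A (ξ - η) * B η) :=
    (hA.comp (measurable_fst.sub measurable_snd)).mul (hB.comp measurable_snd)
  rw [lintegral_lintegral_swap hAB.aemeasurable, ← lintegral_const_mul _ hB]
  refine lintegral_congr fun η => ?_
  rw [lintegral_mul_const _ (by exact hA.comp (measurable_id.sub_const η)),
    lintegral_sub_right_eq_self]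

lemma bracket_le (ξ η : Space d) : bracket ξ ≤ 4 * max (bracket (ξ - η)) (bracket η) := by
  have htriangle : ‖(2 * Real.pi) • ξ‖ ≤ ‖(2 * Real.pi) • (ξ - η)‖ + ‖(2 * Real.pi) • η‖ := by
    refine le_trans (le_of_eq ?_) (norm_add_le _ _)
    rw [← smul_add, sub_add_cancel]
  have hsum : bracket ξ ≤ 2 * bracket (ξ - η) + 2 * bracket η := by
    unfold bracket
    have := norm_nonneg ((2 * Real.pi) • ξ)
    nlinarith [sq_nonneg (‖(2 * Real.pi) • (ξ - η)‖ - ‖(2 * Real.pi) • η‖)]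
  linarith [le_max_left (bracket (ξ - η)) (bracket η), le_max_right (bracket (ξ - η)) (bracket η)]

lemma rpow_neg_mul_rpow_neg_le {X Y a b : ℝ} (hX : 0 < X) (hY : 0 < Y) (ha : 0 ≤ a)
    (hb : 0 ≤ b) : X ^ (-a) * Y ^ (-b) ≤ X ^ (-(a + b)) + Y ^ (-(a + b)) := by
  have hsplit : ∀ {Z : ℝ}, 0 < Z → Z ^ (-a) * Z ^ (-b) = Z ^ (-(a + b)) := fun hZ => by
    rw [← Real.rpow_add hZ, neg_add]
  rcases le_total X Y with h | h
  · calc X ^ (-a) * Y ^ (-b) ≤ X ^ (-a) * X ^ (-b) := by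
          gcongr ?_ * ?_
          exact Real.rpow_le_rpow_of_nonpos hX h (neg_nonpos.2 hb)
      _ ≤ _ := by
          rw [hsplit hX]
          exact le_add_of_nonneg_right (by positivity)
  · calc X ^ (-a) * Y ^ (-b) ≤ Y ^ (-a) * Y ^ (-b) := by
          gcongr ?_ * ?_
          exact Real.rpow_le_rpow_of_nonpos hY h (neg_nonpos.2 ha)
      _ ≤ _ := by
          rw [hsplit hY]
          exact le_add_of_nonneg_left (by positivity)

lemma max_rpow_mul_rpow_neg_mul_rpow_neg_le {X Y k s₁ s₂ : ℝ} (hX : 0 < X) (hY : 0 < Y)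
    (hk : 0 ≤ k) (h₁ : k ≤ s₁) (h₂ : k ≤ s₂) :
    max X Y ^ k * (X ^ (-s₁) * Y ^ (-s₂)) ≤ X ^ (-(s₁ + s₂ - k)) + Y ^ (-(s₁ + s₂ - k)) := by
  rcases max_choice X Y with h | h <;> rw [h]
  · have := rpow_neg_mul_rpow_neg_le hX hY (sub_nonneg.2 h₁) (hk.trans h₂)
    rw [show s₁ - k + s₂ = s₁ + s₂ - k by ring] at this
    rwa [← mul_assoc, ← Real.rpow_add hX, show k + -s₁ = -(s₁ - k) by ring]
  · have := rpow_neg_mul_rpow_neg_le hX hY (hk.trans h₁) (sub_nonneg.2 h₂)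
    rw [show s₁ + (s₂ - k) = s₁ + s₂ - k by ring] at this
    rwa [mul_left_comm, ← Real.rpow_add hY, show k + -s₂ = -(s₂ - k) by ring]

lemma bracket_kernel_le {k s₁ s₂ : ℝ} (hk : 0 ≤ k) (h₁ : k ≤ s₁) (h₂ : k ≤ s₂) (ξ η : Space d) :
    bracket ξ ^ k * (bracket (ξ - η) ^ (-s₁) * bracket η ^ (-s₂)) ≤
      4 ^ k * (bracket (ξ - η) ^ (-(s₁ + s₂ - k)) + bracket η ^ (-(s₁ + s₂ - k))) := by
  have hX := bracket_pos (ξ - η)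
  have hY := bracket_pos η
  calc _ ≤ (4 * max (bracket (ξ - η)) (bracket η)) ^ k *
        (bracket (ξ - η) ^ (-s₁) * bracket η ^ (-s₂)) := by
        gcongr
        · exact (bracket_pos ξ).le
        · exact bracket_le ξ η
    _ = 4 ^ k * (max (bracket (ξ - η)) (bracket η) ^ k *
        (bracket (ξ - η) ^ (-s₁) * bracket η ^ (-s₂))) := by
        rw [Real.mul_rpow (by norm_num) (by positivity), mul_assoc]
    _ ≤ _ := by
        gcongr
        exact max_rpow_mul_rpow_neg_mul_rpow_neg_le hX hY hk h₁ h₂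

lemma lintegral_bracket_kernel_le {k s₁ s₂ : ℝ} (hk : 0 ≤ k) (h₁ : k ≤ s₁) (h₂ : k ≤ s₂)
    (ξ : Space d) :
    ∫⁻ η : Space d, ENNReal.ofReal (bracket ξ ^ k * (bracket (ξ - η) ^ (-s₁) * bracket η ^ (-s₂)))
      ≤ ENNReal.ofReal (2 * 4 ^ k) * bracketMass d (s₁ + s₂ - k) := by
  set w : Space d → ℝ≥0∞ := fun η => ENNReal.ofReal (bracket η ^ (-(s₁ + s₂ - k)))
  have hw : Measurable w := (continuous_bracket_rpow _).measurable.ennreal_ofReal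
  calc _ ≤ ∫⁻ η : Space d, ENNReal.ofReal (4 ^ k) * (w (ξ - η) + w η) := by
        refine lintegral_mono fun η => ?_
        dsimp only [w]
        rw [← ENNReal.ofReal_add (Real.rpow_nonneg (bracket_pos _).le _)
          (Real.rpow_nonneg (bracket_pos _).le _), ← ENNReal.ofReal_mul (by positivity)]
        exact ENNReal.ofReal_le_ofReal (bracket_kernel_le hk h₁ h₂ ξ η)
    _ = ENNReal.ofReal (4 ^ k) * (2 * bracketMass d (s₁ + s₂ - k)) := by
        rw [lintegral_const_mul' _ _ ENNReal.ofReal_ne_top, lintegral_add_right _ hw,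
          lintegral_sub_left_eq_self w ξ, ← two_mul]
        rfl
    _ = _ := by
        rw [← mul_assoc, mul_comm _ 2, ENNReal.ofReal_mul (by norm_num), ENNReal.ofReal_ofNat]

/-- The density of the squared `H^s` norm on the Fourier side. -/
def sobolevDensity (s : ℝ) (g : Space d → ℂ) (ξ : Space d) : ℝ≥0∞ :=
  ENNReal.ofReal (bracket ξ ^ s) * ‖𝓕 g ξ‖ₑ ^ 2

lemma measurable_sobolevDensity (s : ℝ) {g : Space d → ℂ} (hg : Integrable g) :
    Measurable (sobolevDensity s g) :=
  (continuous_bracket_rpow s).measurable.ennreal_ofReal.mul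
    ((continuous_fourier hg).measurable.enorm.pow_const 2)

lemma lintegral_sobolevDensity (s : ℝ) (g : Space d → ℂ) :
    ∫⁻ ξ, sobolevDensity s g ξ = funSobolevNorm s g ^ 2 :=
  (funSobolevNorm_sq s g).symm

lemma enorm_fourier_mul_sq_le (s₁ s₂ : ℝ) (f g : 𝓢(Space d, ℂ)) (ξ : Space d) :
    ‖𝓕 (fun x => f x * g x) ξ‖ₑ ^ 2 ≤
      (∫⁻ η : Space d, ENNReal.ofReal (bracket (ξ - η) ^ (-s₁) * bracket η ^ (-s₂))) *
        ∫⁻ η, sobolevDensity s₁ f (ξ - η) * sobolevDensity s₂ g η := by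
  set w : ℝ → ℝ → Space d → ℝ≥0∞ := fun a b η =>
    ENNReal.ofReal (bracket (ξ - η) ^ (a / 2)) * ENNReal.ofReal (bracket η ^ (b / 2))
  set F : Space d → ℝ≥0∞ := fun η => ‖𝓕 (f : Space d → ℂ) (ξ - η)‖ₑ * ‖𝓕 (g : Space d → ℂ) η‖ₑ
  have hb : ∀ a : ℝ, Measurable fun η : Space d => ENNReal.ofReal (bracket η ^ (a / 2)) :=
    fun a => (continuous_bracket_rpow _).measurable.ennreal_ofReal
  have hw : ∀ a b, Measurable (w a b) := fun a b =>
    ((hb a).comp (measurable_id.const_sub ξ)).mul (hb b)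
  have hF : Measurable F :=
    ((continuous_fourier f.integrable).measurable.comp (measurable_id.const_sub ξ)).enorm.mul
      (continuous_fourier g.integrable).measurable.enorm
  have hcancel : ∀ (a : ℝ) (η : Space d), ENNReal.ofReal (bracket η ^ (-a / 2)) *
      ENNReal.ofReal (bracket η ^ (a / 2)) = 1 := fun a η => by
    rw [← ENNReal.ofReal_mul (Real.rpow_nonneg (bracket_pos η).le _),
      ← Real.rpow_add (bracket_pos η), neg_div, neg_add_cancel, Real.rpow_zero, ENNReal.ofReal_one]
  calc ‖𝓕 (fun x => f x * g x) ξ‖ₑ ^ 2 ≤ (∫⁻ η, F η) ^ 2 := by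
        rw [fourier_schwartz_mul_apply]
        gcongr
        exact (enorm_integral_le_lintegral_enorm _).trans_eq (by simp only [enorm_mul, F])
    _ = (∫⁻ η, w (-s₁) (-s₂) η * (w s₁ s₂ η * F η)) ^ 2 := by
        congr 2 with η
        have hww : w (-s₁) (-s₂) η * w s₁ s₂ η = 1 := by
          simp only [w]
          rw [mul_mul_mul_comm, hcancel, hcancel, one_mul]
        rw [← mul_assoc, hww, one_mul]
    _ ≤ (∫⁻ η, w (-s₁) (-s₂) η ^ 2) * ∫⁻ η, (w s₁ s₂ η * F η) ^ 2 :=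
        lintegral_mul_sq_le (hw _ _).aemeasurable ((hw _ _).mul hF).aemeasurable
    _ = _ := by
        congr 2 with η
        · simp only [w, mul_pow, ofReal_bracket_rpow_half_sq]
          rw [ENNReal.ofReal_mul (Real.rpow_nonneg (bracket_pos _).le _)]
        · simp only [w, F, mul_pow, ofReal_bracket_rpow_half_sq, sobolevDensity]
          ring

lemma sobolevDensity_mul_le {k s₁ s₂ : ℝ} (hk : 0 ≤ k) (h₁ : k ≤ s₁) (h₂ : k ≤ s₂)
    (f g : 𝓢(Space d, ℂ)) (ξ : Space d) :
    sobolevDensity k (fun x => f x * g x) ξ ≤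
      ENNReal.ofReal (2 * 4 ^ k) * bracketMass d (s₁ + s₂ - k) *
        ∫⁻ η, sobolevDensity s₁ f (ξ - η) * sobolevDensity s₂ g η := by
  refine (mul_le_mul_right (enorm_fourier_mul_sq_le s₁ s₂ f g ξ) _).trans ?_
  rw [← mul_assoc, ← lintegral_const_mul' _ _ ENNReal.ofReal_ne_top]
  gcongr
  simp_rw [← ENNReal.ofReal_mul (Real.rpow_nonneg (bracket_pos ξ).le k)]
  exact lintegral_bracket_kernel_le hk h₁ h₂ ξ

/-- The constant of the product law `H^{s₁} · H^{s₂} ⊂ H^k`, with `ρ = s₁ + s₂ - k`. -/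
def prodConst (d : ℕ) (k ρ : ℝ) : ℝ≥0∞ :=
  (ENNReal.ofReal (2 * 4 ^ k) * bracketMass d ρ) ^ ((1 : ℝ) / 2)

lemma prodConst_ne_top {k ρ : ℝ} (hρ : (d : ℝ) / 2 < ρ) : prodConst d k ρ ≠ ∞ :=
  ENNReal.rpow_ne_top_of_nonneg (by norm_num)
    (ENNReal.mul_ne_top ENNReal.ofReal_ne_top (bracketMass_lt_top hρ).ne)

lemma prodConst_sq (d : ℕ) (k ρ : ℝ) :
    prodConst d k ρ ^ 2 = ENNReal.ofReal (2 * 4 ^ k) * bracketMass d ρ := by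
  rw [prodConst, ← ENNReal.rpow_natCast, ← ENNReal.rpow_mul]
  norm_num

lemma funSobolevNorm_mul_le {k s₁ s₂ : ℝ} (hk : 0 ≤ k) (h₁ : k ≤ s₁) (h₂ : k ≤ s₂)
    (f g : 𝓢(Space d, ℂ)) :
    funSobolevNorm k (fun x => f x * g x) ≤
      prodConst d k (s₁ + s₂ - k) * (funSobolevNorm s₁ f * funSobolevNorm s₂ g) := by
  refine (ENNReal.pow_right_strictMono two_ne_zero).le_iff_le.1 ?_
  have hmeas : ∀ (s : ℝ) (u : 𝓢(Space d, ℂ)), Measurable (sobolevDensity s u) :=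
    fun s u => measurable_sobolevDensity s u.integrable
  calc funSobolevNorm k (fun x => f x * g x) ^ 2
      ≤ ∫⁻ ξ, prodConst d k (s₁ + s₂ - k) ^ 2 *
          ∫⁻ η, sobolevDensity s₁ f (ξ - η) * sobolevDensity s₂ g η := by
        rw [← lintegral_sobolevDensity, prodConst_sq]
        exact lintegral_mono (sobolevDensity_mul_le hk h₁ h₂ f g)
    _ = prodConst d k (s₁ + s₂ - k) ^ 2 * (funSobolevNorm s₁ f ^ 2 * funSobolevNorm s₂ g ^ 2) := by
        rw [lintegral_const_mul, lintegral_lintegral_sub_mul (hmeas _ _) (hmeas _ _),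
          lintegral_sobolevDensity, lintegral_sobolevDensity]
        exact ((((hmeas s₁ f).comp (measurable_fst.sub measurable_snd)).mul
          ((hmeas s₂ g).comp measurable_snd))).lintegral_prod_right'
    _ = _ := by rw [mul_pow, mul_pow]

section Composition

open LineDeriv

/-- The real-linear map `w ↦ α w + β w̄`, that is, the real differential of a function on `ℂ` with
Wirtinger derivatives `α = ∂_z` and `β = ∂_z̄`. -/
def wirtinger (α β : ℂ) : ℂ →L[ℝ] ℂ :=
  α • (ContinuousLinearMap.id ℝ ℂ) + β • (Complex.conjCLE : ℂ →L[ℝ] ℂ)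

@[simp] lemma wirtinger_apply (α β w : ℂ) :
    wirtinger α β w = α * w + β * (starRingEnd ℂ) w := by
  simp [wirtinger]

lemma norm_wirtinger_le (α β : ℂ) : ‖wirtinger α β‖ ≤ ‖α‖ + ‖β‖ := by
  refine ContinuousLinearMap.opNorm_le_bound _ (by positivity) fun w => ?_
  rw [wirtinger_apply, add_mul]
  refine (norm_add_le _ _).trans_eq ?_
  rw [norm_mul, norm_mul, RCLike.norm_conj]

lemma continuous_wirtinger {X : Type*} [TopologicalSpace X] {α β : X → ℂ} (hα : Continuous α)
    (hβ : Continuous β) : Continuous fun x => wirtinger (α x) (β x) := by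
  unfold wirtinger
  fun_prop

lemma hasFDerivAt_wirtinger {F : ℂ → ℂ} {L : ℂ →L[ℝ] ℂ} {z α β : ℂ} (h : HasFDerivAt F L z)
    (hL : ∀ w, L w = α * w + β * (starRingEnd ℂ) w) : HasFDerivAt F (wirtinger α β) z :=
  h.congr_fderiv (ContinuousLinearMap.ext fun w => by rw [hL, wirtinger_apply])

/-- `F` is `k` times continuously real-differentiable, and it and its iterated Wirtinger derivatives
up to order `k` are bounded by `B` on the disc of radius `M`. -/
def WirtingerBound (M B : ℝ) : ℕ → (ℂ → ℂ) → Prop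
  | 0, F => Continuous F ∧ ∀ z, ‖z‖ ≤ M → ‖F z‖ ≤ B
  | k + 1, F => (Continuous F ∧ ∀ z, ‖z‖ ≤ M → ‖F z‖ ≤ B) ∧
      ∃ α β : ℂ → ℂ, (∀ z, HasFDerivAt F (wirtinger (α z) (β z)) z) ∧
        WirtingerBound M B k α ∧ WirtingerBound M B k β

namespace WirtingerBound

variable {M B B' : ℝ} {k : ℕ} {F G : ℂ → ℂ}

lemma zero (h : WirtingerBound M B k F) : WirtingerBound M B 0 F := by
  cases k with
  | zero => exact h
  | succ k => exact h.1

lemma continuous (h : WirtingerBound M B k F) : Continuous F := h.zero.1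

lemma norm_le (h : WirtingerBound M B k F) {z : ℂ} (hz : ‖z‖ ≤ M) : ‖F z‖ ≤ B := h.zero.2 z hz

lemma of_succ (h : WirtingerBound M B (k + 1) F) : WirtingerBound M B k F := by
  induction k generalizing F with
  | zero => exact h.1
  | succ k ih =>
    obtain ⟨h0, α, β, hder, hα, hβ⟩ := h
    exact ⟨h0, α, β, hder, ih hα, ih hβ⟩

lemma mono (hB : B ≤ B') (h : WirtingerBound M B k F) : WirtingerBound M B' k F := by
  have bound_mono : ∀ {G}, WirtingerBound M B 0 G → WirtingerBound M B' 0 G := fun hG =>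
    ⟨hG.1, fun z hz => (hG.2 z hz).trans hB⟩
  induction k generalizing F with
  | zero => exact bound_mono h
  | succ k ih =>
    obtain ⟨h0, α, β, hder, hα, hβ⟩ := h
    exact ⟨bound_mono h0, α, β, hder, ih hα, ih hβ⟩

lemma add (hF : WirtingerBound M B k F) (hG : WirtingerBound M B' k G) :
    WirtingerBound M (B + B') k (fun z => F z + G z) := by
  have hFG : WirtingerBound M (B + B') 0 (fun z => F z + G z) :=
    ⟨hF.continuous.add hG.continuous, fun z hz =>
      (norm_add_le _ _).trans (add_le_add (hF.norm_le hz) (hG.norm_le hz))⟩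
  induction k generalizing F G with
  | zero => exact hFG
  | succ k ih =>
    obtain ⟨-, α, β, hder, hα, hβ⟩ := hF
    obtain ⟨-, α', β', hder', hα', hβ'⟩ := hG
    have add_zero_order : ∀ {f g : ℂ → ℂ}, WirtingerBound M B k f → WirtingerBound M B' k g →
        WirtingerBound M (B + B') 0 (fun z => f z + g z) := fun hf hg =>
      ⟨hf.continuous.add hg.continuous, fun z hz =>
        (norm_add_le _ _).trans (add_le_add (hf.norm_le hz) (hg.norm_le hz))⟩
    refine ⟨hFG, fun z => α z + α' z, fun z => β z + β' z, fun z => ?_,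
      ih hα hα' (add_zero_order hα hα'), ih hβ hβ' (add_zero_order hβ hβ')⟩
    refine hasFDerivAt_wirtinger ((hder z).add (hder' z)) fun w => ?_
    rw [add_apply, wirtinger_apply, wirtinger_apply]
    ring

lemma const_mul (hF : WirtingerBound M B k F) (c : ℂ) :
    WirtingerBound M (‖c‖ * B) k (fun z => c * F z) := by
  have const_mul_zero_order : ∀ {G : ℂ → ℂ}, WirtingerBound M B 0 G →
      WirtingerBound M (‖c‖ * B) 0 (fun z => c * G z) := fun hG => by
    refine ⟨hG.1.const_mul c, fun z hz => ?_⟩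
    rw [norm_mul]
    gcongr
    exact hG.2 z hz
  induction k generalizing F with
  | zero => exact const_mul_zero_order hF
  | succ k ih =>
    obtain ⟨h0, α, β, hder, hα, hβ⟩ := hF
    refine ⟨const_mul_zero_order h0, fun z => c * α z, fun z => c * β z, fun z => ?_,
      ih hα, ih hβ⟩
    refine hasFDerivAt_wirtinger ((hder z).const_mul c) fun w => ?_
    rw [smul_apply, wirtinger_apply, smul_eq_mul]
    ring

end WirtingerBound

/-- The product of Schwartz functions. -/
def schwartzMul (f g : 𝓢(Space d, ℂ)) : 𝓢(Space d, ℂ) :=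
  SchwartzMap.pairing (ContinuousLinearMap.mul ℂ ℂ) f g

@[simp] lemma schwartzMul_apply (f g : 𝓢(Space d, ℂ)) (x : Space d) :
    schwartzMul f g x = f x * g x := by
  simp [schwartzMul, SchwartzMap.pairing_apply_apply]

/-- The complex conjugate of a Schwartz function. -/
def schwartzConj (f : 𝓢(Space d, ℂ)) : 𝓢(Space d, ℂ) :=
  SchwartzMap.postcompCLM (𝕜 := ℝ) (Complex.conjCLE : ℂ →L[ℝ] ℂ) f

@[simp] lemma schwartzConj_apply (f : 𝓢(Space d, ℂ)) (x : Space d) :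
    schwartzConj f x = (starRingEnd ℂ) (f x) := by
  simp [schwartzConj]

lemma funSobolevNorm_schwartzConj (s : ℝ) (f : 𝓢(Space d, ℂ)) :
    funSobolevNorm s (schwartzConj f) = funSobolevNorm s f := by
  rw [← funSobolevNorm_conj]
  congr 1 with x
  simp

lemma funSobolevNorm_lineDerivOp_le (s : ℝ) (f : 𝓢(Space d, ℂ)) (j : Fin d) :
    funSobolevNorm s (∂_{basisVec j} f : 𝓢(Space d, ℂ)) ≤ funSobolevNorm (s + 1) f :=
  funSobolevNorm_fderiv_le s f j

lemma funSobolevNorm_schwartzMul_le {ρ k : ℝ} (hk : 0 ≤ k) (hkρ : k + 1 ≤ ρ)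
    (w f : 𝓢(Space d, ℂ)) :
    funSobolevNorm k (schwartzMul w f) ≤
      prodConst d k ρ * funSobolevNorm (ρ - 1) w * funSobolevNorm (k + 1) f := by
  have h := funSobolevNorm_mul_le hk (le_sub_iff_add_le.2 hkρ) (le_add_of_nonneg_right zero_le_one)
    w f
  rw [show ρ - 1 + (k + 1) - k = ρ by ring, ← mul_assoc] at h
  simpa only [← schwartzMul_apply] using h

lemma integrable_comp_smul {E : Type*} [NormedAddCommGroup E] [NormedSpace ℂ E] {M B : ℝ}
    {F : ℂ → ℂ} (hF : WirtingerBound M B 0 F) (u : 𝓢(Space d, ℂ)) (hu : ∀ x, ‖u x‖ ≤ M)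
    {f : Space d → E} (hf : Integrable f) : Integrable (fun x => F (u x) • f x) :=
  hf.bdd_smul B (hF.continuous.comp u.continuous).aestronglyMeasurable
    (Eventually.of_forall fun x => hF.norm_le (hu x))

lemma integrable_wirtinger_comp {M B : ℝ} {α β : ℂ → ℂ} (hα : WirtingerBound M B 0 α)
    (hβ : WirtingerBound M B 0 β) (u : 𝓢(Space d, ℂ)) (hu : ∀ x, ‖u x‖ ≤ M)
    (f : 𝓢(Space d, ℂ)) :
    Integrable (fun x => (wirtinger (α (u x)) (β (u x))).comp (fderiv ℝ f x)) := by
  set f' : 𝓢(Space d, Space d →L[ℝ] ℂ) := SchwartzMap.fderivCLM ℝ (Space d) ℂ f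
  have hw := continuous_wirtinger (hα.continuous.comp u.continuous)
    (hβ.continuous.comp u.continuous)
  refine (f'.integrable.norm.const_mul (B + B)).mono'
    (hw.clm_comp f'.continuous).aestronglyMeasurable (Eventually.of_forall fun x => ?_)
  refine (ContinuousLinearMap.opNorm_comp_le _ _).trans ?_
  refine mul_le_mul_of_nonneg_right ?_ (norm_nonneg _)
  exact (norm_wirtinger_le _ _).trans (add_le_add (hα.norm_le (hu x)) (hβ.norm_le (hu x)))

lemma hasFDerivAt_comp_schwartz {F α β : ℂ → ℂ}
    (hder : ∀ z, HasFDerivAt F (wirtinger (α z) (β z)) z) (u : 𝓢(Space d, ℂ)) (x : Space d) :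
    HasFDerivAt (fun x => F (u x)) ((wirtinger (α (u x)) (β (u x))).comp (fderiv ℝ u x)) x :=
  (hder (u x)).comp x (u.hasFDerivAt x)

lemma hasFDerivAt_comp_mul {F α β : ℂ → ℂ} (hder : ∀ z, HasFDerivAt F (wirtinger (α z) (β z)) z)
    (u f : 𝓢(Space d, ℂ)) (x : Space d) :
    HasFDerivAt (fun x => F (u x) * f x) (F (u x) • fderiv ℝ f x +
      f x • (wirtinger (α (u x)) (β (u x))).comp (fderiv ℝ u x)) x :=
  (hasFDerivAt_comp_schwartz hder u x).mul (f.hasFDerivAt x)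

lemma integrable_fderiv_comp_mul {M B : ℝ} {F α β : ℂ → ℂ} (hF : WirtingerBound M B 0 F)
    (hα : WirtingerBound M B 0 α) (hβ : WirtingerBound M B 0 β)
    (hder : ∀ z, HasFDerivAt F (wirtinger (α z) (β z)) z) (u f : 𝓢(Space d, ℂ))
    (hu : ∀ x, ‖u x‖ ≤ M) : Integrable (fderiv ℝ (fun x => F (u x) * f x)) := by
  rw [funext fun x => (hasFDerivAt_comp_mul hder u f x).fderiv]
  exact (integrable_comp_smul hF u hu (SchwartzMap.fderivCLM ℝ (Space d) ℂ f).integrable).add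
    ((integrable_wirtinger_comp hα hβ u hu u).bdd_smul _ f.continuous.aestronglyMeasurable
      (Eventually.of_forall fun x => SchwartzMap.norm_le_seminorm ℝ f x))

lemma funSobolevNorm_zero_comp_mul_le {M B : ℝ} {F : ℂ → ℂ} (hF : WirtingerBound M B 0 F)
    (u f : 𝓢(Space d, ℂ)) (hu : ∀ x, ‖u x‖ ≤ M) :
    funSobolevNorm 0 (fun x => F (u x) * f x) ≤ ENNReal.ofReal B * funSobolevNorm 0 f := by
  have hle : ∀ x, ‖F (u x) * f x‖ ≤ B * ‖f x‖ := fun x => by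
    rw [norm_mul]
    gcongr
    exact hF.norm_le (hu x)
  have hmem : MemLp (fun x => F (u x) * f x) 2 := (f.memLp 2 volume).of_le_mul
    ((hF.continuous.comp u.continuous).mul f.continuous).aestronglyMeasurable
    (Eventually.of_forall hle)
  have hint : Integrable (fun x => F (u x) * f x) := integrable_comp_smul hF u hu f.integrable
  rw [funSobolevNorm_zero hint hmem,
    funSobolevNorm_zero f.integrable (f.memLp 2 volume)]
  exact eLpNorm_le_mul_eLpNorm_of_ae_le_mul (Eventually.of_forall hle) 2

/-- The Schwartz functions bounded by `M` both in `L^∞` and in `H^ρ`. -/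
def schwartzBall (d : ℕ) (ρ M : ℝ) : Set 𝓢(Space d, ℂ) :=
  {u | (∀ x, ‖u x‖ ≤ M) ∧ funSobolevNorm ρ u ≤ ENNReal.ofReal M}

/-- For `u` in `schwartzBall d ρ M`, multiplication by `F(u)` has operator norm at most `C` on
`H^k`, uniformly in the functions `F` with `WirtingerBound M B k F`. -/
def CompMulBound (d : ℕ) (ρ M B : ℝ) (k : ℕ) (C : ℝ≥0∞) : Prop :=
  ∀ F, WirtingerBound M B k F → ∀ u ∈ schwartzBall d ρ M, ∀ f : 𝓢(Space d, ℂ),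
    funSobolevNorm k (fun x => F (u x) * f x) ≤ C * funSobolevNorm k f

lemma CompMulBound.add_le {ρ M B : ℝ} {k : ℕ} {C : ℝ≥0∞} (hC : CompMulBound d ρ M B k C)
    {α β : ℂ → ℂ} (hα : WirtingerBound M B k α) (hβ : WirtingerBound M B k β)
    {u : 𝓢(Space d, ℂ)} (hu : u ∈ schwartzBall d ρ M) (f g : 𝓢(Space d, ℂ)) :
    funSobolevNorm k (fun x => α (u x) * f x + β (u x) * g x) ≤
      C * (funSobolevNorm k f + funSobolevNorm k g) := by
  refine (funSobolevNorm_add_le k (integrable_comp_smul hα.zero u hu.1 f.integrable)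
    (integrable_comp_smul hβ.zero u hu.1 g.integrable)).trans ?_
  rw [mul_add]
  exact add_le_add (hC α hα u hu f) (hC β hβ u hu g)

lemma funSobolevNorm_lineDerivOp_le_of_mem {ρ M : ℝ} {u : 𝓢(Space d, ℂ)}
    (hu : u ∈ schwartzBall d ρ M) (j : Fin d) :
    funSobolevNorm (ρ - 1) (∂_{basisVec j} u : 𝓢(Space d, ℂ)) ≤ ENNReal.ofReal M := by
  have h := funSobolevNorm_lineDerivOp_le (ρ - 1) u j
  rw [sub_add_cancel] at h
  exact h.trans hu.2

lemma CompMulBound.fderiv_comp_mul_le {ρ M B : ℝ} {k : ℕ} (hkρ : (k : ℝ) + 1 ≤ ρ) {C : ℝ≥0∞}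
    (hC : CompMulBound d ρ M B k C) {F α β : ℂ → ℂ} (hF : WirtingerBound M B k F)
    (hα : WirtingerBound M B k α) (hβ : WirtingerBound M B k β)
    (hder : ∀ z, HasFDerivAt F (wirtinger (α z) (β z)) z) {u : 𝓢(Space d, ℂ)}
    (hu : u ∈ schwartzBall d ρ M) (f : 𝓢(Space d, ℂ)) (j : Fin d) :
    funSobolevNorm k (fun x => fderiv ℝ (fun x => F (u x) * f x) x (basisVec j)) ≤
      C * (2 * (prodConst d k ρ * ENNReal.ofReal M) + 1) * funSobolevNorm (k + 1) f := by
  set u' : 𝓢(Space d, ℂ) := ∂_{basisVec j} u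
  set f' : 𝓢(Space d, ℂ) := ∂_{basisVec j} f
  have hmul : ∀ w : 𝓢(Space d, ℂ), funSobolevNorm (ρ - 1) w ≤ ENNReal.ofReal M →
      funSobolevNorm k (schwartzMul w f) ≤
        prodConst d k ρ * ENNReal.ofReal M * funSobolevNorm (k + 1) f := fun w hw =>
    (funSobolevNorm_schwartzMul_le (Nat.cast_nonneg k) hkρ w f).trans (by gcongr)
  have hu' := funSobolevNorm_lineDerivOp_le_of_mem hu j
  have hleibniz : (fun x => fderiv ℝ (fun x => F (u x) * f x) x (basisVec j)) = fun x =>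
      (α (u x) * schwartzMul u' f x + β (u x) * schwartzMul (schwartzConj u') f x) +
      F (u x) * f' x := by
    ext x
    rw [(hasFDerivAt_comp_mul hder u f x).fderiv]
    simp [u', f', SchwartzMap.lineDerivOp_apply_eq_fderiv]
    ring
  rw [hleibniz]
  have hint : ∀ {G : ℂ → ℂ}, WirtingerBound M B k G → ∀ g : 𝓢(Space d, ℂ),
      Integrable fun x => G (u x) * g x := fun hG g =>
    integrable_comp_smul hG.zero u hu.1 g.integrable
  calc _ ≤ C * (funSobolevNorm k (schwartzMul u' f) +
          funSobolevNorm k (schwartzMul (schwartzConj u') f)) + C * funSobolevNorm k f' :=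
        (funSobolevNorm_add_le k ((hint hα _).add (hint hβ _)) (hint hF _)).trans
          (add_le_add (hC.add_le hα hβ hu _ _) (hC F hF u hu _))
    _ ≤ C * (prodConst d k ρ * ENNReal.ofReal M * funSobolevNorm (k + 1) f +
          prodConst d k ρ * ENNReal.ofReal M * funSobolevNorm (k + 1) f) +
          C * funSobolevNorm (k + 1) f := by
        gcongr
        · exact hmul _ hu'
        · exact hmul _ ((funSobolevNorm_schwartzConj _ _).trans_le hu')
        · exact funSobolevNorm_lineDerivOp_le _ _ _
    _ = _ := by ring

lemma CompMulBound.succ {ρ M B : ℝ} {k : ℕ} (hkρ : (k : ℝ) + 1 ≤ ρ) {C : ℝ≥0∞}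
    (hC : CompMulBound d ρ M B k C) :
    CompMulBound d ρ M B (k + 1) (ENNReal.ofReal (2 ^ (((k : ℝ) + 1) / 2)) * ENNReal.ofReal B +
      2 * ∑ _j : Fin d, C * (2 * (prodConst d k ρ * ENNReal.ofReal M) + 1)) := by
  intro F hF u hu f
  have hFk := hF.of_succ
  obtain ⟨hF0, α, β, hder, hα, hβ⟩ := hF
  have hint : Integrable (fun x => F (u x) * f x) :=
    integrable_comp_smul hF0 u hu.1 f.integrable
  push_cast
  refine (funSobolevNorm_succ_le (Nat.cast_nonneg k) hint
    (fun x => (hasFDerivAt_comp_mul hder u f x).differentiableAt)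
    (integrable_fderiv_comp_mul hF0 hα.zero hβ.zero hder u f hu.1)).trans ?_
  rw [add_mul, mul_assoc, mul_assoc 2, Finset.sum_mul]
  gcongr with j
  · refine (funSobolevNorm_zero_comp_mul_le hF0 u f hu.1).trans ?_
    gcongr
    exact funSobolevNorm_mono (by positivity) _
  · exact hC.fderiv_comp_mul_le hkρ hFk hα hβ hder hu f j

theorem exists_compMulBound {ρ : ℝ} (hρ : (d : ℝ) / 2 < ρ) (M B : ℝ) (k : ℕ) (hk : (k : ℝ) ≤ ρ) :
    ∃ C : ℝ≥0∞, C ≠ ∞ ∧ CompMulBound d ρ M B k C := by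
  induction k with
  | zero =>
    refine ⟨ENNReal.ofReal B, ENNReal.ofReal_ne_top, fun F hF u hu f => ?_⟩
    simpa using funSobolevNorm_zero_comp_mul_le hF u f hu.1
  | succ k ih =>
    push_cast at hk
    obtain ⟨C, hC, hbound⟩ := ih (by linarith)
    refine ⟨_, ?_, hbound.succ hk⟩
    have hconst : C * (2 * (prodConst d k ρ * ENNReal.ofReal M) + 1) ≠ ∞ := by
      have := prodConst_ne_top (k := k) hρ
      finiteness
    exact ENNReal.add_ne_top.2 ⟨by finiteness,
      ENNReal.mul_ne_top (by norm_num) (ENNReal.sum_ne_top.2 fun _ _ => hconst)⟩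

lemma funSobolevNorm_zero_comp_le {M B : ℝ} {F : ℂ → ℂ} (hF : Continuous F)
    (hFB : ∀ z, ‖z‖ ≤ M → ‖F z‖ ≤ B * ‖z‖) (u : 𝓢(Space d, ℂ)) (hu : ∀ x, ‖u x‖ ≤ M) :
    funSobolevNorm 0 (fun x => F (u x)) ≤ ENNReal.ofReal B * funSobolevNorm 0 u := by
  have hle : ∀ᵐ x, ‖F (u x)‖ ≤ B * ‖u x‖ := Eventually.of_forall fun x => hFB _ (hu x)
  have hmeas : AEStronglyMeasurable (fun x => F (u x)) :=
    (hF.comp u.continuous).aestronglyMeasurable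
  rw [funSobolevNorm_zero ((u.integrable.norm.const_mul B).mono' hmeas hle)
      ((u.memLp 2 volume).of_le_mul hmeas hle),
    funSobolevNorm_zero u.integrable (u.memLp 2 volume)]
  exact eLpNorm_le_mul_eLpNorm_of_ae_le_mul hle 2

lemma CompMulBound.fderiv_comp_le {ρ M B : ℝ} {k : ℕ} {C : ℝ≥0∞} (hC : CompMulBound d ρ M B k C)
    {F α β : ℂ → ℂ} (hα : WirtingerBound M B k α) (hβ : WirtingerBound M B k β)
    (hder : ∀ z, HasFDerivAt F (wirtinger (α z) (β z)) z) {u : 𝓢(Space d, ℂ)}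
    (hu : u ∈ schwartzBall d ρ M) (j : Fin d) :
    funSobolevNorm k (fun x => fderiv ℝ (fun x => F (u x)) x (basisVec j)) ≤
      C * 2 * funSobolevNorm (k + 1) u := by
  set u' : 𝓢(Space d, ℂ) := ∂_{basisVec j} u
  have hchain : (fun x => fderiv ℝ (fun x => F (u x)) x (basisVec j)) = fun x =>
      α (u x) * u' x + β (u x) * schwartzConj u' x := by
    ext x
    rw [(hasFDerivAt_comp_schwartz hder u x).fderiv]
    simp [u', SchwartzMap.lineDerivOp_apply_eq_fderiv]
  rw [hchain]
  refine (hC.add_le hα hβ hu _ _).trans ?_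
  rw [funSobolevNorm_schwartzConj, ← two_mul, mul_assoc]
  gcongr
  exact funSobolevNorm_lineDerivOp_le k u j

theorem exists_funSobolevNorm_comp_le {ρ : ℝ} (hρ : (d : ℝ) / 2 < ρ) (M B : ℝ) (k : ℕ)
    (hk : (k : ℝ) ≤ ρ) :
    ∃ C : ℝ≥0∞, C ≠ ∞ ∧ ∀ F α β : ℂ → ℂ, (∀ z, HasFDerivAt F (wirtinger (α z) (β z)) z) →
      (∀ z, ‖z‖ ≤ M → ‖F z‖ ≤ B * ‖z‖) → WirtingerBound M B k α → WirtingerBound M B k β →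
      ∀ u ∈ schwartzBall d ρ M,
      funSobolevNorm ((k : ℝ) + 1) (fun x => F (u x)) ≤ C * funSobolevNorm ((k : ℝ) + 1) u := by
  obtain ⟨C, hC, hbound⟩ := exists_compMulBound hρ M B k hk
  refine ⟨ENNReal.ofReal (2 ^ (((k : ℝ) + 1) / 2)) * ENNReal.ofReal B + 2 * ∑ _j : Fin d, C * 2,
    ENNReal.add_ne_top.2 ⟨by finiteness, ENNReal.mul_ne_top (by norm_num)
      (ENNReal.sum_ne_top.2 fun _ _ => by finiteness)⟩, fun F α β hder hFB hα hβ u hu => ?_⟩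
  have hF : Continuous F := continuous_iff_continuousAt.2 fun z => (hder z).continuousAt
  have hint : Integrable (fun x => F (u x)) :=
    (u.integrable.norm.const_mul B).mono' (hF.comp u.continuous).aestronglyMeasurable
      (Eventually.of_forall fun x => hFB _ (hu.1 x))
  have hfderiv : Integrable (fderiv ℝ (fun x => F (u x))) := by
    rw [funext fun x => (hasFDerivAt_comp_schwartz hder u x).fderiv]
    exact integrable_wirtinger_comp hα.zero hβ.zero u hu.1 u
  refine (funSobolevNorm_succ_le (Nat.cast_nonneg k) hint
    (fun x => (hasFDerivAt_comp_schwartz hder u x).differentiableAt) hfderiv).trans ?_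
  rw [add_mul, mul_assoc, mul_assoc 2, Finset.sum_mul]
  gcongr with j
  · refine (funSobolevNorm_zero_comp_le hF hFB u hu.1).trans ?_
    gcongr
    exact funSobolevNorm_mono (by positivity) _
  · exact hbound.fderiv_comp_le hα hβ hder hu j

end Composition

section Monomials

variable {a b : ℕ} {c : ℝ} {z : ℂ}

lemma tendsto_norm_rpow_zero (E : Type*) [SeminormedAddCommGroup E] {p : ℝ} (hp : 0 < p) :
    Tendsto (fun x : E => ‖x‖ ^ p) (𝓝 0) (𝓝 0) := by
  have h : ContinuousAt (fun x : E => ‖x‖ ^ p) 0 :=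
    continuous_norm.continuousAt.rpow_const (Or.inr hp.le)
  simpa [ContinuousAt, Real.zero_rpow hp.ne'] using h

lemma hasFDerivAt_zero_of_norm_le_rpow {E F : Type*} [NormedAddCommGroup E] [NormedSpace ℝ E]
    [NormedAddCommGroup F] [NormedSpace ℝ F] {f : E → F} {p : ℝ} (hp : 1 < p)
    (hf : ∀ x, ‖f x‖ ≤ ‖x‖ ^ p) : HasFDerivAt f (0 : E →L[ℝ] F) 0 := by
  have hf0 : f 0 = 0 := norm_le_zero_iff.1 <| (hf 0).trans_eq <| by
    rw [norm_zero, Real.zero_rpow (by linarith)]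
  rw [hasFDerivAt_iff_isLittleO_nhds_zero, Asymptotics.isLittleO_iff]
  intro ε hε
  filter_upwards [(tendsto_norm_rpow_zero E (sub_pos.2 hp)).eventually (gt_mem_nhds hε)] with x hx
  calc ‖f (0 + x) - f 0 - (0 : E →L[ℝ] F) x‖ = ‖f x‖ := by simp [hf0]
    _ ≤ ‖x‖ ^ (p - 1 + 1) := by simpa using hf x
    _ = ‖x‖ ^ (p - 1) * ‖x‖ := Real.rpow_add_one' (norm_nonneg x) (by linarith)
    _ ≤ ε * ‖x‖ := by gcongr

/-- The function `z^a z̄^b |z|^c`. -/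
def monom (a b : ℕ) (c : ℝ) (z : ℂ) : ℂ :=
  z ^ a * (starRingEnd ℂ z) ^ b * ((‖z‖ ^ c : ℝ) : ℂ)

lemma norm_monom (a b : ℕ) (c : ℝ) (hz : z ≠ 0) :
    ‖monom a b c z‖ = ‖z‖ ^ ((a : ℝ) + b + c) := by
  have hz' : 0 < ‖z‖ := norm_pos_iff.2 hz
  rw [monom, norm_mul, norm_mul, norm_pow, norm_pow, RCLike.norm_conj, Complex.norm_real,
    Real.norm_of_nonneg (by positivity), Real.rpow_add hz', Real.rpow_add hz', Real.rpow_natCast,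
    Real.rpow_natCast]

lemma monom_zero (h : 0 < (a : ℝ) + b + c) : monom a b c 0 = 0 := by
  rcases eq_or_ne a 0 with rfl | ha
  · rcases eq_or_ne b 0 with rfl | hb
    · have hc : c ≠ 0 := by
        rintro rfl
        simp at h
      simp [monom, Real.zero_rpow hc]
    · simp [monom, hb]
  · simp [monom, ha]

lemma norm_monom_le (h : 0 < (a : ℝ) + b + c) (z : ℂ) :
    ‖monom a b c z‖ ≤ ‖z‖ ^ ((a : ℝ) + b + c) := by
  rcases eq_or_ne z 0 with rfl | hz
  · rw [monom_zero h, norm_zero]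
    positivity
  · exact (norm_monom a b c hz).le

lemma hasFDerivAt_pow (a : ℕ) (z : ℂ) :
    HasFDerivAt (fun z : ℂ => z ^ a) (wirtinger (a * z ^ (a - 1)) 0) z :=
  hasFDerivAt_wirtinger ((hasDerivAt_pow a z).hasFDerivAt.restrictScalars ℝ) fun w => by
    simp [mul_comm]

lemma hasFDerivAt_conj_pow (b : ℕ) (z : ℂ) :
    HasFDerivAt (fun z : ℂ => (starRingEnd ℂ z) ^ b)
      (wirtinger 0 (b * (starRingEnd ℂ z) ^ (b - 1))) z :=
  hasFDerivAt_wirtinger ((hasFDerivAt_pow b (starRingEnd ℂ z)).comp z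
    (Complex.conjCLE : ℂ →L[ℝ] ℂ).hasFDerivAt) fun w => by simp

lemma norm_rpow_eq_sq_rpow_half {E : Type*} [SeminormedAddGroup E] (x : E) (c : ℝ) :
    ‖x‖ ^ c = (‖x‖ ^ 2) ^ (c / 2) := by
  rw [← Real.rpow_natCast_mul (norm_nonneg x)]
  congr 1
  push_cast
  ring

lemma hasFDerivAt_norm_rpow_complex (c : ℝ) (hz : z ≠ 0) :
    HasFDerivAt (fun z : ℂ => ((‖z‖ ^ c : ℝ) : ℂ))
      (wirtinger ((c / 2 : ℝ) * (starRingEnd ℂ z) * ((‖z‖ ^ (c - 2) : ℝ) : ℂ))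
        ((c / 2 : ℝ) * z * ((‖z‖ ^ (c - 2) : ℝ) : ℂ))) z := by
  have hsq : HasFDerivAt (fun z : ℂ => ‖z‖ ^ 2) (2 • (innerSL ℝ z)) z :=
    (hasStrictFDerivAt_norm_sq z).hasFDerivAt
  have hrpow := Complex.ofRealCLM.hasFDerivAt.comp z
    (hsq.rpow_const (p := c / 2) (Or.inl (by positivity)))
  rw [norm_rpow_eq_sq_rpow_half z (c - 2), sub_div, div_self two_ne_zero,
    funext fun z : ℂ => congrArg Complex.ofReal (norm_rpow_eq_sq_rpow_half z c)]
  refine hasFDerivAt_wirtinger hrpow fun w => ?_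
  have hinner : (innerSL ℝ z) w = z.re * w.re + z.im * w.im := by
    simp [innerSL_apply_apply, Complex.inner]
    ring
  simp only [ContinuousLinearMap.comp_apply, Complex.ofRealCLM_apply, smul_apply, hinner,
    smul_eq_mul, nsmul_eq_mul]
  apply Complex.ext <;> simp <;> ring

/-- The derivative of `z^a z̄^b |z|^c` with respect to `z`. -/
def monomDz (a b : ℕ) (c : ℝ) (z : ℂ) : ℂ :=
  a * monom (a - 1) b c z + (c / 2 : ℝ) * monom a (b + 1) (c - 2) z

/-- The derivative of `z^a z̄^b |z|^c` with respect to `z̄`. -/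
def monomDzbar (a b : ℕ) (c : ℝ) (z : ℂ) : ℂ :=
  b * monom a (b - 1) c z + (c / 2 : ℝ) * monom (a + 1) b (c - 2) z

lemma monomDz_zero (h : 1 < (a : ℝ) + b + c) : monomDz a b c 0 = 0 := by
  rw [monomDz, monom_zero (a := a) (b := b + 1) (by push_cast; linarith)]
  cases a with
  | zero => simp
  | succ a =>
    push_cast at h
    rw [Nat.add_sub_cancel, monom_zero (by linarith)]
    simp

lemma monomDzbar_zero (h : 1 < (a : ℝ) + b + c) : monomDzbar a b c 0 = 0 := by
  rw [monomDzbar, monom_zero (a := a + 1) (b := b) (by push_cast; linarith)]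
  cases b with
  | zero => simp
  | succ b =>
    push_cast at h
    rw [Nat.add_sub_cancel, monom_zero (by linarith)]
    simp

lemma wirtinger_zero_zero : wirtinger 0 0 = 0 := by
  ext w
  simp

lemma hasFDerivAt_monom_of_norm_rpow (a b : ℕ) {p q : ℂ}
    (h : HasFDerivAt (fun z : ℂ => ((‖z‖ ^ c : ℝ) : ℂ)) (wirtinger p q) z) :
    HasFDerivAt (monom a b c) (wirtinger
      (a * monom (a - 1) b c z + z ^ a * (starRingEnd ℂ z) ^ b * p)
      (b * monom a (b - 1) c z + z ^ a * (starRingEnd ℂ z) ^ b * q)) z := by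
  refine hasFDerivAt_wirtinger
    (((hasFDerivAt_pow a z).mul (hasFDerivAt_conj_pow b z)).mul h) fun w => ?_
  simp only [monom, wirtinger_apply, add_apply, smul_apply, smul_eq_mul, Pi.mul_apply]
  ring

lemma hasFDerivAt_monom_of_ne_zero (a b : ℕ) (c : ℝ) (hz : z ≠ 0) :
    HasFDerivAt (monom a b c) (wirtinger (monomDz a b c z) (monomDzbar a b c z)) z := by
  convert hasFDerivAt_monom_of_norm_rpow a b (hasFDerivAt_norm_rpow_complex c hz) using 2
  · simp only [monomDz, monom, pow_succ]
    ring
  · simp only [monomDzbar, monom, pow_succ]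
    ring

lemma hasFDerivAt_monom (h : 1 < (a : ℝ) + b + c ∨ c = 0) (z : ℂ) :
    HasFDerivAt (monom a b c) (wirtinger (monomDz a b c z) (monomDzbar a b c z)) z := by
  rcases eq_or_ne c 0 with rfl | hc
  · have hone : HasFDerivAt (fun z : ℂ => ((‖z‖ ^ (0 : ℝ) : ℝ) : ℂ)) (wirtinger 0 0) z := by
      simp only [Real.rpow_zero, wirtinger_zero_zero]
      exact hasFDerivAt_const _ _
    convert hasFDerivAt_monom_of_norm_rpow a b hone using 2 <;> simp [monomDz, monomDzbar]
  have hdeg : 1 < (a : ℝ) + b + c := h.resolve_right hc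
  rcases eq_or_ne z 0 with rfl | hz
  · rw [monomDz_zero hdeg, monomDzbar_zero hdeg, wirtinger_zero_zero]
    exact hasFDerivAt_zero_of_norm_le_rpow hdeg (norm_monom_le (by linarith))
  · exact hasFDerivAt_monom_of_ne_zero a b c hz

lemma continuous_monom (h : 0 < (a : ℝ) + b + c ∨ c = 0) : Continuous (monom a b c) := by
  rcases eq_or_ne c 0 with rfl | hc
  · unfold monom
    simp only [Real.rpow_zero]
    fun_prop
  have hdeg : 0 < (a : ℝ) + b + c := h.resolve_right hc
  refine continuous_iff_continuousAt.2 fun z => ?_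
  rcases eq_or_ne z 0 with rfl | hz
  · rw [ContinuousAt, monom_zero hdeg]
    exact squeeze_zero_norm (norm_monom_le hdeg) (tendsto_norm_rpow_zero ℂ hdeg)
  · exact (hasFDerivAt_monom_of_ne_zero a b c hz).continuousAt

lemma wirtingerBound_const_zero (M : ℝ) (k : ℕ) : WirtingerBound M 0 k (fun _ => 0) := by
  induction k with
  | zero => exact ⟨continuous_const, by simp⟩
  | succ k ih =>
    exact ⟨⟨continuous_const, by simp⟩, fun _ => 0, fun _ => 0, fun z =>
      hasFDerivAt_wirtinger (hasFDerivAt_const (0 : ℂ) z) fun w => by simp, ih, ih⟩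

lemma exists_wirtingerBound_of_continuous (M : ℝ) {F : ℂ → ℂ} (hF : Continuous F) :
    ∃ B, WirtingerBound M B 0 F := by
  obtain ⟨B, hB⟩ :=
    (isCompact_closedBall (0 : ℂ) M).exists_bound_of_continuousOn hF.continuousOn
  exact ⟨B, hF, fun z hz => hB z (by simpa using hz)⟩

lemma exists_wirtingerBound_const_mul {M : ℝ} {k : ℕ} {F : ℂ → ℂ} (w : ℂ)
    (h : w ≠ 0 → ∃ B, WirtingerBound M B k F) :
    ∃ B, WirtingerBound M B k (fun z => w * F z) := by
  rcases eq_or_ne w 0 with rfl | hw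
  · exact ⟨0, by simpa using wirtingerBound_const_zero M k⟩
  · obtain ⟨B, hB⟩ := h hw
    exact ⟨_, hB.const_mul w⟩

lemma exists_wirtingerBound_succ {M : ℝ} {k : ℕ} {F α β : ℂ → ℂ}
    (hder : ∀ z, HasFDerivAt F (wirtinger (α z) (β z)) z)
    (hα : ∃ B, WirtingerBound M B k α) (hβ : ∃ B, WirtingerBound M B k β) :
    ∃ B, WirtingerBound M B (k + 1) F := by
  obtain ⟨B, hB⟩ := exists_wirtingerBound_of_continuous M
    (continuous_iff_continuousAt.2 fun z => (hder z).continuousAt)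
  obtain ⟨Bα, hα⟩ := hα
  obtain ⟨Bβ, hβ⟩ := hβ
  exact ⟨max B (max Bα Bβ), hB.mono (le_max_left _ _), α, β, hder,
    hα.mono ((le_max_left _ _).trans (le_max_right _ _)),
    hβ.mono ((le_max_right _ _).trans (le_max_right _ _))⟩

lemma exists_wirtingerBound_monom (M : ℝ) {k : ℕ} (h : (k : ℝ) < (a : ℝ) + b + c ∨ c = 0) :
    ∃ B, WirtingerBound M B k (monom a b c) := by
  induction k generalizing a b c with
  | zero => exact exists_wirtingerBound_of_continuous M (continuous_monom (by simpa using h))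
  | succ k ih =>
    push_cast at h
    have hcast : ∀ {n : ℕ}, (n : ℂ) ≠ 0 → ((n - 1 : ℕ) : ℝ) = n - 1 := fun hn =>
      Nat.cast_pred (Nat.pos_of_ne_zero (Nat.cast_ne_zero.1 hn))
    have hc : ((c / 2 : ℝ) : ℂ) ≠ 0 → c ≠ 0 := fun hc' => by
      rintro rfl
      simp at hc'
    have : (0 : ℝ) ≤ k := Nat.cast_nonneg k
    refine exists_wirtingerBound_succ (hasFDerivAt_monom (h.imp_left fun h => by linarith)) ?_ ?_
    · obtain ⟨B₁, h₁⟩ := exists_wirtingerBound_const_mul (a : ℂ) fun ha =>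
        ih (a := a - 1) (b := b) (c := c) (h.imp_left fun h => by rw [hcast ha]; linarith)
      obtain ⟨B₂, h₂⟩ := exists_wirtingerBound_const_mul ((c / 2 : ℝ) : ℂ) fun hc' =>
        ih (a := a) (b := b + 1) (c := c - 2)
          (Or.inl (by push_cast; linarith [h.resolve_right (hc hc')]))
      exact ⟨_, h₁.add h₂⟩
    · obtain ⟨B₁, h₁⟩ := exists_wirtingerBound_const_mul (b : ℂ) fun hb =>
        ih (a := a) (b := b - 1) (c := c) (h.imp_left fun h => by rw [hcast hb]; linarith)
      obtain ⟨B₂, h₂⟩ := exists_wirtingerBound_const_mul ((c / 2 : ℝ) : ℂ) fun hc' =>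
        ih (a := a + 1) (b := b) (c := c - 2)
          (Or.inl (by push_cast; linarith [h.resolve_right (hc hc')]))
      exact ⟨_, h₁.add h₂⟩

end Monomials

section SobolevNorm

lemma coeFn_fourier_add (f g : L2 d) :
    ((𝓕 (f + g) : L2 d) : Space d → ℂ) =ᵐ[volume] fun ξ => (𝓕 f : L2 d) ξ + (𝓕 g : L2 d) ξ := by
  rw [FourierTransform.fourier_add]
  exact Lp.coeFn_add _ _

lemma coeFn_fourier_sub (f g : L2 d) :
    ((𝓕 (f - g) : L2 d) : Space d → ℂ) =ᵐ[volume] fun ξ => (𝓕 f : L2 d) ξ - (𝓕 g : L2 d) ξ := by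
  have h : 𝓕 (f - g) = 𝓕 f - 𝓕 g := map_sub (Lp.fourierTransformₗᵢ (Space d) ℂ) f g
  rw [h]
  exact Lp.coeFn_sub _ _

lemma coeFn_fourier_smul (c : ℂ) (f : L2 d) :
    ((𝓕 (c • f) : L2 d) : Space d → ℂ) =ᵐ[volume] fun ξ => c * (𝓕 f : L2 d) ξ := by
  rw [FourierTransform.fourier_smul]
  exact Lp.coeFn_smul _ _

lemma sobolevNorm_eq_eLpNorm (s : ℝ) (f : L2 d) : sobolevNorm s f =
    eLpNorm (fun ξ : Space d => ((bracket ξ ^ (s / 2) : ℝ) : ℂ) * (𝓕 f : L2 d) ξ) 2 volume := rfl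

lemma aestronglyMeasurable_weight_mul_fourier_Lp (s : ℝ) (f : L2 d) : AEStronglyMeasurable
    (fun ξ : Space d => ((bracket ξ ^ s : ℝ) : ℂ) * (𝓕 f : L2 d) ξ) volume :=
  (continuous_ofReal_bracket_rpow _).aestronglyMeasurable.mul (Lp.aestronglyMeasurable _)

lemma sobolevNorm_add_le (s : ℝ) (f g : L2 d) :
    sobolevNorm s (f + g) ≤ sobolevNorm s f + sobolevNorm s g := by
  refine (eLpNorm_congr_ae ?_).trans_le (eLpNorm_add_le
    (aestronglyMeasurable_weight_mul_fourier_Lp (s / 2) f)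
    (aestronglyMeasurable_weight_mul_fourier_Lp (s / 2) g) one_le_two)
  filter_upwards [coeFn_fourier_add f g] with ξ hξ
  rw [Pi.add_apply, hξ, mul_add]

lemma sobolevNorm_smul (s : ℝ) (c : ℂ) (f : L2 d) :
    sobolevNorm s (c • f) = ‖c‖ₑ * sobolevNorm s f := by
  rw [sobolevNorm_eq_eLpNorm, sobolevNorm_eq_eLpNorm, ← eLpNorm_const_smul]
  apply eLpNorm_congr_ae
  filter_upwards [coeFn_fourier_smul c f] with ξ hξ
  rw [hξ, Pi.smul_apply, smul_eq_mul, mul_left_comm]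

lemma sobolevNorm_sub_le (s : ℝ) (f g : L2 d) :
    sobolevNorm s (f - g) ≤ sobolevNorm s f + sobolevNorm s g := by
  have h := sobolevNorm_add_le s f ((-1 : ℂ) • g)
  rwa [sobolevNorm_smul, enorm_neg, enorm_one, one_mul, neg_one_smul, ← sub_eq_add_neg] at h

lemma sobolevNorm_le_add_sub (s : ℝ) (f g : L2 d) :
    sobolevNorm s f ≤ sobolevNorm s g + sobolevNorm s (f - g) := by
  simpa using sobolevNorm_add_le s g (f - g)

lemma sobolevNorm_mono {s s' : ℝ} (h : s ≤ s') (f : L2 d) :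
    sobolevNorm s f ≤ sobolevNorm s' f := by
  refine eLpNorm_mono fun ξ => ?_
  rw [norm_mul, norm_mul]
  refine mul_le_mul_of_nonneg_right ?_ (norm_nonneg _)
  refine (norm_ofReal_bracket_rpow (s / 2) ξ).trans_le
    (le_of_le_of_eq ?_ (norm_ofReal_bracket_rpow (s' / 2) ξ).symm)
  exact Real.rpow_le_rpow_of_exponent_le (one_le_bracket ξ) (by linarith)

lemma enorm_le_sobolevNorm {s : ℝ} (h : 0 ≤ s) (f : L2 d) : ‖f‖ₑ ≤ sobolevNorm s f :=
  (sobolevNorm_zero f).symm.trans_le (sobolevNorm_mono h f)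

lemma tendsto_of_tendsto_sobolevNorm_sub {ι : Type*} {l : Filter ι} {s : ℝ} (hs : 0 ≤ s)
    {f : ι → L2 d} {g : L2 d} (h : Tendsto (fun i => sobolevNorm s (f i - g)) l (𝓝 0)) :
    Tendsto f l (𝓝 g) := by
  refine tendsto_iff_edist_tendsto_0.2 (tendsto_of_tendsto_of_tendsto_of_le_of_le
    tendsto_const_nhds h (fun _ => zero_le) fun i => ?_)
  simpa only [edist_eq_enorm_sub] using enorm_le_sobolevNorm hs (f i - g)

-- Along a subsequence the Fourier transforms converge almost everywhere, so this is Fatou's lemma.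
lemma sobolevNorm_le_of_tendsto {s : ℝ} {f : ℕ → L2 d} {g : L2 d} (h : Tendsto f atTop (𝓝 g))
    {R : ℕ → ℝ≥0∞} {r : ℝ≥0∞} (hR : ∀ᶠ n in atTop, sobolevNorm s (f n) ≤ R n)
    (hr : Tendsto R atTop (𝓝 r)) : sobolevNorm s g ≤ r := by
  have hF : Tendsto (fun n => (𝓕 (f n) : L2 d)) atTop (𝓝 (𝓕 g)) :=
    ((Lp.fourierTransformₗᵢ (Space d) ℂ).continuous.tendsto g).comp h
  obtain ⟨ns, hns, hae⟩ := (tendstoInMeasure_of_tendsto_Lp hF).exists_seq_tendsto_ae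
  calc sobolevNorm s g ≤ liminf (fun n => sobolevNorm s (f (ns n))) atTop :=
        Lp.eLpNorm_lim_le_liminf_eLpNorm
          (fun n => aestronglyMeasurable_weight_mul_fourier_Lp (s / 2) (f (ns n))) _
          (hae.mono fun ξ hξ => hξ.const_mul _)
    _ ≤ liminf (fun n => R (ns n)) atTop := liminf_le_liminf (hns.tendsto_atTop.eventually hR)
    _ = r := (hr.comp hns.tendsto_atTop).liminf_eq

lemma isClosed_sobolevBall (s : ℝ) (R : ℝ≥0∞) : IsClosed {f : L2 d | sobolevNorm s f ≤ R} :=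
  IsSeqClosed.isClosed fun _ _ hf h =>
    sobolevNorm_le_of_tendsto h (Eventually.of_forall hf) tendsto_const_nhds

lemma hasTemperateGrowth_bracket_rpow (s : ℝ) :
    (fun ξ : Space d => ((bracket ξ ^ s : ℝ) : ℂ)).HasTemperateGrowth := by
  have hscale : (fun ξ : Space d => (2 * Real.pi) • ξ).HasTemperateGrowth := by fun_prop
  have hbracket : (fun ξ : Space d => (bracket ξ ^ s : ℝ)).HasTemperateGrowth :=
    (Function.hasTemperateGrowth_one_add_norm_sq_rpow (Space d) s).comp hscale
  fun_prop

lemma exists_schwartz_sobolevNorm_sub_le {s : ℝ} {u : L2 d} (hu : sobolevNorm s u < ∞) {ε : ℝ}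
    (hε : 0 < ε) :
    ∃ φ : 𝓢(Space d, ℂ), sobolevNorm s (φ.toLp 2 volume - u) ≤ ENNReal.ofReal ε := by
  have hW : MemLp (fun ξ : Space d => ((bracket ξ ^ (s / 2) : ℝ) : ℂ) * (𝓕 u : L2 d) ξ) 2 volume :=
    ⟨aestronglyMeasurable_weight_mul_fourier_Lp (s / 2) u, hu⟩
  obtain ⟨ψ, hψ⟩ := (SchwartzMap.denseRange_toLpCLM (E := Space d) (F := ℂ) (p := 2) (μ := volume)
    ENNReal.ofNat_ne_top).exists_dist_lt (hW.toLp _) hε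
  set χ : 𝓢(Space d, ℂ) :=
    SchwartzMap.smulLeftCLM ℂ (fun ξ : Space d => ((bracket ξ ^ (-(s / 2)) : ℝ) : ℂ)) ψ with hχ
  refine ⟨𝓕⁻ χ, ?_⟩
  have hfourier : (𝓕 ((𝓕⁻ χ).toLp 2 volume) : L2 d) = χ.toLp 2 volume := by
    rw [SchwartzMap.toLp_fourier_eq, FourierTransform.fourier_fourierInv_eq]
  have heq : sobolevNorm s ((𝓕⁻ χ).toLp 2 volume - u) = ‖ψ.toLp 2 volume - hW.toLp _‖ₑ := by
    rw [sobolevNorm_eq_eLpNorm, Lp.enorm_def]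
    apply eLpNorm_congr_ae
    filter_upwards [coeFn_fourier_sub ((𝓕⁻ χ).toLp 2 volume) u, χ.coeFn_toLp 2 volume,
      ψ.coeFn_toLp 2 volume, hW.coeFn_toLp, Lp.coeFn_sub (ψ.toLp 2 volume) (hW.toLp _)]
      with ξ hF hχξ hψξ hWξ hsub
    rw [hF, hsub, Pi.sub_apply, hψξ, hWξ, hfourier, hχξ, hχ,
      SchwartzMap.smulLeftCLM_apply_apply (hasTemperateGrowth_bracket_rpow _), mul_sub, smul_eq_mul,
      ← mul_assoc, ← Complex.ofReal_mul, ← Real.rpow_add (bracket_pos ξ)]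
    simp
  rw [dist_comm, dist_eq_norm] at hψ
  rw [heq, ← ofReal_norm]
  exact ENNReal.ofReal_le_ofReal hψ.le

lemma exists_schwartz_seq_tendsto {s : ℝ} {u : L2 d} (hu : sobolevNorm s u < ∞) :
    ∃ φ : ℕ → 𝓢(Space d, ℂ),
      Tendsto (fun n => sobolevNorm s ((φ n).toLp 2 volume - u)) atTop (𝓝 0) := by
  choose φ hφ using fun n : ℕ =>
    exists_schwartz_sobolevNorm_sub_le hu (Nat.one_div_pos_of_nat (α := ℝ) (n := n))
  refine ⟨φ, tendsto_of_tendsto_of_tendsto_of_le_of_le tendsto_const_nhds ?_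
    (fun _ => zero_le) hφ⟩
  simpa using ENNReal.tendsto_ofReal (tendsto_one_div_add_atTop_nhds_zero_nat (𝕜 := ℝ))

/-- A finite constant at least `1` for which the Sobolev embedding `H^ρ ⊂ L^∞`, `ρ > d/2`,
holds. -/
def sobolevConst (d : ℕ) (ρ : ℝ) : ℝ≥0∞ := max 1 (bracketMass d ρ ^ (2⁻¹ : ℝ))

lemma sobolevConst_ne_top {ρ : ℝ} (hρ : (d : ℝ) / 2 < ρ) : sobolevConst d ρ ≠ ∞ :=
  max_ne_top ENNReal.one_ne_top
    (ENNReal.rpow_ne_top_of_nonneg (by norm_num) (bracketMass_lt_top hρ).ne)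

lemma one_le_sobolevConst (d : ℕ) (ρ : ℝ) : 1 ≤ sobolevConst d ρ := le_max_left _ _

lemma enorm_schwartz_le_sobolevConst_mul (ρ : ℝ) (f : 𝓢(Space d, ℂ)) (x : Space d) :
    ‖f x‖ₑ ≤ sobolevConst d ρ * funSobolevNorm ρ f := by
  have hsq : (bracketMass d ρ ^ (2⁻¹ : ℝ)) ^ 2 = bracketMass d ρ := by
    rw [← ENNReal.rpow_mul_natCast]
    norm_num
  have h := enorm_sq_le_bracketMass_mul ρ f x
  rw [← hsq, ← mul_pow] at h
  exact ((ENNReal.pow_right_strictMono two_ne_zero).le_iff_le.1 h).trans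
    (mul_le_mul_left (le_max_right _ _) _)

lemma ae_enorm_le_sobolevConst_mul {ρ : ℝ} (hρ : (d : ℝ) / 2 < ρ) (u : L2 d) :
    ∀ᵐ x, ‖u x‖ₑ ≤ sobolevConst d ρ * sobolevNorm ρ u := by
  rcases eq_or_ne (sobolevNorm ρ u) ∞ with htop | htop
  · rw [htop, ENNReal.mul_top (one_pos.trans_le (one_le_sobolevConst d ρ)).ne']
    exact Eventually.of_forall fun _ => le_top
  obtain ⟨φ, hφ⟩ := exists_schwartz_seq_tendsto htop.lt_top
  have hρ0 : 0 ≤ ρ := (by positivity : (0 : ℝ) ≤ d / 2).trans hρ.le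
  obtain ⟨ns, hns, hae⟩ := (tendstoInMeasure_of_tendsto_Lp
    (tendsto_of_tendsto_sobolevNorm_sub hρ0 hφ)).exists_seq_tendsto_ae
  have hlim : Tendsto (fun n => sobolevConst d ρ *
      (sobolevNorm ρ u + sobolevNorm ρ ((φ (ns n)).toLp 2 volume - u))) atTop
      (𝓝 (sobolevConst d ρ * sobolevNorm ρ u)) := by
    simpa using ENNReal.Tendsto.const_mul ((hφ.comp hns.tendsto_atTop).const_add (sobolevNorm ρ u))
      (Or.inr (sobolevConst_ne_top hρ))
  filter_upwards [hae, ae_all_iff.2 fun n => (φ n).coeFn_toLp 2 volume] with x hx hcoe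
  refine le_of_tendsto_of_tendsto' hx.enorm hlim fun n => ?_
  rw [hcoe]
  refine (enorm_schwartz_le_sobolevConst_mul ρ (φ (ns n)) x).trans ?_
  gcongr
  rw [← sobolevNorm_schwartz]
  exact sobolevNorm_le_add_sub ρ _ u

lemma norm_le_toReal_mul_of_enorm_le {E : Type*} [SeminormedAddGroup E] {x : E} {C a : ℝ≥0∞}
    (hC : C ≠ ∞) {M : ℝ} (hM : 0 ≤ M) (ha : a ≤ ENNReal.ofReal M) (h : ‖x‖ₑ ≤ C * a) :
    ‖x‖ ≤ C.toReal * M := by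
  have h' := ENNReal.toReal_mono (by finiteness) (h.trans (mul_le_mul_right ha C))
  rwa [toReal_enorm, ENNReal.toReal_mul, ENNReal.toReal_ofReal hM] at h'

lemma mem_schwartzBall_of_funSobolevNorm_le {ρ : ℝ} (hρ : (d : ℝ) / 2 < ρ) {M : ℝ} (hM : 0 ≤ M)
    {f : 𝓢(Space d, ℂ)} (hf : funSobolevNorm ρ f ≤ ENNReal.ofReal M) :
    f ∈ schwartzBall d ρ ((sobolevConst d ρ).toReal * M) := by
  have hC := sobolevConst_ne_top hρ
  refine ⟨fun x => norm_le_toReal_mul_of_enorm_le hC hM hf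
    (enorm_schwartz_le_sobolevConst_mul ρ f x), hf.trans (ENNReal.ofReal_le_ofReal ?_)⟩
  exact le_mul_of_one_le_left hM (by simpa using ENNReal.toReal_mono hC (one_le_sobolevConst d ρ))

lemma sobolevNorm_map_le_of_schwartz {ρ r : ℝ} (hr : 0 ≤ r) (hρr : ρ ≤ r) {N : L2 d → L2 d}
    (hN : Continuous N) {C M M' : ℝ≥0∞} (hC0 : C ≠ 0) (hC : C ≠ ∞) (hM : M < M')
    (h : ∀ φ : 𝓢(Space d, ℂ), funSobolevNorm ρ φ ≤ M' →
      sobolevNorm r (N (φ.toLp 2 volume)) ≤ C * funSobolevNorm r φ)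
    {u : L2 d} (hu : sobolevNorm ρ u ≤ M) : sobolevNorm r (N u) ≤ C * sobolevNorm r u := by
  rcases eq_or_ne (sobolevNorm r u) ∞ with htop | htop
  · rw [htop, ENNReal.mul_top hC0]
    exact le_top
  obtain ⟨φ, hφ⟩ := exists_schwartz_seq_tendsto htop.lt_top
  have hball : ∀ᶠ n in atTop, M + sobolevNorm r ((φ n).toLp 2 volume - u) < M' := by
    have hlim := hφ.const_add M
    rw [add_zero] at hlim
    exact hlim.eventually (gt_mem_nhds hM)
  refine sobolevNorm_le_of_tendsto
    ((hN.tendsto u).comp (tendsto_of_tendsto_sobolevNorm_sub hr hφ))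
    (R := fun n => C * (sobolevNorm r u + sobolevNorm r ((φ n).toLp 2 volume - u))) ?_ ?_
  · filter_upwards [hball] with n hn
    refine (h (φ n) ?_).trans ?_
    · rw [← sobolevNorm_schwartz]
      exact (sobolevNorm_le_add_sub ρ _ u).trans
        ((add_le_add hu (sobolevNorm_mono hρr _)).trans hn.le)
    · gcongr
      rw [← sobolevNorm_schwartz]
      exact sobolevNorm_le_add_sub r _ u
  · simpa using ENNReal.Tendsto.const_mul (hφ.const_add (sobolevNorm r u)) (Or.inr hC)

lemma sobolevNorm_compLp_schwartz (s : ℝ) {K : NNReal} {g : ℂ → ℂ} (hg : LipschitzWith K g)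
    (hg0 : g 0 = 0) (u : 𝓢(Space d, ℂ)) :
    sobolevNorm s (hg.compLp hg0 (u.toLp 2 volume)) = funSobolevNorm s (fun x => g (u x)) := by
  have hle : ∀ᵐ x, ‖g (u x)‖ ≤ K * ‖u x‖ :=
    Eventually.of_forall fun x => by simpa [hg0] using hg.norm_sub_le (u x) 0
  have hmeas : AEStronglyMeasurable (fun x => g (u x)) :=
    (hg.continuous.comp u.continuous).aestronglyMeasurable
  have hmem : MemLp (fun x => g (u x)) 2 := (u.memLp 2 volume).of_le_mul hmeas hle
  have hcomp : hg.compLp hg0 (u.toLp 2 volume) = hmem.toLp _ := by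
    apply Lp.ext
    filter_upwards [hg.coeFn_compLp hg0 (u.toLp 2 volume), hmem.coeFn_toLp, u.coeFn_toLp 2 volume]
      with x hx hgx hux
    rw [hx, hgx, Function.comp_apply, hux]
  rw [hcomp, sobolevNorm_toLp s ((u.integrable.norm.const_mul K).mono' hmeas hle) hmem]

end SobolevNorm

section Nonlinearity

/-- The nonlinearity `|z|^{2σ} z`. -/
def nonlin (σ : ℝ) (z : ℂ) : ℂ := ((‖z‖ ^ (2 * σ) : ℝ) : ℂ) * z

lemma nonlin_zero (σ : ℝ) : nonlin σ 0 = 0 := by simp [nonlin]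

lemma nonlin_eq_monom (σ : ℝ) : nonlin σ = monom 1 0 (2 * σ) := by
  ext z
  simp [nonlin, monom, mul_comm]

lemma nonlin_natCast_eq_monom (n : ℕ) : nonlin n = monom (n + 1) n 0 := by
  ext z
  have h : ((‖z‖ ^ (2 * (n : ℝ)) : ℝ) : ℂ) = z ^ n * (starRingEnd ℂ z) ^ n := by
    rw [← mul_pow, Complex.mul_conj, Complex.normSq_eq_norm_sq, Real.rpow_mul (norm_nonneg _),
      Real.rpow_natCast]
    norm_num
  rw [nonlin, h]
  simp [monom, pow_succ]
  ring

lemma norm_nonlin_le {σ M : ℝ} (hσ : 0 < σ) {z : ℂ} (hz : ‖z‖ ≤ M) :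
    ‖nonlin σ z‖ ≤ M ^ (2 * σ) * ‖z‖ := by
  rw [nonlin, norm_mul, Complex.norm_real, Real.norm_of_nonneg (by positivity)]
  gcongr

lemma exists_wirtingerBound_nonlin {σ : ℝ} {r : ℕ} (h : (∃ n : ℕ, σ = n) ∨ (r : ℝ) ≤ 2 * σ)
    (M : ℝ) : ∃ B, WirtingerBound M B r (nonlin σ) := by
  rcases h with ⟨n, rfl⟩ | h
  · rw [nonlin_natCast_eq_monom]
    exact exists_wirtingerBound_monom M (Or.inr rfl)
  · rw [nonlin_eq_monom]
    exact exists_wirtingerBound_monom M (Or.inl (by push_cast; linarith))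

lemma exists_funSobolevNorm_nonlin_comp_le {σ : ℝ} (hσ : 0 < σ) {k : ℕ} {ρ : ℝ}
    (hρ : (d : ℝ) / 2 < ρ) (hkρ : (k : ℝ) ≤ ρ)
    (hreg : (∃ n : ℕ, σ = n) ∨ ((k + 1 : ℕ) : ℝ) ≤ 2 * σ) (M : ℝ) :
    ∃ C : ℝ≥0∞, C ≠ ∞ ∧ ∀ u ∈ schwartzBall d ρ M,
      funSobolevNorm ((k : ℝ) + 1) (fun x => nonlin σ (u x)) ≤
        C * funSobolevNorm ((k : ℝ) + 1) u := by
  obtain ⟨B, hB⟩ := exists_wirtingerBound_nonlin hreg M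
  obtain ⟨C, hC, hcomp⟩ :=
    exists_funSobolevNorm_comp_le (d := d) hρ M (max B (M ^ (2 * σ))) k hkρ
  obtain ⟨-, α, β, hder, hα, hβ⟩ := hB.mono (le_max_left B (M ^ (2 * σ)))
  refine ⟨C, hC, hcomp (nonlin σ) α β hder (fun z hz => (norm_nonlin_le hσ hz).trans ?_) hα hβ⟩
  gcongr
  exact le_max_right _ _

lemma WirtingerBound.exists_lipschitzWith_eq {M B : ℝ} {k : ℕ} {F : ℂ → ℂ}
    (h : WirtingerBound M B (k + 1) F) :
    ∃ (K : NNReal) (g : ℂ → ℂ), LipschitzWith K g ∧ ∀ z, ‖z‖ ≤ M → g z = F z := by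
  obtain ⟨-, α, β, hder, hα, hβ⟩ := h
  have hlip : LipschitzOnWith (B + B).toNNReal F (Metric.closedBall 0 M) := by
    refine (convex_closedBall (0 : ℂ) M).lipschitzOnWith_of_nnnorm_hasFDerivWithin_le
      (f' := fun z => wirtinger (α z) (β z)) (fun z _ => (hder z).hasFDerivWithinAt) fun z hz => ?_
    have hzM : ‖z‖ ≤ M := by simpa using hz
    rw [← NNReal.coe_le_coe, coe_nnnorm]
    exact ((norm_wirtinger_le _ _).trans (add_le_add (hα.norm_le hzM) (hβ.norm_le hzM))).trans
      (Real.le_coe_toNNReal _)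
  obtain ⟨g, hg, heq⟩ := hlip.extend_finite_dimension
  exact ⟨_, g, hg, fun z hz => (heq (by simpa using hz)).symm⟩

/-- `N` replaces the power nonlinearity on the ball of radius `M` of `H^ρ`: there it has the same
values and grows at most linearly in `H^r`. -/
def IsTruncation (σ ρ r M : ℝ) (C : NNReal) (N : L2 d → L2 d) : Prop :=
  ∀ u : L2 d, sobolevNorm ρ u ≤ ENNReal.ofReal M →
    (N u =ᵐ[volume] fun x => nonlin σ (u x)) ∧ sobolevNorm r (N u) ≤ C * sobolevNorm r u

-- By the Sobolev embedding, a ball of `H^ρ` does not see the values of the nonlinearity at large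
-- arguments, so these can be modified to make it globally Lipschitz.
theorem exists_isTruncation {σ : ℝ} (hσ : 0 < σ) {k : ℕ} {ρ : ℝ} (hρ : (d : ℝ) / 2 < ρ)
    (hkρ : (k : ℝ) ≤ ρ) (hρr : ρ ≤ k + 1)
    (hreg : (∃ n : ℕ, σ = n) ∨ ((k + 1 : ℕ) : ℝ) ≤ 2 * σ) {M : ℝ} (hM : 0 ≤ M) :
    ∃ (K C : NNReal) (N : L2 d → L2 d), LipschitzWith K N ∧ IsTruncation σ ρ (k + 1) M C N := by
  set M' : ℝ := (sobolevConst d ρ).toReal * (M + 1) with hM'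
  have hM'0 : 0 ≤ M' := by positivity
  obtain ⟨B, hB⟩ := exists_wirtingerBound_nonlin hreg M'
  obtain ⟨K, g, hg, hgeq⟩ := hB.exists_lipschitzWith_eq
  have hg0 : g 0 = 0 := by rw [hgeq 0 (by simpa using hM'0), nonlin_zero]
  obtain ⟨C, hC, hcomp⟩ := exists_funSobolevNorm_nonlin_comp_le hσ hρ hkρ hreg M'
  refine ⟨K, (C + 1).toNNReal, hg.compLp hg0, hg.lipschitzWith_compLp hg0,
    fun u hu => ⟨?_, ?_⟩⟩
  · filter_upwards [hg.coeFn_compLp hg0 u, ae_enorm_le_sobolevConst_mul hρ u] with x hx hux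
    rw [hx, Function.comp_apply, hgeq]
    refine (norm_le_toReal_mul_of_enorm_le (sobolevConst_ne_top hρ) hM hu hux).trans ?_
    rw [hM']
    gcongr
    exact le_add_of_nonneg_right zero_le_one
  · rw [ENNReal.coe_toNNReal (by finiteness)]
    refine sobolevNorm_map_le_of_schwartz (by positivity) hρr (hg.continuous_compLp hg0)
      (by simp) (by finiteness) (M' := ENNReal.ofReal (M + 1))
      ((ENNReal.ofReal_lt_ofReal_iff (by positivity)).2 (lt_add_one M)) (fun φ hφ => ?_) hu
    have hball := mem_schwartzBall_of_funSobolevNorm_le hρ (by positivity) hφ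
    rw [sobolevNorm_compLp_schwartz, funext fun x => hgeq _ (hball.1 x)]
    exact (hcomp φ hball).trans (mul_le_mul_left le_self_add _)

end Nonlinearity

lemma tendsto_eLpNorm_mul_zero {α ι : Type*} [MeasurableSpace α] {μ : Measure α} {l : Filter ι}
    [l.IsCountablyGenerated] {b : ι → α → ℂ} (hb : ∀ i, AEStronglyMeasurable (b i) μ) {C : ℝ}
    (hC : ∀ i x, ‖b i x‖ ≤ C) (h0 : ∀ᵐ x ∂μ, Tendsto (fun i => b i x) l (𝓝 0)) {f : α → ℂ}
    (hf : MemLp f 2 μ) : Tendsto (fun i => eLpNorm (fun x => b i x * f x) 2 μ) l (𝓝 0) := by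
  have hsq : Tendsto (fun i => ∫⁻ x, ‖b i x * f x‖ₑ ^ 2 ∂μ) l (𝓝 (∫⁻ _, 0 ∂μ)) := by
    refine tendsto_lintegral_filter_of_dominated_convergence'
      (fun x => ENNReal.ofReal C ^ 2 * ‖f x‖ₑ ^ 2) (Eventually.of_forall fun i => ?_)
      (Eventually.of_forall fun i => Eventually.of_forall fun x => ?_) ?_ ?_
    · exact ((hb i).mul hf.1).enorm.pow_const 2
    · rw [enorm_mul, mul_pow]
      gcongr
      rw [← ofReal_norm]
      exact ENNReal.ofReal_le_ofReal (hC i x)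
    · rw [lintegral_const_mul' _ _ (by finiteness), ← eLpNorm_two_sq]
      have := hf.2.ne
      finiteness
    · filter_upwards [h0] with x hx
      have hmul : Tendsto (fun i => b i x * f x) l (𝓝 0) := by simpa using hx.mul_const (f x)
      simpa [Function.comp_def] using ((ENNReal.continuous_pow 2).tendsto _).comp hmul.enorm
  simp_rw [← eLpNorm_two_sq, lintegral_zero] at hsq
  have hroot : ∀ y : ℝ≥0∞, (y ^ 2) ^ (2 : ℝ)⁻¹ = y := fun y => by
    rw [← ENNReal.rpow_natCast_mul]
    norm_num
  simpa [Function.comp_def, hroot] using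
    ((ENNReal.continuous_rpow_const (y := (2 : ℝ)⁻¹)).tendsto _).comp hsq

section Multiplier

variable {b : Space d → ℂ} (hb : AEStronglyMeasurable b volume) {C : ℝ} (hC : ∀ ξ, ‖b ξ‖ ≤ C)

include hb hC in
lemma memLp_mul_of_bounded (f : L2 d) : MemLp (fun ξ => b ξ * f ξ) 2 volume :=
  (Lp.memLp f).of_le_mul (hb.mul (Lp.aestronglyMeasurable f)) <| Eventually.of_forall fun ξ =>
    (norm_mul_le _ _).trans (mul_le_mul_of_nonneg_right (hC ξ) (norm_nonneg _))

/-- The Fourier multiplier `f ↦ 𝓕⁻¹ (b 𝓕 f)` by a bounded function `b`, on `L²`. -/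
def multOp : L2 d →L[ℂ] L2 d :=
  LinearMap.mkContinuous
    { toFun := fun f => 𝓕⁻ (memLp_mul_of_bounded hb hC (𝓕 f : L2 d)).toLp
      map_add' := fun f g => by
        rw [← FourierTransform.fourierInv_add, ← MemLp.toLp_add]
        congr 1
        refine MemLp.toLp_congr _ _ ?_
        filter_upwards [coeFn_fourier_add f g] with ξ hξ
        rw [hξ, Pi.add_apply, mul_add]
      map_smul' := fun c f => by
        rw [RingHom.id_apply, ← FourierTransform.fourierInv_smul, ← MemLp.toLp_const_smul]
        congr 1
        refine MemLp.toLp_congr _ _ ?_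
        filter_upwards [coeFn_fourier_smul c f] with ξ hξ
        rw [hξ, Pi.smul_apply, smul_eq_mul, mul_left_comm] } C fun f => by
    rw [← Lp.norm_fourier_eq f]
    refine ((Lp.fourierTransformₗᵢ (Space d) ℂ).symm.norm_map _).trans_le
      (Lp.norm_le_mul_norm_of_ae_le_mul ?_)
    filter_upwards [(memLp_mul_of_bounded hb hC (𝓕 f : L2 d)).coeFn_toLp] with ξ hξ
    rw [hξ, norm_mul]
    exact mul_le_mul_of_nonneg_right (hC ξ) (norm_nonneg _)

lemma multOp_apply (f : L2 d) :
    multOp hb hC f = 𝓕⁻ (memLp_mul_of_bounded hb hC (𝓕 f : L2 d)).toLp := rfl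

lemma fourier_multOp (f : L2 d) :
    ((𝓕 (multOp hb hC f) : L2 d) : Space d → ℂ) =ᵐ[volume] fun ξ => b ξ * (𝓕 f : L2 d) ξ := by
  rw [multOp_apply, FourierTransform.fourier_fourierInv_eq]
  exact MemLp.coeFn_toLp _

lemma enorm_multOp (f : L2 d) :
    ‖multOp hb hC f‖ₑ = eLpNorm (fun ξ => b ξ * (𝓕 f : L2 d) ξ) 2 volume := by
  rw [enorm_eq_eLpNorm_fourier]
  exact eLpNorm_congr_ae (fourier_multOp hb hC f)

lemma norm_multOp_le (f : L2 d) : ‖multOp hb hC f‖ ≤ C * ‖f‖ :=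
  (multOp hb hC).le_of_opNorm_le
    (LinearMap.mkContinuous_norm_le _ ((norm_nonneg _).trans (hC 0)) _) f

end Multiplier

section FreeFlow

variable {P : Space d → ℝ} (hP : AEMeasurable P volume)

include hP in
lemma aemeasurable_symbol : AEMeasurable (fun ξ => P ((2 * Real.pi) • ξ)) volume :=
  hP.comp_quasiMeasurePreserving (Measure.quasiMeasurePreserving_smul volume Real.two_pi_pos.ne')

/-- The multiplier `exp (i t P(2πξ))` of the free flow. -/
def phase (P : Space d → ℝ) (t : ℝ) (ξ : Space d) : ℂ :=
  Complex.exp (Complex.I * (t * P ((2 * Real.pi) • ξ) : ℝ))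

lemma norm_phase (P : Space d → ℝ) (t : ℝ) (ξ : Space d) : ‖phase P t ξ‖ = 1 := by
  rw [phase, mul_comm Complex.I, Complex.norm_exp_ofReal_mul_I]

include hP in
lemma aestronglyMeasurable_phase (t : ℝ) : AEStronglyMeasurable (phase P t) volume :=
  (Complex.measurable_exp.comp_aemeasurable ((Complex.measurable_ofReal.comp_aemeasurable
    ((aemeasurable_symbol hP).const_mul t)).const_mul _)).aestronglyMeasurable

lemma freeFlow_eq_multOp (t : ℝ) (f : L2 d) : freeFlow hP t f =
    multOp (aestronglyMeasurable_phase hP t) (fun ξ => (norm_phase P t ξ).le) f := rfl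

lemma fourier_freeFlow (t : ℝ) (f : L2 d) :
    ((𝓕 (freeFlow hP t f) : L2 d) : Space d → ℂ) =ᵐ[volume]
      fun ξ => phase P t ξ * (𝓕 f : L2 d) ξ :=
  fourier_multOp (aestronglyMeasurable_phase hP t) (fun ξ => (norm_phase P t ξ).le) f

lemma sobolevNorm_freeFlow (s t : ℝ) (f : L2 d) :
    sobolevNorm s (freeFlow hP t f) = sobolevNorm s f := by
  apply eLpNorm_congr_norm_ae
  filter_upwards [fourier_freeFlow hP t f] with ξ hξ
  rw [hξ, norm_mul, norm_mul, norm_mul, norm_phase, one_mul]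

lemma norm_freeFlow (t : ℝ) (f : L2 d) : ‖freeFlow hP t f‖ = ‖f‖ := by
  have h := sobolevNorm_freeFlow hP 0 t f
  rw [sobolevNorm_zero, sobolevNorm_zero] at h
  simpa using congrArg ENNReal.toReal h

lemma freeFlow_sub (t : ℝ) (f g : L2 d) :
    freeFlow hP t (f - g) = freeFlow hP t f - freeFlow hP t g := by
  simp only [freeFlow_eq_multOp, map_sub]

lemma enorm_freeFlow_sub_freeFlow (t t₀ : ℝ) (f : L2 d) :
    ‖freeFlow hP t f - freeFlow hP t₀ f‖ₑ =
      eLpNorm (fun ξ => (phase P t ξ - phase P t₀ ξ) * (𝓕 f : L2 d) ξ) 2 volume := by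
  rw [enorm_eq_eLpNorm_fourier]
  apply eLpNorm_congr_ae
  filter_upwards [coeFn_fourier_sub (freeFlow hP t f) (freeFlow hP t₀ f),
    fourier_freeFlow hP t f, fourier_freeFlow hP t₀ f] with ξ hsub ht ht₀
  rw [hsub, ht, ht₀, sub_mul]

lemma continuous_freeFlow_time (f : L2 d) : Continuous fun t => freeFlow hP t f := by
  refine continuous_iff_continuousAt.2 fun t₀ => tendsto_iff_edist_tendsto_0.2 ?_
  simp_rw [edist_eq_enorm_sub, enorm_freeFlow_sub_freeFlow]
  refine tendsto_eLpNorm_mul_zero (C := 2)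
    (fun t => (aestronglyMeasurable_phase hP t).sub (aestronglyMeasurable_phase hP t₀))
    (fun t ξ => (norm_sub_le _ _).trans_eq (by rw [norm_phase, norm_phase]; norm_num))
    (Eventually.of_forall fun ξ => ?_) (Lp.memLp _)
  have hphase : Continuous fun t => phase P t ξ := by unfold phase; fun_prop
  simpa using (hphase.tendsto t₀).sub_const (phase P t₀ ξ)

lemma lipschitzWith_freeFlow (t : ℝ) : LipschitzWith 1 (freeFlow hP t) :=
  LipschitzWith.of_dist_le_mul fun f g => by
    simp [dist_eq_norm, ← freeFlow_sub, norm_freeFlow]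

lemma continuous_freeFlow : Continuous fun p : ℝ × L2 d => freeFlow hP p.1 p.2 :=
  continuous_prod_of_continuous_lipschitzWith' _ 1 (lipschitzWith_freeFlow hP)
    (continuous_freeFlow_time hP)

/-- The multiplier `min (2, T |P(2πξ)|)`, which dominates `|exp (i t P(2πξ)) - 1|` for
`|t| ≤ T`. -/
def defectSymbol (P : Space d → ℝ) (T : ℝ) (ξ : Space d) : ℂ :=
  ((min 2 |T * P ((2 * Real.pi) • ξ)| : ℝ) : ℂ)

lemma norm_defectSymbol (P : Space d → ℝ) (T : ℝ) (ξ : Space d) :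
    ‖defectSymbol P T ξ‖ = min 2 |T * P ((2 * Real.pi) • ξ)| := by
  rw [defectSymbol, Complex.norm_real, Real.norm_of_nonneg (by positivity)]

lemma norm_defectSymbol_le (P : Space d → ℝ) (T : ℝ) (ξ : Space d) : ‖defectSymbol P T ξ‖ ≤ 2 :=
  (norm_defectSymbol P T ξ).trans_le (min_le_left _ _)

include hP in
lemma aestronglyMeasurable_defectSymbol (T : ℝ) :
    AEStronglyMeasurable (defectSymbol P T) volume :=
  (Complex.measurable_ofReal.comp_aemeasurable (aemeasurable_const.min
    (measurable_norm.comp_aemeasurable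
      ((aemeasurable_symbol hP).const_mul T)))).aestronglyMeasurable

/-- The operator `min (2, T |P(D)|)`, which measures how far the free flow is from the identity up
to time `T`. -/
def defect (T : ℝ) : L2 d →L[ℂ] L2 d :=
  multOp (aestronglyMeasurable_defectSymbol hP T) (norm_defectSymbol_le P T)

lemma norm_defect_le (T : ℝ) (f : L2 d) : ‖defect hP T f‖ ≤ 2 * ‖f‖ := norm_multOp_le _ _ f

lemma norm_phase_sub_one_le {t T : ℝ} (ht : |t| ≤ T) (ξ : Space d) :
    ‖phase P t ξ - 1‖ ≤ ‖defectSymbol P T ξ‖ := by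
  rw [norm_defectSymbol]
  refine le_min ((norm_sub_le _ _).trans_eq (by rw [norm_phase]; norm_num)) ?_
  refine (Real.norm_exp_I_mul_ofReal_sub_one_le (x := t * P ((2 * Real.pi) • ξ))).trans ?_
  rw [Real.norm_eq_abs, abs_mul, abs_mul]
  exact mul_le_mul_of_nonneg_right (ht.trans (le_abs_self T)) (abs_nonneg _)

lemma norm_freeFlow_sub_le {t T : ℝ} (ht : |t| ≤ T) (f : L2 d) :
    ‖freeFlow hP t f - f‖ ≤ ‖defect hP T f‖ := by
  rw [← enorm_le_iff_norm_le, defect, enorm_multOp, enorm_eq_eLpNorm_fourier]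
  apply eLpNorm_mono_ae
  filter_upwards [coeFn_fourier_sub (freeFlow hP t f) f, fourier_freeFlow hP t f] with ξ hsub ht'
  rw [hsub, ht', ← sub_one_mul, norm_mul, norm_mul]
  exact mul_le_mul_of_nonneg_right (norm_phase_sub_one_le ht ξ) (norm_nonneg _)

lemma tendsto_norm_defect {Q : ℕ → Space d → ℝ} (hQ : ∀ n, AEMeasurable (Q n) volume)
    (h0 : ∀ᵐ ξ, Tendsto (fun n => Q n ξ) atTop (𝓝 0)) (T : ℝ) (f : L2 d) :
    Tendsto (fun n => ‖defect (hQ n) T f‖) atTop (𝓝 0) := by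
  have henorm : Tendsto (fun n => ‖defect (hQ n) T f‖ₑ) atTop (𝓝 0) := by
    simp_rw [defect, enorm_multOp]
    refine tendsto_eLpNorm_mul_zero (fun n => aestronglyMeasurable_defectSymbol (hQ n) T)
      (fun n ξ => norm_defectSymbol_le (Q n) T ξ) ?_ (Lp.memLp _)
    filter_upwards [(Measure.quasiMeasurePreserving_smul volume Real.two_pi_pos.ne').ae h0]
      with ξ hξ
    rw [tendsto_zero_iff_norm_tendsto_zero]
    simp_rw [norm_defectSymbol]
    refine squeeze_zero (fun n => by positivity) (fun n => min_le_right _ _) ?_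
    simpa using (hξ.const_mul T).abs
  simpa [Function.comp_def] using (ENNReal.tendsto_toReal ENNReal.zero_ne_top).comp henorm

end FreeFlow

section Minkowski

/-- The weight `(1 + |2πξ|²)^{s/2}` truncated at height `k`. -/
def truncWeight (s : ℝ) (k : ℕ) (ξ : Space d) : ℂ := ((min (bracket ξ ^ (s / 2)) k : ℝ) : ℂ)

lemma norm_truncWeight (s : ℝ) (k : ℕ) (ξ : Space d) :
    ‖truncWeight s k ξ‖ = min (bracket ξ ^ (s / 2)) k := by
  have := Real.rpow_nonneg (bracket_pos ξ).le (s / 2)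
  rw [truncWeight, Complex.norm_real, Real.norm_of_nonneg (by positivity)]

lemma aestronglyMeasurable_truncWeight (s : ℝ) (k : ℕ) :
    AEStronglyMeasurable (truncWeight (d := d) s k) volume :=
  (Complex.continuous_ofReal.comp
    ((continuous_bracket_rpow _).min continuous_const)).aestronglyMeasurable

/-- The truncation of `(1 + |D|²)^{s/2}` to a bounded operator on `L²`. -/
def truncOp (s : ℝ) (k : ℕ) : L2 d →L[ℂ] L2 d :=
  multOp (aestronglyMeasurable_truncWeight s k) (C := k)
    fun ξ => (norm_truncWeight s k ξ).trans_le (min_le_right _ _)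

lemma enorm_truncOp_le (s : ℝ) (k : ℕ) (f : L2 d) : ‖truncOp s k f‖ₑ ≤ sobolevNorm s f := by
  rw [truncOp, enorm_multOp]
  refine eLpNorm_mono fun ξ => ?_
  rw [norm_mul, norm_mul, norm_truncWeight]
  exact mul_le_mul_of_nonneg_right
    ((min_le_left _ _).trans_eq (norm_ofReal_bracket_rpow (s / 2) ξ).symm) (norm_nonneg _)

lemma sobolevNorm_le_of_forall_enorm_truncOp_le {s : ℝ} {f : L2 d} {r : ℝ≥0∞}
    (h : ∀ k, ‖truncOp s k f‖ₑ ≤ r) : sobolevNorm s f ≤ r := by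
  simp_rw [truncOp, enorm_multOp] at h
  refine (Lp.eLpNorm_lim_le_liminf_eLpNorm (fun k : ℕ => ?_) _ (Eventually.of_forall fun ξ => ?_)
    (f := fun k ξ => truncWeight s k ξ * (𝓕 f : L2 d) ξ)).trans
    (liminf_le_of_frequently_le' (Frequently.of_forall h))
  · exact (aestronglyMeasurable_truncWeight s k).mul (Lp.aestronglyMeasurable _)
  · refine Tendsto.mul_const _ (tendsto_const_nhds.congr' ?_)
    filter_upwards [eventually_ge_atTop ⌈bracket ξ ^ (s / 2)⌉₊] with k hk
    rw [truncWeight, min_eq_left (Nat.ceil_le.1 hk)]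
    rfl

lemma sobolevNorm_integral_le {s a b : ℝ} (hab : a ≤ b) {f : ℝ → L2 d}
    (hf : IntervalIntegrable f volume a b) {m : ℝ → ℝ} (hm : IntervalIntegrable m volume a b)
    (hm0 : ∀ τ ∈ Set.Ioc a b, 0 ≤ m τ)
    (h : ∀ τ ∈ Set.Ioc a b, sobolevNorm s (f τ) ≤ ENNReal.ofReal (m τ)) :
    sobolevNorm s (∫ τ in a..b, f τ) ≤ ENNReal.ofReal (∫ τ in a..b, m τ) := by
  refine sobolevNorm_le_of_forall_enorm_truncOp_le fun k => ?_
  rw [← ContinuousLinearMap.intervalIntegral_comp_comm _ hf, ← ofReal_norm]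
  refine ENNReal.ofReal_le_ofReal (intervalIntegral.norm_integral_le_of_norm_le hab
    (Eventually.of_forall fun τ hτ => ?_) hm)
  rw [← ENNReal.ofReal_le_ofReal_iff (hm0 τ hτ), ofReal_norm]
  exact (enorm_truncOp_le s k (f τ)).trans (h τ hτ)

end Minkowski

section Interpolation

lemma exists_rpow_le_mul_rpow_add {a b ε : ℝ} (ha : 0 ≤ a) (hab : a < b) (hε : 0 < ε) :
    ∃ C : ℝ, 0 ≤ C ∧ ∀ X : ℝ, 0 < X → X ^ a ≤ ε * X ^ b + C := by
  set K : ℝ := ε ^ (-(b - a)⁻¹) with hK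
  have hK0 : 0 < K := by positivity
  refine ⟨K ^ a, by positivity, fun X hX => ?_⟩
  rcases le_total K X with h | h
  · have hKε : K ^ (-(b - a)) = ε := by
      rw [hK, ← Real.rpow_mul hε.le, neg_mul_neg, inv_mul_cancel₀ (sub_pos.2 hab).ne',
        Real.rpow_one]
    calc X ^ a = X ^ (-(b - a)) * X ^ b := by rw [← Real.rpow_add hX]; congr 1; ring
      _ ≤ K ^ (-(b - a)) * X ^ b := by
        gcongr ?_ * _
        exact Real.rpow_le_rpow_of_nonpos hK0 h (by linarith)
      _ = ε * X ^ b := by rw [hKε]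
      _ ≤ ε * X ^ b + K ^ a := le_add_of_nonneg_right (by positivity)
  · exact (Real.rpow_le_rpow hX.le h ha).trans (le_add_of_nonneg_left (by positivity))

lemma exists_sobolevNorm_le_add {ρ r : ℝ} (hρ : 0 ≤ ρ) (hr : ρ < r) {ε : ℝ} (hε : 0 < ε) :
    ∃ C : ℝ, 0 ≤ C ∧ ∀ f : L2 d, sobolevNorm ρ f ≤
      ENNReal.ofReal ε * sobolevNorm r f + ENNReal.ofReal C * ‖f‖ₑ := by
  obtain ⟨C, hC, h⟩ := exists_rpow_le_mul_rpow_add (a := ρ / 2) (b := r / 2) (by positivity)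
    (by linarith) hε
  refine ⟨C, hC, fun f => ?_⟩
  rw [enorm_eq_eLpNorm_fourier]
  calc sobolevNorm ρ f
      ≤ eLpNorm ((fun ξ : Space d => ε * ‖((bracket ξ ^ (r / 2) : ℝ) : ℂ) * (𝓕 f : L2 d) ξ‖) +
          fun ξ => C * ‖(𝓕 f : L2 d) ξ‖) 2 volume := by
        refine eLpNorm_mono_real fun ξ => ?_
        rw [Pi.add_apply, norm_mul, norm_mul, norm_ofReal_bracket_rpow, ← mul_assoc, ← add_mul]
        exact mul_le_mul_of_nonneg_right ((norm_ofReal_bracket_rpow (ρ / 2) ξ).trans_le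
          (h _ (bracket_pos ξ))) (norm_nonneg _)
    _ ≤ eLpNorm (fun ξ : Space d => ε * ‖((bracket ξ ^ (r / 2) : ℝ) : ℂ) * (𝓕 f : L2 d) ξ‖) 2 volume
          + eLpNorm (fun ξ => C * ‖(𝓕 f : L2 d) ξ‖) 2 volume :=
        eLpNorm_add_le ((aestronglyMeasurable_weight_mul_fourier_Lp _ f).norm.const_mul ε)
          ((Lp.aestronglyMeasurable (𝓕 f : L2 d)).norm.const_mul _) one_le_two
    _ ≤ ENNReal.ofReal ε * sobolevNorm r f +
          ENNReal.ofReal C * eLpNorm (𝓕 f : L2 d) 2 volume := by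
        refine add_le_add
          (eLpNorm_le_mul_eLpNorm_of_ae_le_mul (Eventually.of_forall fun ξ => ?_) 2)
          (eLpNorm_le_mul_eLpNorm_of_ae_le_mul (Eventually.of_forall fun ξ => ?_) 2)
        · rw [norm_mul, Real.norm_of_nonneg hε.le, norm_norm]
          rfl
        · rw [norm_mul, Real.norm_of_nonneg hC, norm_norm]

lemma exists_sobolevNorm_le_of_norm_le {ρ r : ℝ} (hρ : 0 ≤ ρ) (hr : ρ < r) {R : ℝ} (hR : 0 ≤ R)
    {ε : ℝ} (hε : 0 < ε) : ∃ δ > 0, ∀ f : L2 d, sobolevNorm r f ≤ ENNReal.ofReal R → ‖f‖ ≤ δ →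
      sobolevNorm ρ f ≤ ENNReal.ofReal ε := by
  obtain ⟨C, hC, h⟩ :=
    exists_sobolevNorm_le_add (d := d) hρ hr (ε := ε / 2 / (R + 1)) (by positivity)
  refine ⟨ε / 2 / (C + 1), by positivity, fun f hf hδ => ?_⟩
  have hhalf : ∀ {y : ℝ}, 0 ≤ y → ε / 2 / (y + 1) * y ≤ ε / 2 := fun {y} hy =>
    (mul_le_mul_of_nonneg_left (le_add_of_nonneg_right zero_le_one) (by positivity)).trans_eq
      (div_mul_cancel₀ _ (by positivity))
  calc sobolevNorm ρ f
      ≤ ENNReal.ofReal (ε / 2 / (R + 1)) * ENNReal.ofReal R +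
          ENNReal.ofReal C * ENNReal.ofReal (ε / 2 / (C + 1)) := by
        refine (h f).trans ?_
        rw [← ofReal_norm]
        gcongr
    _ = ENNReal.ofReal (ε / 2 / (R + 1) * R) + ENNReal.ofReal (ε / 2 / (C + 1) * C) := by
        rw [ENNReal.ofReal_mul (by positivity), ENNReal.ofReal_mul (by positivity),
          mul_comm (ENNReal.ofReal C)]
    _ ≤ ENNReal.ofReal (ε / 2) + ENNReal.ofReal (ε / 2) := by
        gcongr
        exacts [hhalf hR, hhalf hC]
    _ = ENNReal.ofReal ε := by
        rw [← ENNReal.ofReal_add (by positivity) (by positivity), add_halves]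

end Interpolation

section Volterra

open Set

lemma exists_isFixedPt_mem_of_contractingWith_iterate {X : Type*} [MetricSpace X]
    [CompleteSpace X] {Ψ : X → X} {n : ℕ} {q : NNReal} (hΨ : ContractingWith q Ψ^[n])
    {A : Set X} (hA : IsClosed A) (hne : A.Nonempty) (hmaps : MapsTo Ψ A A) :
    ∃ z ∈ A, Function.IsFixedPt Ψ z := by
  obtain ⟨x, hx⟩ := hne
  have : Nonempty X := ⟨x⟩
  refine ⟨_, hA.mem_of_tendsto (hΨ.tendsto_iterate_fixedPoint x) (Eventually.of_forall fun m => ?_),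
    hΨ.isFixedPt_fixedPoint_iterate⟩
  rw [← Function.iterate_mul]
  exact hmaps.iterate _ hx

variable {X : Type*} [NormedAddCommGroup X] {T L : ℝ} (hT : 0 ≤ T)

lemma integral_mul_pow_div_factorial (L D t : ℝ) (n : ℕ) :
    L * ∫ τ in (0 : ℝ)..t, (L * τ) ^ n / n.factorial * D =
      (L * t) ^ (n + 1) / (n + 1).factorial * D := by
  simp_rw [mul_pow, mul_div_assoc]
  rw [intervalIntegral.integral_mul_const, intervalIntegral.integral_const_mul,
    intervalIntegral.integral_div, integral_pow, Nat.factorial_succ, zero_pow n.succ_ne_zero]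
  push_cast
  field_simp
  ring

lemma dist_iterate_le_of_volterra (hL : 0 ≤ L) {Ψ : C(Icc 0 T, X) → C(Icc 0 T, X)}
    (hΨ : ∀ u w (t : Icc 0 T), dist (Ψ u t) (Ψ w t) ≤
      L * ∫ τ in (0 : ℝ)..t, dist (IccExtend hT u τ) (IccExtend hT w τ))
    (n : ℕ) (u w : C(Icc 0 T, X)) (t : Icc 0 T) :
    dist ((Ψ^[n] u) t) ((Ψ^[n] w) t) ≤ (L * t) ^ n / n.factorial * dist u w := by
  induction n generalizing t with
  | zero => simpa using ContinuousMap.dist_apply_le_dist t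
  | succ n ih =>
    rw [Function.iterate_succ_apply', Function.iterate_succ_apply',
      ← integral_mul_pow_div_factorial]
    refine (hΨ _ _ t).trans (mul_le_mul_of_nonneg_left ?_ hL)
    refine intervalIntegral.integral_mono_on t.2.1 (Continuous.intervalIntegrable ?_ _ _)
      (Continuous.intervalIntegrable (by fun_prop) _ _) fun τ hτ => ?_
    · exact (ContinuousMap.continuous _).Icc_extend'.dist (ContinuousMap.continuous _).Icc_extend'
    · have hτT : τ ∈ Icc 0 T := ⟨hτ.1, hτ.2.trans t.2.2⟩
      rw [IccExtend_of_mem hT _ hτT, IccExtend_of_mem hT _ hτT]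
      exact ih ⟨τ, hτT⟩

lemma exists_contractingWith_iterate_of_volterra (hL : 0 ≤ L) {Ψ : C(Icc 0 T, X) → C(Icc 0 T, X)}
    (hΨ : ∀ u w (t : Icc 0 T), dist (Ψ u t) (Ψ w t) ≤
      L * ∫ τ in (0 : ℝ)..t, dist (IccExtend hT u τ) (IccExtend hT w τ)) :
    ∃ (n : ℕ) (q : NNReal), ContractingWith q Ψ^[n] := by
  obtain ⟨n, hn⟩ : ∃ n : ℕ, (L * T) ^ n / n.factorial < 1 :=
    ((FloorSemiring.tendsto_pow_div_factorial_atTop (L * T)).eventually_lt_const one_pos).exists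
  have hq : 0 ≤ (L * T) ^ n / n.factorial := by positivity
  refine ⟨n, ⟨_, hq⟩, hn, LipschitzWith.of_dist_le_mul fun u w => ?_⟩
  refine (ContinuousMap.dist_le (by positivity)).2 fun t => ?_
  refine (dist_iterate_le_of_volterra hT hL hΨ n u w t).trans
    (mul_le_mul_of_nonneg_right ?_ dist_nonneg)
  have := t.2.1
  have := t.2.2
  change _ ≤ (L * T) ^ n / n.factorial
  gcongr

variable {U : ℝ → X → X} (hU : Continuous fun p : ℝ × X => U p.1 p.2) {N : X → X}

include hU in
lemma continuous_duhamel_integrand (hN : Continuous N) {u : ℝ → X} (hu : Continuous u) :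
    Continuous fun p : ℝ × ℝ => U (p.1 - p.2) (N (u p.2)) :=
  hU.comp ((continuous_fst.sub continuous_snd).prodMk (hN.comp (hu.comp continuous_snd)))

include hU in
lemma intervalIntegrable_duhamel_integrand (hN : Continuous N) {u : ℝ → X} (hu : Continuous u)
    (t : ℝ) : IntervalIntegrable (fun τ => U (t - τ) (N (u τ))) volume 0 t :=
  ((continuous_duhamel_integrand hU hN hu).comp
    (continuous_const.prodMk continuous_id)).intervalIntegrable _ _

variable [NormedSpace ℝ X] {𝕜 : Type*} [NormedField 𝕜] [NormedSpace 𝕜 X]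

/-- The right-hand side `U(t) a + c ∫₀ᵗ U(t - τ) N(u(τ)) dτ` of Duhamel's formula. -/
def duhamel (U : ℝ → X → X) (N : X → X) (a : X) (c : 𝕜) (u : ℝ → X) (t : ℝ) : X :=
  U t a + c • ∫ τ in (0 : ℝ)..t, U (t - τ) (N (u τ))

variable (a : X) (c : 𝕜)

include hU

lemma continuous_duhamel (hN : Continuous N) {u : ℝ → X} (hu : Continuous u) :
    Continuous (duhamel U N a c u) :=
  (hU.comp (continuous_id.prodMk continuous_const)).add
    ((intervalIntegral.continuous_parametric_intervalIntegral_of_continuous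
      (continuous_duhamel_integrand hU hN hu) continuous_id).const_smul c)

lemma dist_duhamel_le (hUlip : ∀ t, LipschitzWith 1 (U t)) {K : NNReal} (hN : LipschitzWith K N)
    {u w : ℝ → X} (hu : Continuous u) (hw : Continuous w) {t : ℝ} (ht : 0 ≤ t) :
    dist (duhamel U N a c u t) (duhamel U N a c w t) ≤
      ‖c‖ * K * ∫ τ in (0 : ℝ)..t, dist (u τ) (w τ) := by
  rw [duhamel, duhamel, dist_add_left, dist_smul₀, mul_assoc, dist_eq_norm,
    ← intervalIntegral.integral_sub
      (intervalIntegrable_duhamel_integrand hU hN.continuous hu t)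
      (intervalIntegrable_duhamel_integrand hU hN.continuous hw t),
    ← intervalIntegral.integral_const_mul]
  refine mul_le_mul_of_nonneg_left (intervalIntegral.norm_integral_le_of_norm_le ht
    (Eventually.of_forall fun τ _ => ?_) (Continuous.intervalIntegrable (by fun_prop) _ _))
    (norm_nonneg c)
  rw [← dist_eq_norm]
  exact ((hUlip _).dist_le_mul _ _).trans (by simpa using hN.dist_le_mul (u τ) (w τ))

lemma exists_eq_duhamel_of_mapsTo [CompleteSpace X] (hUlip : ∀ t, LipschitzWith 1 (U t))
    {K : NNReal} (hN : LipschitzWith K N) (hT : 0 ≤ T) {S : ℝ → Set X} (hS : ∀ t, IsClosed (S t))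
    {v : ℝ → X} (hv : Continuous v) (hvS : ∀ t ∈ Icc 0 T, v t ∈ S t)
    (hinv : ∀ u : ℝ → X, Continuous u → (∀ t ∈ Icc 0 T, u t ∈ S t) →
      ∀ t ∈ Icc 0 T, duhamel U N a c u t ∈ S t) :
    ∃ u : ℝ → X, Continuous u ∧ (∀ t ∈ Icc 0 T, u t ∈ S t) ∧
      ∀ t ∈ Icc 0 T, u t = duhamel U N a c u t := by
  let Ψ (u : C(Icc 0 T, X)) : C(Icc 0 T, X) := ⟨fun t => duhamel U N a c (IccExtend hT u) t,
    (continuous_duhamel hU a c hN.continuous u.continuous.Icc_extend').comp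
      continuous_subtype_val⟩
  let A : Set C(Icc 0 T, X) := {u | ∀ t : Icc (0 : ℝ) T, u t ∈ S t}
  have hAclosed : IsClosed A := by
    rw [show A = ⋂ t : Icc (0 : ℝ) T, (fun u : C(Icc 0 T, X) => u t) ⁻¹' S t by ext; simp [A]]
    exact isClosed_iInter fun t => (hS t).preimage (continuous_eval_const t)
  have hextend : ∀ u ∈ A, ∀ t ∈ Icc 0 T, IccExtend hT u t ∈ S t := fun u hu t ht => by
    rw [IccExtend_of_mem hT u ht]
    exact hu ⟨t, ht⟩
  have hvA : ContinuousMap.mk (fun t : Icc 0 T => v t) (hv.comp continuous_subtype_val) ∈ A :=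
    fun t => hvS t t.2
  obtain ⟨n, q, hcontr⟩ := exists_contractingWith_iterate_of_volterra (Ψ := Ψ) hT
    (L := ‖c‖ * K) (by positivity) fun u w t => dist_duhamel_le hU a c hUlip hN
      u.continuous.Icc_extend' w.continuous.Icc_extend' t.2.1
  obtain ⟨z, hzA, hz⟩ := exists_isFixedPt_mem_of_contractingWith_iterate hcontr hAclosed ⟨_, hvA⟩
    fun u hu t => hinv _ u.continuous.Icc_extend' (hextend u hu) t t.2
  refine ⟨IccExtend hT z, z.continuous.Icc_extend', hextend z hzA, fun t ht => ?_⟩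
  conv_lhs => rw [IccExtend_of_mem hT z ht, ← hz]
  rfl

end Volterra

section DispersionlessLimit

lemma continuousInSobolev_of_sobolevNorm_le {ρ r R T : ℝ} (hρ : 0 ≤ ρ) (hρr : ρ < r) (hR : 0 ≤ R)
    {u : ℝ → L2 d} (hu : ContinuousOn u (Set.Icc 0 T))
    (huR : ∀ t ∈ Set.Icc 0 T, sobolevNorm r (u t) ≤ ENNReal.ofReal R) :
    ContinuousInSobolev ρ T u := by
  intro t₀ ht₀
  refine ⟨((sobolevNorm_mono hρr.le _).trans (huR t₀ ht₀)).trans_lt ENNReal.ofReal_lt_top,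
    ENNReal.tendsto_nhds_zero.2 fun ε hε => ?_⟩
  obtain ⟨ε', -, hε'0, hε'⟩ := ENNReal.lt_iff_exists_real_btwn.1 hε
  obtain ⟨δ, hδ, hsmall⟩ := exists_sobolevNorm_le_of_norm_le (d := d) hρ hρr
    (add_nonneg hR hR) (ENNReal.ofReal_pos.1 hε'0)
  have hnorm : Tendsto (fun t => ‖u t - u t₀‖) (𝓝[Set.Icc 0 T] t₀) (𝓝 0) :=
    tendsto_iff_norm_sub_tendsto_zero.1 (hu t₀ ht₀)
  filter_upwards [hnorm.eventually_le_const hδ, self_mem_nhdsWithin] with t htδ ht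
  refine (hsmall _ ((sobolevNorm_sub_le _ _ _).trans ?_) htδ).trans hε'.le
  rw [ENNReal.ofReal_add hR hR]
  exact add_le_add (huR t ht) (huR t₀ ht₀)

lemma add_mul_integral_exp (R b C t : ℝ) :
    R + b * ∫ τ in (0 : ℝ)..t, C * (R * Real.exp (b * C * τ)) = R * Real.exp (b * C * t) := by
  have hderiv : ∀ τ ∈ Set.uIcc 0 t, HasDerivAt (fun τ => R * Real.exp (b * C * τ))
      (b * (C * (R * Real.exp (b * C * τ)))) τ := fun τ _ => by
    have h : HasDerivAt (fun τ => R * Real.exp (b * C * τ))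
        (R * (Real.exp (b * C * τ) * (b * C))) τ :=
      ((hasDerivAt_const_mul (b * C)).exp).const_mul R
    exact h.congr_deriv (by ring)
  rw [← intervalIntegral.integral_const_mul,
    intervalIntegral.integral_eq_sub_of_hasDerivAt hderiv
      (Continuous.intervalIntegrable (by fun_prop) _ _)]
  simp

variable {P : Space d → ℝ} (hP : AEMeasurable P volume) {N : L2 d → L2 d} {a : L2 d} {c : ℂ}

lemma sobolevNorm_duhamel_le {s R : ℝ} (hR : 0 ≤ R) (ha : sobolevNorm s a ≤ ENNReal.ofReal R)
    (hN : Continuous N) {C : NNReal} {w : ℝ → L2 d} (hw : Continuous w) {t : ℝ} (ht : 0 ≤ t)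
    (hNw : ∀ τ ∈ Set.Ioc 0 t,
      sobolevNorm s (N (w τ)) ≤ C * ENNReal.ofReal (R * Real.exp (‖c‖ * C * τ))) :
    sobolevNorm s (duhamel (freeFlow hP) N a c w t) ≤
      ENNReal.ofReal (R * Real.exp (‖c‖ * C * t)) := by
  have hint : sobolevNorm s (∫ τ in (0 : ℝ)..t, freeFlow hP (t - τ) (N (w τ))) ≤
      ENNReal.ofReal (∫ τ in (0 : ℝ)..t, C * (R * Real.exp (‖c‖ * C * τ))) := by
    refine sobolevNorm_integral_le ht
      (intervalIntegrable_duhamel_integrand (continuous_freeFlow hP) hN hw t)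
      (Continuous.intervalIntegrable (by fun_prop) _ _) (fun τ _ => by positivity) fun τ hτ => ?_
    rw [sobolevNorm_freeFlow, ENNReal.ofReal_mul C.coe_nonneg, ENNReal.ofReal_coe_nnreal]
    exact hNw τ hτ
  have hpos : 0 ≤ ∫ τ in (0 : ℝ)..t, C * (R * Real.exp (‖c‖ * C * τ)) :=
    intervalIntegral.integral_nonneg ht fun τ _ => by positivity
  rw [duhamel, ← add_mul_integral_exp, ENNReal.ofReal_add hR (by positivity),
    ENNReal.ofReal_mul (norm_nonneg _), ofReal_norm]
  refine (sobolevNorm_add_le _ _ _).trans ?_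
  rw [sobolevNorm_freeFlow, sobolevNorm_smul]
  gcongr

/-- A bound for the error made up to time `T` when the free flow is replaced by the identity in
Duhamel's formula with source term `g`. -/
def duhamelDefect (a : L2 d) (c : ℂ) (g : ℝ → L2 d) (T : ℝ) : ℝ :=
  ‖defect hP T a‖ + ‖c‖ * ∫ τ in (0 : ℝ)..T, ‖defect hP T (g τ)‖

lemma tendsto_duhamelDefect {Q : ℕ → Space d → ℝ} (hQ : ∀ n, AEMeasurable (Q n) volume)
    (hlim : ∀ᵐ ξ, Tendsto (fun n => Q n ξ) atTop (𝓝 0)) (a : L2 d) (c : ℂ) {g : ℝ → L2 d}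
    (hg : Continuous g) (T : ℝ) :
    Tendsto (fun n => duhamelDefect (hQ n) a c g T) atTop (𝓝 0) := by
  have hint : Tendsto (fun n => ∫ τ in (0 : ℝ)..T, ‖defect (hQ n) T (g τ)‖) atTop
      (𝓝 (∫ _ in (0 : ℝ)..T, (0 : ℝ))) := by
    refine intervalIntegral.tendsto_integral_filter_of_dominated_convergence
      (fun τ => 2 * ‖g τ‖) (Eventually.of_forall fun n => ?_)
      (Eventually.of_forall fun n => Eventually.of_forall fun τ _ => ?_)
      (Continuous.intervalIntegrable (by fun_prop) _ _)
      (Eventually.of_forall fun τ _ => tendsto_norm_defect hQ hlim T _)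
    · exact ((defect (hQ n) T).continuous.comp hg).norm.aestronglyMeasurable
    · exact (norm_norm _).trans_le (norm_defect_le (hQ n) T _)
  simpa [duhamelDefect] using (tendsto_norm_defect hQ hlim T a).add (hint.const_mul ‖c‖)

lemma norm_freeFlow_sub_le_add {T t : ℝ} (ht : |t| ≤ T) (f g : L2 d) :
    ‖freeFlow hP t f - g‖ ≤ ‖f - g‖ + ‖defect hP T g‖ := by
  calc ‖freeFlow hP t f - g‖ = ‖freeFlow hP t (f - g) + (freeFlow hP t g - g)‖ := by
        rw [freeFlow_sub, sub_add_sub_cancel]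
    _ ≤ ‖f - g‖ + ‖defect hP T g‖ :=
      (norm_add_le _ _).trans (add_le_add (norm_freeFlow hP t _).le (norm_freeFlow_sub_le hP ht g))

lemma norm_duhamel_sub_le {K : NNReal} (hN : LipschitzWith K N) {v w : ℝ → L2 d}
    (hv : Continuous v) (hw : Continuous w) {δ t T : ℝ} (ht : t ∈ Set.Icc 0 T)
    (hvt : v t = a + c • ∫ τ in (0 : ℝ)..t, N (v τ))
    (hwv : ∀ τ ∈ Set.Ioc 0 t, ‖w τ - v τ‖ ≤ δ * Real.exp (‖c‖ * K * τ))
    (hδ : duhamelDefect hP a c (fun τ => N (v τ)) T ≤ δ) :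
    ‖duhamel (freeFlow hP) N a c w t - v t‖ ≤ δ * Real.exp (‖c‖ * K * t) := by
  have hNv : Continuous fun τ => N (v τ) := hN.continuous.comp hv
  have hdefect : Continuous fun τ => ‖defect hP T (N (v τ))‖ :=
    ((defect hP T).continuous.comp hNv).norm
  have hexp : Continuous fun τ => K * (δ * Real.exp (‖c‖ * K * τ)) := by fun_prop
  have hint : ‖∫ τ in (0 : ℝ)..t, (freeFlow hP (t - τ) (N (w τ)) - N (v τ))‖ ≤
      (∫ τ in (0 : ℝ)..t, K * (δ * Real.exp (‖c‖ * K * τ))) +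
        ∫ τ in (0 : ℝ)..T, ‖defect hP T (N (v τ))‖ := by
    refine (intervalIntegral.norm_integral_le_of_norm_le ht.1
      (Eventually.of_forall fun τ hτ => ?_)
      ((hexp.add hdefect).intervalIntegrable 0 t)).trans ?_
    · have htime : |t - τ| ≤ T := by
        rw [abs_of_nonneg (sub_nonneg.2 hτ.2)]
        linarith [hτ.1, ht.2]
      refine (norm_freeFlow_sub_le_add hP htime _ _).trans (add_le_add_left ?_ _)
      exact (hN.norm_sub_le _ _).trans (mul_le_mul_of_nonneg_left (hwv τ hτ) K.coe_nonneg)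
    · simp only [Pi.add_apply]
      rw [intervalIntegral.integral_add (hexp.intervalIntegrable _ _)
        (hdefect.intervalIntegrable _ _)]
      exact add_le_add_right (intervalIntegral.integral_mono_interval le_rfl ht.1 ht.2
        (Eventually.of_forall fun τ => norm_nonneg _) (hdefect.intervalIntegrable _ _)) _
  have hdata : ‖freeFlow hP t a - a‖ ≤ ‖defect hP T a‖ :=
    norm_freeFlow_sub_le hP (by rw [abs_of_nonneg ht.1]; exact ht.2) a
  calc ‖duhamel (freeFlow hP) N a c w t - v t‖
      = ‖(freeFlow hP t a - a) +
          c • ∫ τ in (0 : ℝ)..t, (freeFlow hP (t - τ) (N (w τ)) - N (v τ))‖ := by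
        rw [hvt, duhamel, intervalIntegral.integral_sub
          (intervalIntegrable_duhamel_integrand (continuous_freeFlow hP) hN.continuous hw t)
          (hNv.intervalIntegrable _ _), smul_sub]
        congr 1
        abel
    _ ≤ ‖defect hP T a‖ + ‖c‖ * ((∫ τ in (0 : ℝ)..t, K * (δ * Real.exp (‖c‖ * K * τ))) +
          ∫ τ in (0 : ℝ)..T, ‖defect hP T (N (v τ))‖) := by
        refine (norm_add_le _ _).trans (add_le_add hdata ?_)
        rw [norm_smul]
        gcongr
    _ ≤ δ + ‖c‖ * ∫ τ in (0 : ℝ)..t, K * (δ * Real.exp (‖c‖ * K * τ)) := by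
        rw [duhamelDefect] at hδ
        linarith
    _ = δ * Real.exp (‖c‖ * K * t) := add_mul_integral_exp δ ‖c‖ K t

/-- The tube around `v` in which the solutions with small dispersion are found: an `H^r` ball and an
`L²` ball around `v t` whose radii grow exponentially in time. -/
def tube (r : ℝ) (v : ℝ → L2 d) (R L δ K t : ℝ) : Set (L2 d) :=
  {f | sobolevNorm r f ≤ ENNReal.ofReal (R * Real.exp (L * t))} ∩
    {f | ‖f - v t‖ ≤ δ * Real.exp (K * t)}

lemma isClosed_tube (r : ℝ) (v : ℝ → L2 d) (R L δ K t : ℝ) : IsClosed (tube r v R L δ K t) :=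
  (isClosed_sobolevBall _ _).inter
    (isClosed_le (continuous_id.sub continuous_const).norm continuous_const)

variable {v : ℝ → L2 d} {r R L K T : ℝ}

lemma le_mul_exp_mul (hR : 0 ≤ R) (hL : 0 ≤ L) {t : ℝ} (ht : 0 ≤ t) : R ≤ R * Real.exp (L * t) :=
  le_mul_of_one_le_right hR (Real.one_le_exp (mul_nonneg hL ht))

lemma self_mem_tube (hR : 0 ≤ R) (hL : 0 ≤ L) {δ : ℝ} (hδ : 0 ≤ δ) {t : ℝ} (ht : 0 ≤ t)
    (hv : sobolevNorm r (v t) ≤ ENNReal.ofReal R) : v t ∈ tube r v R L δ K t := by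
  refine ⟨hv.trans (ENNReal.ofReal_le_ofReal (le_mul_exp_mul hR hL ht)), ?_⟩
  rw [Set.mem_ofPred_eq, sub_self, norm_zero]
  positivity

lemma sobolevNorm_le_of_mem_tube (hR : 0 ≤ R) (hL : 0 ≤ L) {δ t : ℝ} (ht : t ≤ T) {f : L2 d}
    (hf : f ∈ tube r v R L δ K t) : sobolevNorm r f ≤ ENNReal.ofReal (R * Real.exp (L * T)) := by
  refine hf.1.trans (ENNReal.ofReal_le_ofReal ?_)
  gcongr

lemma exists_sobolevNorm_sub_le_of_mem_tube {s : ℝ} (hs : 0 ≤ s) (hsr : s < r) (hR : 0 ≤ R)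
    (hL : 0 ≤ L) (hK : 0 ≤ K)
    (hv : ∀ t ∈ Set.Icc 0 T, sobolevNorm r (v t) ≤ ENNReal.ofReal R) {ε : ℝ} (hε : 0 < ε) :
    ∃ δ₀ > 0, ∀ δ ≤ δ₀, ∀ t ∈ Set.Icc 0 T, ∀ f ∈ tube r v R L δ K t,
      sobolevNorm s (f - v t) ≤ ENNReal.ofReal ε := by
  obtain ⟨δ', hδ', hsmall⟩ := exists_sobolevNorm_le_of_norm_le (d := d) hs hsr
    (R := R * Real.exp (L * T) + R) (by positivity) hε
  refine ⟨δ' * Real.exp (-(K * T)), by positivity, fun δ hδ t ht f hf => hsmall _ ?_ ?_⟩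
  · rw [ENNReal.ofReal_add (by positivity) hR]
    exact (sobolevNorm_sub_le _ _ _).trans
      (add_le_add (sobolevNorm_le_of_mem_tube hR hL ht.2 hf) (hv t ht))
  · have ht' := ht.2
    calc ‖f - v t‖ ≤ δ' * Real.exp (-(K * T)) * Real.exp (K * T) := by
          refine hf.2.trans ?_
          gcongr
      _ = δ' := by rw [mul_assoc, ← Real.exp_add, neg_add_cancel, Real.exp_zero, mul_one]

/-- `v` solves `i ∂ₜ v = lam |v|^{2σ} v`, `v(0) = a`, the limit of the equation for a vanishing
symbol, in its integral form. -/
def IsDispersionlessSolution (lam σ : ℝ) (a : L2 d) (v : ℝ → L2 d) : Prop :=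
  Continuous v ∧ ∃ g : ℝ → L2 d, (∀ t, g t =ᵐ[volume] fun x => nonlin σ (v t x)) ∧
    ∀ t, v t = a - (Complex.I * (lam : ℂ)) • ∫ τ in (0 : ℝ)..t, g τ

variable {lam σ ρ M : ℝ} {C : NNReal}

lemma IsDispersionlessSolution.apply_zero (hv : IsDispersionlessSolution lam σ a v) : v 0 = a := by
  obtain ⟨-, g, -, hvg⟩ := hv
  simpa using hvg 0

lemma IsDispersionlessSolution.eq_add_integral (hv : IsDispersionlessSolution lam σ a v)
    (hN : IsTruncation σ ρ r M C N) {t : ℝ} (ht : 0 ≤ t)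
    (hvM : ∀ τ ∈ Set.Icc 0 t, sobolevNorm ρ (v τ) ≤ ENNReal.ofReal M) :
    v t = a + (-(Complex.I * (lam : ℂ))) • ∫ τ in (0 : ℝ)..t, N (v τ) := by
  obtain ⟨-, g, hg, hvg⟩ := hv
  rw [hvg t, neg_smul, ← sub_eq_add_neg]
  congr 2
  refine intervalIntegral.integral_congr fun τ hτ => ?_
  rw [Set.uIcc_of_le ht] at hτ
  exact Lp.ext ((hg τ).trans (hN _ (hvM τ hτ)).1.symm)

lemma duhamel_mem_tube (hR : 0 ≤ R) {K : NNReal} (hNlip : LipschitzWith K N)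
    (hN : IsTruncation σ ρ r M C N) (hv : IsDispersionlessSolution lam σ a v)
    (hvM : ∀ t ∈ Set.Icc 0 T, sobolevNorm ρ (v t) ≤ ENNReal.ofReal M)
    (ha : sobolevNorm r a ≤ ENNReal.ofReal R) {δ : ℝ} (htube : ∀ t ∈ Set.Icc 0 T,
      ∀ f ∈ tube r v R (|lam| * C) δ (|lam| * K) t, sobolevNorm ρ f ≤ ENNReal.ofReal M)
    (hδ : duhamelDefect hP a (-(Complex.I * (lam : ℂ))) (fun τ => N (v τ)) T ≤ δ)
    {w : ℝ → L2 d} (hw : Continuous w)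
    (hwv : ∀ t ∈ Set.Icc 0 T, w t ∈ tube r v R (|lam| * C) δ (|lam| * K) t)
    {t : ℝ} (ht : t ∈ Set.Icc 0 T) :
    duhamel (freeFlow hP) N a (-(Complex.I * (lam : ℂ))) w t ∈
      tube r v R (|lam| * C) δ (|lam| * K) t := by
  have hnorm : ‖-(Complex.I * (lam : ℂ))‖ = |lam| := by simp
  have hsub : ∀ τ ∈ Set.Ioc 0 t, τ ∈ Set.Icc 0 T := fun τ hτ => ⟨hτ.1.le, hτ.2.trans ht.2⟩
  refine ⟨?_, ?_⟩ <;> rw [Set.mem_ofPred_eq, ← hnorm]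
  · refine sobolevNorm_duhamel_le hP hR ha hNlip.continuous hw ht.1 fun τ hτ => ?_
    have hmem := hwv τ (hsub τ hτ)
    refine (hN _ (htube τ (hsub τ hτ) _ hmem)).2.trans ?_
    rw [hnorm]
    gcongr
    exact hmem.1
  · refine norm_duhamel_sub_le hP hNlip hv.1 hw ht
      (hv.eq_add_integral hN ht.1 fun τ hτ => hvM τ ⟨hτ.1, hτ.2.trans ht.2⟩) (fun τ hτ => ?_) hδ
    rw [hnorm]
    exact (hwv τ (hsub τ hτ)).2

lemma exists_isSolution_mem_tube (hρ : (d : ℝ) / 2 < ρ) (hρr : ρ < r) (hR : 0 ≤ R) (hRM : R ≤ M)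
    (hT : 0 ≤ T) {K : NNReal} (hNlip : LipschitzWith K N) (hN : IsTruncation σ ρ r M C N)
    {a₀ : 𝓢(Space d, ℂ)} (hv : IsDispersionlessSolution lam σ (a₀.toLp 2 volume) v)
    (hvR : ∀ t ∈ Set.Icc 0 T, sobolevNorm r (v t) ≤ ENNReal.ofReal R)
    {δ : ℝ} (hδ : 0 ≤ δ) (htube : ∀ t ∈ Set.Icc 0 T,
      ∀ f ∈ tube r v R (|lam| * C) δ (|lam| * K) t, sobolevNorm ρ f ≤ ENNReal.ofReal M)
    (hdefect : duhamelDefect hP (a₀.toLp 2 volume) (-(Complex.I * (lam : ℂ)))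
      (fun τ => N (v τ)) T ≤ δ) :
    ∃ u : ℝ → L2 d, IsSolution hP lam σ a₀ T u ∧
      ∀ t ∈ Set.Icc 0 T, u t ∈ tube r v R (|lam| * C) δ (|lam| * K) t := by
  have hρ₀ : 0 ≤ ρ := le_trans (by positivity) hρ.le
  have hL : 0 ≤ |lam| * C := by positivity
  have ha : sobolevNorm r (a₀.toLp 2 volume : L2 d) ≤ ENNReal.ofReal R :=
    hv.apply_zero ▸ hvR 0 ⟨le_rfl, hT⟩
  have hvM : ∀ t ∈ Set.Icc 0 T, sobolevNorm ρ (v t) ≤ ENNReal.ofReal M := fun t ht =>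
    (sobolevNorm_mono hρr.le _).trans ((hvR t ht).trans (ENNReal.ofReal_le_ofReal hRM))
  obtain ⟨u, hu, hmem, heq⟩ := exists_eq_duhamel_of_mapsTo (continuous_freeFlow hP) _ _
    (lipschitzWith_freeFlow hP) hNlip hT (isClosed_tube r v R (|lam| * C) δ (|lam| * K)) hv.1
    (fun t ht => self_mem_tube hR hL hδ ht.1 (hvR t ht)) fun w hw hwv t ht =>
      duhamel_mem_tube hP hR hNlip hN hv hvM ha htube hdefect hw hwv ht
  refine ⟨u, ⟨⟨ρ, hρ, continuousInSobolev_of_sobolevNorm_le hρ₀ hρr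
    (R := R * Real.exp (|lam| * C * T)) (by positivity) hu.continuousOn fun t ht =>
      sobolevNorm_le_of_mem_tube hR hL ht.2 (hmem t ht)⟩,
    fun t => N (u t), (hNlip.continuous.comp hu).continuousOn,
    fun t ht => (hN _ (htube t ht _ (hmem t ht))).1, fun t ht => ?_⟩, hmem⟩
  rw [heq t ht, duhamel, neg_smul, ← sub_eq_add_neg]

-- The solutions are constructed by a fixed point argument in a tube around `v`; the choice of the
-- radius of the tube makes the a priori bounds close on the whole of `[0, T]`.
theorem eventually_exists_isSolution_near {s ε : ℝ} {k : ℕ} (hσ : 0 < σ)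
    (hk : (d : ℝ) / 2 < k + 1) (hreg : (∃ n : ℕ, σ = n) ∨ ((k + 1 : ℕ) : ℝ) ≤ 2 * σ) (hT : 0 ≤ T)
    (hR : 0 ≤ R) (hs : 0 ≤ s) (hsk : s < k + 1) (hε : 0 < ε) {a₀ : 𝓢(Space d, ℂ)}
    (hv : IsDispersionlessSolution lam σ (a₀.toLp 2 volume) v)
    (hvR : ∀ t ∈ Set.Icc 0 T, sobolevNorm (k + 1) (v t) ≤ ENNReal.ofReal R)
    {Q : ℕ → Space d → ℝ} (hQ : ∀ n, AEMeasurable (Q n) volume)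
    (hlim : ∀ᵐ ξ, Tendsto (fun n => Q n ξ) atTop (𝓝 0)) :
    ∀ᶠ n in atTop, ∃ u : ℝ → L2 d, IsSolution (hQ n) lam σ a₀ T u ∧
      sobolevNorm s (u T - v T) ≤ ENNReal.ofReal ε := by
  obtain ⟨ρ, hρ, hρk⟩ : ∃ ρ : ℝ, max ((d : ℝ) / 2) k < ρ ∧ ρ < (k : ℝ) + 1 :=
    exists_between (max_lt hk (lt_add_one _))
  obtain ⟨hdρ, hkρ⟩ := max_lt_iff.1 hρ
  have hρ₀ : 0 ≤ ρ := le_trans (by positivity) hkρ.le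
  obtain ⟨K, C, N, hNlip, hN⟩ := exists_isTruncation (d := d) hσ hdρ hkρ.le hρk.le hreg
    (M := R + 1) (by positivity)
  have hL : 0 ≤ |lam| * C := by positivity
  have hK : 0 ≤ |lam| * K := by positivity
  obtain ⟨δ₁, hδ₁, hnear₁⟩ :=
    exists_sobolevNorm_sub_le_of_mem_tube (d := d) hρ₀ hρk hR hL hK hvR one_pos
  obtain ⟨δ₂, hδ₂, hnear₂⟩ :=
    exists_sobolevNorm_sub_le_of_mem_tube (d := d) hs hsk hR hL hK hvR hε
  have htube : ∀ t ∈ Set.Icc 0 T,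
      ∀ f ∈ tube (k + 1) v R (|lam| * C) (min δ₁ δ₂) (|lam| * K) t,
        sobolevNorm ρ f ≤ ENNReal.ofReal (R + 1) := fun t ht f hf => by
    rw [ENNReal.ofReal_add hR zero_le_one]
    exact (sobolevNorm_le_add_sub ρ f (v t)).trans (add_le_add
      ((sobolevNorm_mono hρk.le _).trans (hvR t ht)) (hnear₁ _ (min_le_left _ _) t ht f hf))
  have hδ : 0 < min δ₁ δ₂ := lt_min hδ₁ hδ₂
  filter_upwards [(tendsto_duhamelDefect hQ hlim (a₀.toLp 2 volume) (-(Complex.I * (lam : ℂ)))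
    (hNlip.continuous.comp hv.1) T).eventually_le_const hδ] with n hn
  obtain ⟨u, hu, hmem⟩ := exists_isSolution_mem_tube (hQ n) hdρ hρk hR (by linarith) hT hNlip hN hv
    hvR hδ.le htube hn
  have hTT : T ∈ Set.Icc 0 T := ⟨hT, le_rfl⟩
  exact ⟨u, hu, hnear₂ _ (min_le_right _ _) T hTT _ (hmem T hTT)⟩

end DispersionlessLimit

section Oscillation

/-- The inclusion of real-valued into complex-valued Schwartz functions. -/
def ofRealSchwartz (γ : 𝓢(Space d, ℝ)) : 𝓢(Space d, ℂ) :=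
  SchwartzMap.postcompCLM Complex.ofRealCLM γ

@[simp] lemma ofRealSchwartz_apply (γ : 𝓢(Space d, ℝ)) (x : Space d) :
    ofRealSchwartz γ x = γ x := rfl

variable (γ : 𝓢(Space d, ℝ)) (b : 𝓢(Space d, ℂ))

/-- The modulated function `e^{-itγ} b`, which solves `i ∂ₜ v = γ v`. -/
def oscFun (t : ℝ) (x : Space d) : ℂ := Complex.exp ((-(t * γ x) : ℝ) * Complex.I) * b x

lemma norm_oscFun (t : ℝ) (x : Space d) : ‖oscFun γ b t x‖ = ‖b x‖ := by
  rw [oscFun, norm_mul, Complex.norm_exp_ofReal_mul_I, one_mul]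

lemma continuous_oscFun (t : ℝ) : Continuous (oscFun γ b t) := by
  have hγ := γ.continuous
  have hb := b.continuous
  unfold oscFun
  fun_prop

lemma integrable_oscFun (t : ℝ) : Integrable (oscFun γ b t) :=
  b.integrable.mono (continuous_oscFun γ b t).aestronglyMeasurable
    (Eventually.of_forall fun x => (norm_oscFun γ b t x).le)

lemma memLp_oscFun (t : ℝ) : MemLp (oscFun γ b t) 2 volume :=
  (b.memLp 2 volume).of_le (continuous_oscFun γ b t).aestronglyMeasurable
    (Eventually.of_forall fun x => (norm_oscFun γ b t x).le)

/-- The modulated function `e^{-itγ} b` as an element of `L²`. -/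
def osc (t : ℝ) : L2 d := (memLp_oscFun γ b t).toLp

lemma coeFn_osc (t : ℝ) : osc γ b t =ᵐ[volume] oscFun γ b t := MemLp.coeFn_toLp _

lemma osc_zero : osc γ b 0 = b.toLp 2 volume := by
  refine MemLp.toLp_congr _ _ (Eventually.of_forall fun x => ?_)
  simp [oscFun]

lemma oscFun_sub_sub (t t' : ℝ) (x : Space d) :
    oscFun γ b t' x - oscFun γ b t x -
        (t' - t) • (-Complex.I • oscFun γ (schwartzMul (ofRealSchwartz γ) b) t x) =
      (Complex.exp (-((t' - t) * γ x) * Complex.I) - 1 - -((t' - t) * γ x) * Complex.I) *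
        oscFun γ b t x := by
  have hexp : Complex.exp ((-(t' * γ x) : ℝ) * Complex.I) =
      Complex.exp (-((t' - t) * γ x) * Complex.I) *
        Complex.exp ((-(t * γ x) : ℝ) * Complex.I) := by
    rw [← Complex.exp_add]
    congr 1
    push_cast
    ring
  simp only [oscFun, hexp, schwartzMul_apply, ofRealSchwartz_apply, Complex.real_smul,
    smul_eq_mul, Complex.ofReal_sub]
  ring

lemma norm_oscFun_sub_sub_le {K t t' : ℝ} {x : Space d} (hK : ‖γ x‖ ≤ K)
    (ht : |t' - t| * K ≤ 1) :
    ‖oscFun γ b t' x - oscFun γ b t x -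
        (t' - t) • (-Complex.I • oscFun γ (schwartzMul (ofRealSchwartz γ) b) t x)‖ ≤
      (|t' - t| * K) ^ 2 * ‖b x‖ := by
  have hz : ‖-((t' - t : ℂ) * γ x) * Complex.I‖ ≤ |t' - t| * K := by
    rw [norm_mul, norm_neg, norm_mul, Complex.norm_I, mul_one, Complex.norm_real,
      ← Complex.ofReal_sub, Complex.norm_real, Real.norm_eq_abs (t' - t)]
    gcongr
  rw [oscFun_sub_sub, norm_mul, norm_oscFun]
  gcongr
  exact (Complex.norm_exp_sub_one_sub_id_le (hz.trans ht)).trans (by gcongr)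

lemma norm_osc_sub_sub_le {K t t' : ℝ} (hK : ∀ x, ‖γ x‖ ≤ K) (ht : |t' - t| * K ≤ 1) :
    ‖osc γ b t' - osc γ b t -
        (t' - t) • (-Complex.I • osc γ (schwartzMul (ofRealSchwartz γ) b) t)‖ ≤
      (|t' - t| * K) ^ 2 * ‖b.toLp 2 volume‖ := by
  apply Lp.norm_le_mul_norm_of_ae_le_mul
  set b' := schwartzMul (ofRealSchwartz γ) b
  filter_upwards [coeFn_osc γ b t, coeFn_osc γ b t', coeFn_osc γ b' t, b.coeFn_toLp 2 volume,
    Lp.coeFn_sub (osc γ b t' - osc γ b t) ((t' - t) • (-Complex.I • osc γ b' t)),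
    Lp.coeFn_sub (osc γ b t') (osc γ b t), Lp.coeFn_smul (t' - t) (-Complex.I • osc γ b' t),
    Lp.coeFn_smul (-Complex.I) (osc γ b' t)] with x ht₀ ht₁ hb' hb hsub hsub' hsmul hsmul'
  rw [hsub, Pi.sub_apply, hsub', hsmul, Pi.sub_apply, Pi.smul_apply, hsmul', Pi.smul_apply,
    ht₀, ht₁, hb', hb]
  exact norm_oscFun_sub_sub_le γ b (hK x) ht

lemma hasDerivAt_osc (t : ℝ) :
    HasDerivAt (osc γ b) (-Complex.I • osc γ (schwartzMul (ofRealSchwartz γ) b) t) t := by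
  set K := SchwartzMap.seminorm ℝ 0 0 γ
  rw [hasDerivAt_iff_isLittleO]
  refine Asymptotics.IsBigO.trans_isLittleO (g := fun t' => ‖t' - t‖ ^ 2) ?_
    (Asymptotics.isLittleO_pow_sub_sub t one_lt_two)
  apply Asymptotics.IsBigO.of_bound (K ^ 2 * ‖b.toLp 2 volume‖)
  have hnear : ∀ᶠ t' in 𝓝 t, |t' - t| * K ≤ 1 := by
    have hcont : Continuous fun t' => |t' - t| * K := by fun_prop
    have hlim := hcont.tendsto t
    simp only [sub_self, abs_zero, zero_mul] at hlim
    exact hlim.eventually_le_const one_pos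
  filter_upwards [hnear] with t' ht'
  refine (norm_osc_sub_sub_le γ b (γ.norm_le_seminorm ℝ) ht').trans_eq ?_
  rw [norm_pow, norm_norm, Real.norm_eq_abs]
  ring

lemma continuous_osc : Continuous (osc γ b) :=
  continuous_iff_continuousAt.2 fun t => (hasDerivAt_osc γ b t).continuousAt

lemma osc_eq_sub_integral (t : ℝ) :
    osc γ b t = b.toLp 2 volume -
      Complex.I • ∫ τ in (0 : ℝ)..t, osc γ (schwartzMul (ofRealSchwartz γ) b) τ := by
  have hderiv_cont :
      Continuous fun τ => -Complex.I • osc γ (schwartzMul (ofRealSchwartz γ) b) τ :=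
    (continuous_const_smul (-Complex.I)).comp (continuous_osc γ _)
  have hftc := intervalIntegral.integral_eq_sub_of_hasDerivAt (a := 0) (b := t)
    (fun τ _ => hasDerivAt_osc γ b τ) (hderiv_cont.intervalIntegrable _ _)
  rw [intervalIntegral.integral_smul, osc_zero, neg_smul] at hftc
  rw [sub_eq_add_neg, hftc, add_sub_cancel]

end Oscillation

lemma wirtingerBound_zero_mul_exp {M c₀ : ℝ} {b c : ℂ} (hc : ‖c‖ ≤ c₀) :
    WirtingerBound M (‖b‖ * Real.exp (c₀ * M)) 0 (fun z => b * Complex.exp (c * z)) := by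
  refine ⟨by fun_prop, fun z hz => ?_⟩
  have hc₀ : 0 ≤ c₀ := (norm_nonneg c).trans hc
  rw [norm_mul, Complex.norm_exp]
  gcongr
  refine (Complex.re_le_norm _).trans ?_
  rw [norm_mul]
  gcongr

lemma wirtingerBound_mul_exp (M : ℝ) {c₀ : ℝ} {b c : ℂ} (hc : ‖c‖ ≤ c₀) (k : ℕ) :
    WirtingerBound M (‖b‖ * (1 + c₀) ^ k * Real.exp (c₀ * M)) k
      (fun z => b * Complex.exp (c * z)) := by
  have hc₀ : 0 ≤ c₀ := (norm_nonneg c).trans hc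
  induction k generalizing b with
  | zero => simpa using wirtingerBound_zero_mul_exp hc
  | succ k ih =>
    have hpow : 1 ≤ (1 + c₀) ^ (k + 1) := one_le_pow₀ (by linarith)
    have hzero : WirtingerBound M (‖b‖ * (1 + c₀) ^ (k + 1) * Real.exp (c₀ * M)) 0
        (fun z => b * Complex.exp (c * z)) :=
      (wirtingerBound_zero_mul_exp hc).mono (by
        gcongr
        exact le_mul_of_one_le_right (norm_nonneg b) hpow)
    have hderiv : WirtingerBound M (‖b‖ * (1 + c₀) ^ (k + 1) * Real.exp (c₀ * M)) k
        (fun z => b * c * Complex.exp (c * z)) :=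
      ih.mono (by
        rw [norm_mul, pow_succ', ← mul_assoc]
        gcongr
        linarith)
    have hconj := (wirtingerBound_const_zero M k).mono
      (by positivity : (0 : ℝ) ≤ ‖b‖ * (1 + c₀) ^ (k + 1) * Real.exp (c₀ * M))
    refine ⟨hzero, _, _, fun z => ?_, hderiv, hconj⟩
    have hd : HasDerivAt (fun z => b * Complex.exp (c * z)) (b * c * Complex.exp (c * z)) z :=
      ((hasDerivAt_const_mul c).cexp.const_mul b).congr_deriv (by ring)
    exact hasFDerivAt_wirtinger (hd.hasFDerivAt.restrictScalars ℝ) fun w => by simp [mul_comm]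

lemma funSobolevNorm_schwartz_ne_top (s : ℝ) (f : 𝓢(Space d, ℂ)) : funSobolevNorm s f ≠ ∞ := by
  have hfin := ((SchwartzMap.smulLeftCLM ℂ (fun ξ : Space d => ((bracket ξ ^ (s / 2) : ℝ) : ℂ))
    (𝓕 f)).memLp 2 volume).2.ne
  refine ne_of_eq_of_ne (congrArg (fun g => eLpNorm g 2 volume) ?_) hfin
  ext ξ
  rw [SchwartzMap.smulLeftCLM_apply_apply (hasTemperateGrowth_bracket_rpow _), smul_eq_mul,
    SchwartzMap.fourier_coe]

lemma exists_mem_schwartzBall (ρ : ℝ) (u : 𝓢(Space d, ℂ)) : ∃ M, u ∈ schwartzBall d ρ M := by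
  refine ⟨max (SchwartzMap.seminorm ℝ 0 0 u) (funSobolevNorm ρ u).toReal,
    fun x => (u.norm_le_seminorm ℝ x).trans (le_max_left _ _), ?_⟩
  exact (ENNReal.le_ofReal_iff_toReal_le (funSobolevNorm_schwartz_ne_top ρ u)
    (le_max_of_le_right ENNReal.toReal_nonneg)).2 (le_max_right _ _)

lemma exists_funSobolevNorm_exp_mul_le (u : 𝓢(Space d, ℂ)) (c₀ : ℝ) (k : ℕ) :
    ∃ C : ℝ≥0∞, C ≠ ∞ ∧ ∀ c : ℂ, ‖c‖ ≤ c₀ → ∀ f : 𝓢(Space d, ℂ),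
      funSobolevNorm k (fun x => Complex.exp (c * u x) * f x) ≤ C * funSobolevNorm k f := by
  set ρ : ℝ := max k (d / 2 + 1)
  have hρ : (d : ℝ) / 2 < ρ := (lt_add_one _).trans_le (le_max_right _ _)
  obtain ⟨M, hu⟩ := exists_mem_schwartzBall ρ u
  obtain ⟨C, hC, hbound⟩ := exists_compMulBound hρ M
    (‖(1 : ℂ)‖ * (1 + c₀) ^ k * Real.exp (c₀ * M)) k (le_max_left _ _)
  refine ⟨C, hC, fun c hc f => ?_⟩
  simpa only [one_mul] using hbound _ (wirtingerBound_mul_exp M hc k (b := 1)) u hu f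

lemma exists_sobolevNorm_osc_le (γ : 𝓢(Space d, ℝ)) (b : 𝓢(Space d, ℂ)) (k : ℕ) (T : ℝ) :
    ∃ R : ℝ, 0 ≤ R ∧ ∀ t ∈ Set.Icc 0 T, sobolevNorm k (osc γ b t) ≤ ENNReal.ofReal R := by
  obtain ⟨C, hC, hbound⟩ := exists_funSobolevNorm_exp_mul_le (ofRealSchwartz γ) T k
  refine ⟨(C * funSobolevNorm k b).toReal, ENNReal.toReal_nonneg, fun t ht => ?_⟩
  rw [ENNReal.ofReal_toReal (ENNReal.mul_ne_top hC (funSobolevNorm_schwartz_ne_top _ _)), osc,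
    sobolevNorm_toLp _ (integrable_oscFun γ b t)]
  have hc : ‖-(t * Complex.I)‖ ≤ T := by
    rw [norm_neg, norm_mul, Complex.norm_I, mul_one, Complex.norm_real,
      Real.norm_of_nonneg ht.1]
    exact ht.2
  refine le_trans (le_of_eq (congrArg _ (funext fun x => ?_))) (hbound _ hc b)
  rw [oscFun, ofRealSchwartz_apply]
  congr 2
  push_cast
  ring

/-- The homogeneous Sobolev norm `‖|D|^s f‖_{L²}`, which scales exactly under dilations. -/
def homNorm (s : ℝ) (f : L2 d) : ℝ≥0∞ :=
  eLpNorm (fun ξ : Space d => ((‖(2 * Real.pi) • ξ‖ ^ s : ℝ) : ℂ) * (𝓕 f : L2 d) ξ) 2 volume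

lemma norm_two_pi_smul_rpow_le {s : ℝ} (hs : 0 ≤ s) (ξ : Space d) :
    ‖(2 * Real.pi) • ξ‖ ^ s ≤ bracket ξ ^ (s / 2) := by
  rw [norm_rpow_eq_sq_rpow_half]
  gcongr
  exact le_add_of_nonneg_left zero_le_one

lemma homNorm_le_sobolevNorm {s : ℝ} (hs : 0 ≤ s) (f : L2 d) : homNorm s f ≤ sobolevNorm s f := by
  rw [homNorm, sobolevNorm_eq_eLpNorm]
  refine eLpNorm_mono fun ξ => ?_
  rw [norm_mul, norm_mul, norm_ofReal_bracket_rpow, Complex.norm_real,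
    Real.norm_of_nonneg (by positivity)]
  gcongr
  exact norm_two_pi_smul_rpow_le hs ξ

lemma continuous_norm_smul_rpow {s : ℝ} (hs : 0 ≤ s) (c : ℝ) :
    Continuous fun ξ : Space d => ‖c • ξ‖ ^ s :=
  (continuous_const_smul c).norm.rpow_const fun _ => Or.inr hs

lemma aestronglyMeasurable_norm_rpow_mul_fourier {s : ℝ} (hs : 0 ≤ s) (f : L2 d) :
    AEStronglyMeasurable
      (fun ξ : Space d => ((‖(2 * Real.pi) • ξ‖ ^ s : ℝ) : ℂ) * (𝓕 f : L2 d) ξ) volume :=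
  (Complex.continuous_ofReal.comp (continuous_norm_smul_rpow hs _)).aestronglyMeasurable.mul
    (Lp.aestronglyMeasurable _)

lemma homNorm_le_add_sub {s : ℝ} (hs : 0 ≤ s) (f g : L2 d) :
    homNorm s f ≤ homNorm s g + homNorm s (g - f) := by
  refine le_trans (le_of_eq (eLpNorm_congr_ae ?_))
    (eLpNorm_sub_le (aestronglyMeasurable_norm_rpow_mul_fourier hs g)
      (aestronglyMeasurable_norm_rpow_mul_fourier hs (g - f)) (by norm_num))
  filter_upwards [coeFn_fourier_sub g f] with ξ hξ
  simp only [Pi.sub_apply]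
  rw [hξ]
  ring

lemma homNorm_toLp {f : Space d → ℂ} (s : ℝ) (h1 : Integrable f) (h2 : MemLp f 2 volume) :
    homNorm s (h2.toLp f) =
      eLpNorm (fun ξ : Space d => ‖(2 * Real.pi) • ξ‖ ^ s * ‖𝓕 f ξ‖) 2 volume := by
  refine eLpNorm_congr_norm_ae ?_
  filter_upwards [coeFn_fourier_toLp h1 h2] with ξ hξ
  rw [hξ, norm_mul, norm_mul, norm_norm, Complex.norm_real]

lemma eLpNorm_fourier {f : Space d → ℂ} (h1 : Integrable f) (h2 : MemLp f 2 volume) :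
    eLpNorm (𝓕 f) 2 volume = eLpNorm f 2 volume := by
  rw [← funSobolevNorm_zero h1 h2, funSobolevNorm]
  simp

lemma fourier_translate_sub {f : Space d → ℂ} (hf : Integrable f) (y ξ : Space d) :
    𝓕 (fun x => f (x + y) - f x) ξ =
      (Complex.exp (Complex.I * (2 * Real.pi * inner ℝ y ξ : ℝ)) - 1) * 𝓕 f ξ := by
  have htranslate : 𝓕 (fun x => f (x + y)) ξ =
      Complex.exp (Complex.I * (2 * Real.pi * inner ℝ y ξ : ℝ)) * 𝓕 f ξ := by
    refine (congrFun (VectorFourier.fourierIntegral_comp_add_right Real.fourierChar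
      (volume : Measure (Space d)) (innerₗ (Space d)) f y) ξ).trans ?_
    simp only [Circle.smul_def, smul_eq_mul, Real.fourierChar_apply, innerₗ_apply_apply]
    rw [mul_comm Complex.I]
    rfl
  have hsub : 𝓕 (fun x => f (x + y) - f x) ξ = 𝓕 (fun x => f (x + y)) ξ - 𝓕 f ξ := by
    rw [Real.fourier_eq, Real.fourier_eq, Real.fourier_eq, ← integral_sub
      ((Real.fourierIntegral_convergent_iff ξ).2 (hf.comp_add_right y))
      ((Real.fourierIntegral_convergent_iff ξ).2 hf)]
    simp_rw [smul_sub]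
  rw [hsub, htranslate]
  ring

lemma norm_exp_I_mul_sub_one_le_two_mul_rpow (θ : ℝ) {p : ℝ} (hp : p ∈ Set.Ioc (0 : ℝ) 1) :
    ‖Complex.exp (Complex.I * θ) - 1‖ ≤ 2 * |θ| ^ p := by
  rcases le_total |θ| 1 with h | h
  · have hle : |θ| ≤ |θ| ^ p := by
      simpa using Real.rpow_le_rpow_of_exponent_ge' (abs_nonneg θ) h hp.1.le hp.2
    have hexp := Real.norm_exp_I_mul_ofReal_sub_one_le (x := θ)
    rw [Real.norm_eq_abs] at hexp
    linarith [abs_nonneg θ]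
  · have hle : 1 ≤ |θ| ^ p := Real.one_le_rpow h hp.1.le
    refine (norm_sub_le _ _).trans ?_
    rw [mul_comm Complex.I, Complex.norm_exp_ofReal_mul_I, norm_one]
    linarith

lemma rpow_min_one_le_one_add_rpow {X s : ℝ} (hX : 0 ≤ X) (hs : 0 ≤ s) :
    X ^ min s 1 ≤ 1 + X ^ s := by
  rcases le_total X 1 with h | h
  · have hle : X ^ min s 1 ≤ 1 := Real.rpow_le_one hX h (le_min hs zero_le_one)
    linarith [Real.rpow_nonneg hX s]
  · linarith [Real.rpow_le_rpow_of_exponent_le h (min_le_left s 1)]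

lemma norm_exp_inner_sub_one_le {s : ℝ} (hs : 0 < s) (y ξ : Space d) :
    ‖Complex.exp (Complex.I * (2 * Real.pi * inner ℝ y ξ : ℝ)) - 1‖ ≤
      2 * ‖y‖ ^ min s 1 * (1 + ‖(2 * Real.pi) • ξ‖ ^ s) := by
  have hp : min s 1 ∈ Set.Ioc (0 : ℝ) 1 := ⟨lt_min hs one_pos, min_le_right _ _⟩
  have hinner : |2 * Real.pi * inner ℝ y ξ| ≤ ‖y‖ * ‖(2 * Real.pi) • ξ‖ := by
    rw [← real_inner_smul_right]
    exact abs_real_inner_le_norm _ _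
  calc _ ≤ 2 * |2 * Real.pi * inner ℝ y ξ| ^ min s 1 :=
        norm_exp_I_mul_sub_one_le_two_mul_rpow _ hp
    _ ≤ 2 * (‖y‖ * ‖(2 * Real.pi) • ξ‖) ^ min s 1 := by
        gcongr
    _ = 2 * ‖y‖ ^ min s 1 * ‖(2 * Real.pi) • ξ‖ ^ min s 1 := by
        rw [Real.mul_rpow (norm_nonneg _) (norm_nonneg _), mul_assoc]
    _ ≤ _ := by
        gcongr
        exact rpow_min_one_le_one_add_rpow (norm_nonneg _) hs.le

lemma eLpNorm_translate_sub_le {s : ℝ} (hs : 0 < s) {f : Space d → ℂ} (h1 : Integrable f)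
    (h2 : MemLp f 2 volume) (y : Space d) :
    eLpNorm (fun x => f (x + y) - f x) 2 volume ≤ ENNReal.ofReal (2 * ‖y‖ ^ min s 1) *
      (eLpNorm f 2 volume + homNorm s (h2.toLp f)) := by
  have h1' : Integrable fun x => f (x + y) - f x := (h1.comp_add_right y).sub h1
  have h2' : MemLp (fun x => f (x + y) - f x) 2 volume :=
    (h2.comp_measurePreserving (measurePreserving_add_right volume y)).sub h2
  have hF := (continuous_fourier h1).norm
  rw [← eLpNorm_fourier h1' h2', ← eLpNorm_fourier h1 h2, homNorm_toLp s h1 h2,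
    ← eLpNorm_norm (𝓕 f)]
  refine le_trans ?_ (mul_le_mul_right (eLpNorm_add_le hF.aestronglyMeasurable
    ((continuous_norm_smul_rpow hs.le _).mul hF).aestronglyMeasurable (by norm_num)) _)
  refine eLpNorm_le_mul_eLpNorm_of_ae_le_mul (Eventually.of_forall fun ξ => ?_) 2
  rw [fourier_translate_sub h1, Pi.add_apply, Pi.mul_apply, ← one_add_mul, norm_mul, norm_mul,
    norm_norm, ← mul_assoc,
    Real.norm_of_nonneg (by positivity : (0 : ℝ) ≤ 1 + ‖(2 * Real.pi) • ξ‖ ^ s)]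
  gcongr
  exact norm_exp_inner_sub_one_le hs y ξ

section OscillationGrowth

/-- The increment of `e^{-itγ} b` between `x` and `x + y`, divided by the phase `e^{-itγ(x)}`. -/
def oscIncrement (γ : 𝓢(Space d, ℝ)) (b : 𝓢(Space d, ℂ)) (t : ℝ) (y x : Space d) : ℂ :=
  Complex.exp ((-(t * (γ (x + y) - γ x)) : ℝ) * Complex.I) * b (x + y) - b x

variable (γ : 𝓢(Space d, ℝ)) (b : 𝓢(Space d, ℂ))

lemma continuous_oscIncrement (t : ℝ) (y : Space d) : Continuous (oscIncrement γ b t y) := by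
  have hγ := γ.continuous
  have hb := b.continuous
  unfold oscIncrement
  fun_prop

lemma norm_oscIncrement (t : ℝ) (y x : Space d) :
    ‖oscIncrement γ b t y x‖ = ‖oscFun γ b t (x + y) - oscFun γ b t x‖ := by
  have hexp : Complex.exp ((-(t * γ (x + y)) : ℝ) * Complex.I) =
      Complex.exp ((-(t * γ x) : ℝ) * Complex.I) *
        Complex.exp ((-(t * (γ (x + y) - γ x)) : ℝ) * Complex.I) := by
    rw [← Complex.exp_add]
    congr 1
    push_cast
    ring
  rw [oscFun, oscFun, hexp, mul_assoc, ← mul_sub, norm_mul, Complex.norm_exp_ofReal_mul_I,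
    one_mul, oscIncrement]

lemma tendsto_oscIncrement (y x : Space d) :
    Tendsto (fun n : ℕ => oscIncrement γ b n ((n : ℝ)⁻¹ • y) x) atTop
      (𝓝 (Complex.exp ((-fderiv ℝ γ x y : ℝ) * Complex.I) * b x - b x)) := by
  have hy : Tendsto (fun n : ℕ => x + (n : ℝ)⁻¹ • y) atTop (𝓝 x) := by
    simpa using ((tendsto_inv_atTop_nhds_zero_nat (𝕜 := ℝ)).smul_const y).const_add x
  have hγ : Tendsto (fun n : ℕ => (n : ℝ) • (γ (x + (n : ℝ)⁻¹ • y) - γ x)) atTop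
      (𝓝 (fderiv ℝ γ x y)) :=
    (γ.hasFDerivAt x).lim y (by simpa using tendsto_natCast_atTop_atTop (R := ℝ))
  have hexp : Continuous fun r : ℝ => Complex.exp ((-r : ℝ) * Complex.I) := by fun_prop
  exact (((hexp.tendsto _).comp hγ).mul ((b.continuous.tendsto x).comp hy)).sub_const _

variable {γ b}

lemma tendsto_eLpNorm_oscIncrement {s : ℝ} (hs : 0 < s) {A : ℝ≥0∞} (hA : A ≠ ∞)
    (hbound : ∀ n : ℕ, 0 < n → homNorm s (osc γ b n) ≤ A) (y : Space d) :
    Tendsto (fun n : ℕ => eLpNorm (oscIncrement γ b n ((n : ℝ)⁻¹ • y)) 2 volume) atTop (𝓝 0) := by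
  have hy : Tendsto (fun n : ℕ => (n : ℝ)⁻¹ • y) atTop (𝓝 0) := by
    simpa using (tendsto_inv_atTop_nhds_zero_nat (𝕜 := ℝ)).smul_const y
  have hupper : Tendsto (fun n : ℕ => ENNReal.ofReal (2 * ‖(n : ℝ)⁻¹ • y‖ ^ min s 1) *
      (eLpNorm b 2 volume + A)) atTop (𝓝 0) := by
    have hpow := ((tendsto_norm_rpow_zero (Space d) (lt_min hs one_pos)).comp hy).const_mul 2
    have hmul := ENNReal.Tendsto.mul_const (b := eLpNorm b 2 volume + A)
      (ENNReal.tendsto_ofReal hpow)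
      (Or.inr (ENNReal.add_ne_top.2 ⟨(b.memLp 2 volume).2.ne, hA⟩))
    simpa using hmul
  refine tendsto_of_tendsto_of_tendsto_of_le_of_le' tendsto_const_nhds hupper
    (Eventually.of_forall fun _ => zero_le) ?_
  filter_upwards [eventually_gt_atTop 0] with n hn
  rw [eLpNorm_congr_norm_ae (Eventually.of_forall (norm_oscIncrement γ b n _))]
  refine (eLpNorm_translate_sub_le hs (integrable_oscFun γ b n) (memLp_oscFun γ b n) _).trans ?_
  gcongr
  · exact (eLpNorm_congr_norm_ae (Eventually.of_forall (norm_oscFun γ b n))).le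
  · exact hbound n hn

lemma exp_fderiv_mul_eq_of_homNorm_osc_le {s : ℝ} (hs : 0 < s) {A : ℝ≥0∞} (hA : A ≠ ∞)
    (hbound : ∀ n : ℕ, 0 < n → homNorm s (osc γ b n) ≤ A) (x y : Space d) :
    Complex.exp ((-fderiv ℝ γ x y : ℝ) * Complex.I) * b x = b x := by
  set w : Space d → ℂ := fun x => Complex.exp ((-fderiv ℝ γ x y : ℝ) * Complex.I) * b x - b x
  have hw : Continuous w := by
    have hb := b.continuous
    have hγ : Continuous fun x => fderiv ℝ γ x y :=
      ((γ.smooth 1).continuous_fderiv one_ne_zero).clm_apply continuous_const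
    fun_prop
  have hnorm : eLpNorm w 2 volume = 0 := by
    have hfatou := Lp.eLpNorm_lim_le_liminf_eLpNorm (p := 2) (μ := volume)
      (fun n : ℕ => (continuous_oscIncrement γ b n ((n : ℝ)⁻¹ • y)).aestronglyMeasurable) w
      (Eventually.of_forall (tendsto_oscIncrement γ b y))
    rw [(tendsto_eLpNorm_oscIncrement hs hA hbound y).liminf_eq] at hfatou
    exact le_antisymm hfatou zero_le
  rw [eLpNorm_eq_zero_iff hw.aestronglyMeasurable two_ne_zero] at hnorm
  exact sub_eq_zero.1 (congrFun ((hw.ae_eq_iff_eq volume continuous_zero).1 hnorm) x)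

-- At times `n`, the translation by `y / n` shifts the phase by about `∂_y γ`; a bound on the
-- norms would make the translated functions `L²`-close, which is absurd once `∂_y γ = π`.
theorem exists_lt_homNorm_osc {s : ℝ} (hs : 0 < s) {x₀ : Space d} (hb : b x₀ ≠ 0)
    (hγ : fderiv ℝ γ x₀ ≠ 0) {A : ℝ≥0∞} (hA : A ≠ ∞) :
    ∃ n : ℕ, 0 < n ∧ A < homNorm s (osc γ b n) := by
  by_contra! hbound
  obtain ⟨e, he⟩ : ∃ e, fderiv ℝ γ x₀ e ≠ 0 := by
    contrapose! hγ
    exact ContinuousLinearMap.ext hγ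
  have heq := exp_fderiv_mul_eq_of_homNorm_osc_le hs hA hbound x₀
    ((Real.pi / fderiv ℝ γ x₀ e) • e)
  rw [map_smul, smul_eq_mul, div_mul_cancel₀ _ he, Complex.ofReal_neg, neg_mul, Complex.exp_neg,
    Complex.exp_pi_mul_I, inv_neg, inv_one, neg_one_mul] at heq
  exact hb (self_eq_neg.1 heq.symm)

end OscillationGrowth

section Profile

/-- The bump function `exp (-c / (1 - ‖x‖²))` of the unit ball. The family is closed under positive
powers, so that the phase `|a₀|^{2σ}` of the profile `a₀ = bump 1` is smooth for every `σ > 0`. -/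
def bump (c : ℝ) (x : Space d) : ℝ := expNegInvGlue ((1 - ‖x‖ ^ 2) / c)

lemma contDiff_bump (c : ℝ) {n : ℕ∞} : ContDiff ℝ n (bump c : Space d → ℝ) :=
  expNegInvGlue.contDiff.comp ((contDiff_const.sub (contDiff_norm_sq ℝ)).div_const c)

lemma bump_nonneg (c : ℝ) (x : Space d) : 0 ≤ bump c x := expNegInvGlue.nonneg _

lemma bump_eq_zero_iff {c : ℝ} (hc : 0 < c) {x : Space d} : bump c x = 0 ↔ 1 ≤ ‖x‖ := by
  rw [bump, expNegInvGlue.zero_iff_nonpos, div_le_iff₀ hc, zero_mul, sub_nonpos,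
    one_le_sq_iff₀ (norm_nonneg x)]

lemma expNegInvGlue_rpow {c : ℝ} (hc : 0 < c) (r : ℝ) :
    expNegInvGlue r ^ c = expNegInvGlue (r / c) := by
  unfold expNegInvGlue
  rcases le_or_gt r 0 with hr | hr
  · rw [if_pos hr, if_pos (div_nonpos_of_nonpos_of_nonneg hr hc.le), Real.zero_rpow hc.ne']
  · rw [if_neg hr.not_ge, if_neg (div_pos hr hc).not_ge, ← Real.exp_mul]
    congr 1
    field_simp

lemma bump_one_rpow {c : ℝ} (hc : 0 < c) (x : Space d) : bump 1 x ^ c = bump c x := by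
  rw [bump, div_one, expNegInvGlue_rpow hc, bump]

lemma hasCompactSupport_bump {c : ℝ} (hc : 0 < c) :
    HasCompactSupport (bump c : Space d → ℝ) := by
  refine HasCompactSupport.intro (isCompact_closedBall (0 : Space d) 1) fun x hx => ?_
  rw [Metric.mem_closedBall, dist_zero_right, not_le] at hx
  exact (bump_eq_zero_iff hc).2 hx.le

/-- The function `bump c` as a Schwartz function. -/
def schwartzBump {c : ℝ} (hc : 0 < c) : 𝓢(Space d, ℝ) :=
  (hasCompactSupport_bump hc).toSchwartzMap (contDiff_bump c)

@[simp] lemma schwartzBump_apply {c : ℝ} (hc : 0 < c) (x : Space d) :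
    schwartzBump hc x = bump c x := rfl

-- The zeros of `f` are minima, hence critical points.
lemma exists_ne_zero_and_fderiv_ne_zero {E : Type*} [NormedAddCommGroup E] [NormedSpace ℝ E]
    {f : E → ℝ} (hf : Differentiable ℝ f) (hf_nonneg : ∀ x, 0 ≤ f x) {x y : E}
    (hxy : f x ≠ f y) : ∃ z, f z ≠ 0 ∧ fderiv ℝ f z ≠ 0 := by
  by_contra! hcrit
  refine hxy (is_const_of_fderiv_eq_zero hf (fun z => ?_) x y)
  by_cases hz : f z = 0
  · exact IsLocalMin.fderiv_eq_zero (Eventually.of_forall fun w => hz.trans_le (hf_nonneg w))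
  · exact hcrit z hz

lemma exists_bump_ne_zero_and_fderiv_ne_zero (hd : 0 < d) {c : ℝ} (hc : 0 < c) :
    ∃ x : Space d, bump c x ≠ 0 ∧ fderiv ℝ (bump c) x ≠ 0 := by
  have : Nonempty (Fin d) := Fin.pos_iff_nonempty.1 hd
  obtain ⟨e, he⟩ := exists_norm_eq (Space d) zero_le_one
  refine exists_ne_zero_and_fderiv_ne_zero (x := 0) (y := e)
    ((contDiff_bump c (n := 1)).differentiable one_ne_zero) (bump_nonneg c) ?_
  rw [(bump_eq_zero_iff hc).2 he.ge, Ne, bump_eq_zero_iff hc, norm_zero]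
  exact not_le.2 one_pos

lemma isDispersionlessSolution_osc {lam σ : ℝ} (hlam : lam ≠ 0) {γ : 𝓢(Space d, ℝ)}
    {b : 𝓢(Space d, ℂ)} (hγ : ∀ x, γ x = lam * ‖b x‖ ^ (2 * σ)) :
    IsDispersionlessSolution lam σ (b.toLp 2 volume) (osc γ b) := by
  have hlam' : (lam : ℂ) ≠ 0 := Complex.ofReal_ne_zero.2 hlam
  set b' := schwartzMul (ofRealSchwartz γ) b
  refine ⟨continuous_osc γ b, fun t => (lam : ℂ)⁻¹ • osc γ b' t, fun t => ?_, fun t => ?_⟩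
  · filter_upwards [coeFn_osc γ b t, coeFn_osc γ b' t,
      Lp.coeFn_smul (lam : ℂ)⁻¹ (osc γ b' t)] with x hb hb' hsmul
    rw [hsmul, Pi.smul_apply, hb, hb', nonlin, norm_oscFun, oscFun, oscFun, schwartzMul_apply,
      ofRealSchwartz_apply, hγ]
    push_cast
    rw [smul_eq_mul]
    field_simp
  · rw [intervalIntegral.integral_smul, smul_smul, mul_assoc,
      mul_inv_cancel₀ hlam', mul_one]
    exact osc_eq_sub_integral γ b t

theorem exists_isDispersionlessSolution_homNorm_unbounded (hd : 0 < d) {lam σ : ℝ}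
    (hlam : lam ≠ 0) (hσ : 0 < σ) :
    ∃ (a₀ : 𝓢(Space d, ℂ)) (v : ℝ → L2 d),
      IsDispersionlessSolution lam σ (a₀.toLp 2 volume) v ∧
      (∀ (k : ℕ) (T : ℝ), ∃ R : ℝ, 0 ≤ R ∧ ∀ t ∈ Set.Icc 0 T,
        sobolevNorm k (v t) ≤ ENNReal.ofReal R) ∧
      ∀ s : ℝ, 0 < s → ∀ A : ℝ≥0∞, A ≠ ∞ → ∃ n : ℕ, 0 < n ∧ A < homNorm s (v n) := by
  have hσ₂ : 0 < 2 * σ := by positivity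
  set a₀ : 𝓢(Space d, ℂ) := ofRealSchwartz (schwartzBump one_pos)
  set γ : 𝓢(Space d, ℝ) := lam • schwartzBump hσ₂
  have hγ : ∀ x, γ x = lam * ‖a₀ x‖ ^ (2 * σ) := fun x => by
    rw [ofRealSchwartz_apply, schwartzBump_apply, Complex.norm_real,
      Real.norm_of_nonneg (bump_nonneg 1 x), bump_one_rpow hσ₂, smul_apply,
      schwartzBump_apply, smul_eq_mul]
  obtain ⟨x₀, hx₀, hderiv⟩ := exists_bump_ne_zero_and_fderiv_ne_zero hd hσ₂
  have ha₀ : a₀ x₀ ≠ 0 := by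
    rw [ofRealSchwartz_apply, schwartzBump_apply, Complex.ofReal_ne_zero]
    intro hzero
    rw [← bump_one_rpow hσ₂, hzero, Real.zero_rpow hσ₂.ne'] at hx₀
    exact hx₀ rfl
  have hγ_deriv : fderiv ℝ γ x₀ ≠ 0 := by
    change fderiv ℝ (lam • bump (2 * σ)) x₀ ≠ 0
    rw [fderiv_const_smul_field]
    exact smul_ne_zero hlam hderiv
  exact ⟨a₀, osc γ a₀, isDispersionlessSolution_osc hlam hγ, exists_sobolevNorm_osc_le γ a₀,
    fun s hs A hA => exists_lt_homNorm_osc hs ha₀ hγ_deriv hA⟩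

end Profile

section Dilation

lemma bracket_smul_le {c : ℝ} (hc : 1 ≤ c) (ξ : Space d) :
    bracket (c • ξ) ≤ c ^ 2 * bracket ξ := by
  unfold bracket
  rw [smul_comm, norm_smul c, mul_pow, Real.norm_eq_abs, sq_abs, mul_one_add]
  gcongr
  exact one_le_pow₀ hc

lemma bracket_smul_rpow_le {s c : ℝ} (hs : 0 ≤ s) (hc : 1 ≤ c) (ξ : Space d) :
    bracket (c • ξ) ^ (s / 2) ≤ c ^ s * bracket ξ ^ (s / 2) := by
  have hc₀ : 0 ≤ c := zero_le_one.trans hc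
  calc bracket (c • ξ) ^ (s / 2)
      ≤ (c ^ 2 * bracket ξ) ^ (s / 2) :=
        Real.rpow_le_rpow (bracket_pos _).le (bracket_smul_le hc ξ) (by positivity)
    _ = c ^ s * bracket ξ ^ (s / 2) := by
        rw [Real.mul_rpow (sq_nonneg c) (bracket_pos ξ).le, ← Real.rpow_natCast_mul hc₀]
        congr 2
        push_cast
        ring

variable {c : ℝ} (hc : 0 < c)

section
include hc

lemma eLpNorm_comp_smul {E : Type*} [NormedAddCommGroup E] {g : Space d → E}
    (hg : AEStronglyMeasurable g volume) : eLpNorm (fun x => g (c • x)) 2 volume =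
      ENNReal.ofReal (c ^ (-((d : ℝ) / 2))) * eLpNorm g 2 volume := by
  have hmap := Measure.map_addHaar_smul (volume : Measure (Space d)) hc.ne'
  have hcomp : eLpNorm g 2 (Measure.map (c • ·) (volume : Measure (Space d))) =
      eLpNorm (fun x => g (c • x)) 2 volume :=
    eLpNorm_map_measure (by rw [hmap]; exact hg.smul_measure _)
      (measurable_const_smul c).aemeasurable
  rw [← hcomp, hmap, eLpNorm_smul_measure_of_ne_top (by norm_num), smul_eq_mul,
    finrank_euclideanSpace_fin, abs_of_pos (by positivity),
    ENNReal.ofReal_rpow_of_pos (by positivity), ← Real.rpow_natCast, ← Real.rpow_neg hc.le,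
    ← Real.rpow_mul hc.le]
  congr 3
  simp
  ring

lemma memLp_comp_smul {E : Type*} [NormedAddCommGroup E] {g : Space d → E}
    (hg : MemLp g 2 volume) : MemLp (fun x => g (c • x)) 2 volume := by
  refine ⟨hg.1.comp_quasiMeasurePreserving
    (Measure.quasiMeasurePreserving_smul volume hc.ne'), ?_⟩
  rw [eLpNorm_comp_smul hc hg.1]
  exact ENNReal.mul_lt_top ENNReal.ofReal_lt_top hg.2

lemma ae_comp_smul {p : Space d → Prop} (hp : ∀ᵐ x, p x) : ∀ᵐ x, p (c • x) :=
  (Measure.quasiMeasurePreserving_smul volume hc.ne').ae hp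

end

/-- The dilation `f ↦ f(c ·)` of `L²`. -/
def dilation : L2 d →L[ℂ] L2 d :=
  LinearMap.mkContinuous
    { toFun := fun f => (memLp_comp_smul hc (Lp.memLp f)).toLp
      map_add' := fun f g =>
        MemLp.toLp_congr _ ((memLp_comp_smul hc (Lp.memLp f)).add
          (memLp_comp_smul hc (Lp.memLp g))) (ae_comp_smul hc (Lp.coeFn_add f g))
      map_smul' := fun a f =>
        MemLp.toLp_congr _ ((memLp_comp_smul hc (Lp.memLp f)).const_smul a)
          (ae_comp_smul hc (Lp.coeFn_smul a f)) } (c ^ (-((d : ℝ) / 2))) fun f => by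
    change ‖(memLp_comp_smul hc (Lp.memLp f)).toLp‖ ≤ _
    rw [Lp.norm_toLp, Lp.norm_def, eLpNorm_comp_smul hc (Lp.aestronglyMeasurable f),
      ENNReal.toReal_mul, ENNReal.toReal_ofReal (by positivity)]

lemma coeFn_dilation (f : L2 d) : dilation hc f =ᵐ[volume] fun x => f (c • x) :=
  MemLp.coeFn_toLp (memLp_comp_smul hc (Lp.memLp f))

/-- The dilation `f ↦ f(c ·)` of Schwartz functions. -/
def schwartzDilation : 𝓢(Space d, ℂ) →L[ℂ] 𝓢(Space d, ℂ) :=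
  SchwartzMap.compCLMOfContinuousLinearEquiv ℂ
    (ContinuousLinearEquiv.smulLeft (Units.mk0 c hc.ne') : Space d ≃L[ℝ] Space d)

@[simp] lemma schwartzDilation_apply (f : 𝓢(Space d, ℂ)) (x : Space d) :
    schwartzDilation hc f x = f (c • x) := by
  simp [schwartzDilation, Units.smul_def]

lemma toLp_schwartzDilation (f : 𝓢(Space d, ℂ)) :
    (schwartzDilation hc f).toLp 2 volume = dilation hc (f.toLp 2 volume) := by
  refine Lp.ext ?_
  filter_upwards [(schwartzDilation hc f).coeFn_toLp 2 volume, coeFn_dilation hc (f.toLp 2 volume),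
    ae_comp_smul hc (f.coeFn_toLp 2 volume)] with x hx hdil hf
  rw [hx, hdil, hf, schwartzDilation_apply]

lemma toLp_smul_schwartzDilation (a : ℂ) (f : 𝓢(Space d, ℂ)) :
    (a • schwartzDilation hc f).toLp 2 volume = a • dilation hc (f.toLp 2 volume) := by
  rw [← toLp_schwartzDilation]
  exact map_smul (SchwartzMap.toLpCLM ℂ ℂ 2 volume) _ _

lemma fourier_comp_smul {V E : Type*} [NormedAddCommGroup V] [InnerProductSpace ℝ V]
    [FiniteDimensional ℝ V] [MeasurableSpace V] [BorelSpace V] [NormedAddCommGroup E]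
    [NormedSpace ℂ E] {c : ℝ} (hc : c ≠ 0) (f : V → E) (ξ : V) :
    𝓕 (fun x => f (c • x)) ξ = |(c ^ Module.finrank ℝ V)⁻¹| • 𝓕 f (c⁻¹ • ξ) := by
  rw [Real.fourier_eq, Real.fourier_eq, ← Measure.integral_comp_smul]
  simp only [real_inner_smul_left, real_inner_smul_right, inv_mul_cancel_left₀ hc]

lemma fourier_dilation (f : L2 d) :
    𝓕 (dilation hc f) = ((c ^ d)⁻¹ : ℂ) • dilation (inv_pos.2 hc) (𝓕 f : L2 d) := by
  have hF := (Lp.fourierTransformₗᵢ (Space d) ℂ).continuous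
  suffices h : (fun f : L2 d => (𝓕 (dilation hc f) : L2 d)) =
      fun f => ((c ^ d)⁻¹ : ℂ) • dilation (inv_pos.2 hc) (𝓕 f : L2 d) from congrFun h f
  refine (SchwartzMap.denseRange_toLpCLM (F := ℂ) (p := 2) ENNReal.ofNat_ne_top).equalizer
    (hF.comp (dilation hc).continuous)
    ((continuous_const_smul _).comp ((dilation (inv_pos.2 hc)).continuous.comp hF)) ?_
  ext1 φ
  change (𝓕 (dilation hc (φ.toLp 2 volume)) : L2 d) =
    ((c ^ d)⁻¹ : ℂ) • dilation (inv_pos.2 hc) (𝓕 (φ.toLp 2 volume) : L2 d)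
  rw [← toLp_schwartzDilation, SchwartzMap.toLp_fourier_eq, SchwartzMap.toLp_fourier_eq,
    ← toLp_schwartzDilation]
  change SchwartzMap.toLpCLM ℂ ℂ 2 volume _ = _ • SchwartzMap.toLpCLM ℂ ℂ 2 volume _
  rw [← map_smul]
  congr 1
  ext ξ
  have hcomp : ⇑(schwartzDilation hc φ) = fun x => φ (c • x) := funext (schwartzDilation_apply hc φ)
  rw [SchwartzMap.fourier_coe, hcomp, fourier_comp_smul hc.ne', smul_apply,
    schwartzDilation_apply, SchwartzMap.fourier_coe, finrank_euclideanSpace_fin,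
    abs_of_pos (by positivity), Complex.real_smul, smul_eq_mul]
  push_cast
  rfl

lemma coeFn_fourier_dilation (f : L2 d) : ((𝓕 (dilation hc f) : L2 d) : Space d → ℂ) =ᵐ[volume]
    fun ξ => ((c ^ d)⁻¹ : ℝ) • (𝓕 f : L2 d) (c⁻¹ • ξ) := by
  rw [fourier_dilation]
  filter_upwards [Lp.coeFn_smul ((c ^ d)⁻¹ : ℂ) (dilation (inv_pos.2 hc) (𝓕 f : L2 d)),
    coeFn_dilation (inv_pos.2 hc) (𝓕 f : L2 d)] with ξ hsmul hdil
  rw [hsmul, Pi.smul_apply, hdil, Complex.real_smul, smul_eq_mul]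
  push_cast
  rfl

lemma sobolevNorm_dilation (s : ℝ) (f : L2 d) :
    sobolevNorm s (dilation hc f) = ENNReal.ofReal (c ^ (-((d : ℝ) / 2))) *
      eLpNorm (fun ξ => ((bracket (c • ξ) ^ (s / 2) : ℝ) : ℂ) * (𝓕 f : L2 d) ξ) 2 volume := by
  set g : Space d → ℂ := fun ξ => ((bracket (c • ξ) ^ (s / 2) : ℝ) : ℂ) * (𝓕 f : L2 d) ξ
  have hg : AEStronglyMeasurable g volume :=
    ((continuous_ofReal_bracket_rpow (s / 2)).comp
      (continuous_const_smul c)).aestronglyMeasurable.mul (Lp.aestronglyMeasurable _)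
  have hdil : sobolevNorm s (dilation hc f) =
      eLpNorm ((c ^ d)⁻¹ • fun ξ => g (c⁻¹ • ξ)) 2 volume := by
    rw [sobolevNorm_eq_eLpNorm]
    apply eLpNorm_congr_ae
    filter_upwards [coeFn_fourier_dilation hc f] with ξ hξ
    rw [hξ, Pi.smul_apply, mul_smul_comm]
    simp only [g, smul_inv_smul₀ hc.ne']
  rw [hdil, eLpNorm_const_smul, eLpNorm_comp_smul (inv_pos.2 hc) hg, ← mul_assoc, ← ofReal_norm,
    Real.norm_of_nonneg (by positivity), ← ENNReal.ofReal_mul (by positivity),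
    Real.inv_rpow hc.le, ← Real.rpow_neg hc.le, neg_neg, ← Real.rpow_natCast,
    ← Real.rpow_neg hc.le, ← Real.rpow_add hc]
  congr 3
  ring

include hc in
lemma ofReal_rpow_sub_half (s : ℝ) : ENNReal.ofReal (c ^ (s - (d : ℝ) / 2)) =
    ENNReal.ofReal (c ^ (-((d : ℝ) / 2))) * ENNReal.ofReal (c ^ s) := by
  rw [← ENNReal.ofReal_mul (by positivity), ← Real.rpow_add hc, neg_add_eq_sub]

lemma sobolevNorm_dilation_le {s : ℝ} (hs : 0 ≤ s) (hc₁ : 1 ≤ c) (f : L2 d) :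
    sobolevNorm s (dilation hc f) ≤
      ENNReal.ofReal (c ^ (s - (d : ℝ) / 2)) * sobolevNorm s f := by
  rw [sobolevNorm_dilation, ofReal_rpow_sub_half hc, mul_assoc, sobolevNorm_eq_eLpNorm]
  gcongr
  refine eLpNorm_le_mul_eLpNorm_of_ae_le_mul (Eventually.of_forall fun ξ => ?_) 2
  rw [norm_mul, norm_mul, norm_ofReal_bracket_rpow, norm_ofReal_bracket_rpow, ← mul_assoc]
  gcongr
  exact bracket_smul_rpow_le hs hc₁ ξ

lemma le_sobolevNorm_dilation {s : ℝ} (hs : 0 ≤ s) (f : L2 d) :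
    ENNReal.ofReal (c ^ (s - (d : ℝ) / 2)) * homNorm s f ≤ sobolevNorm s (dilation hc f) := by
  rw [sobolevNorm_dilation, ofReal_rpow_sub_half hc, mul_assoc, homNorm]
  gcongr
  rw [← Real.enorm_of_nonneg (by positivity : 0 ≤ c ^ s), ← eLpNorm_const_smul]
  refine eLpNorm_mono fun ξ => ?_
  rw [Pi.smul_apply, norm_smul, norm_mul, norm_mul, norm_ofReal_bracket_rpow, Complex.norm_real,
    Real.norm_of_nonneg (by positivity), Real.norm_of_nonneg (by positivity), ← mul_assoc]
  gcongr
  calc c ^ s * ‖(2 * Real.pi) • ξ‖ ^ s = ‖(2 * Real.pi) • c • ξ‖ ^ s := by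
        rw [← Real.mul_rpow hc.le (norm_nonneg _), smul_comm, norm_smul c,
          Real.norm_of_nonneg hc.le]
    _ ≤ bracket (c • ξ) ^ (s / 2) := norm_two_pi_smul_rpow_le hs _

variable {P Q : Space d → ℝ} (hP : AEMeasurable P volume) (hQ : AEMeasurable Q volume) {B : ℝ}

lemma freeFlow_smul (t : ℝ) (a : ℂ) (f : L2 d) :
    freeFlow hP t (a • f) = a • freeFlow hP t f := by
  simp only [freeFlow_eq_multOp, map_smul]

lemma freeFlow_dilation (hPQ : ∀ ξ, P (c • ξ) = B * Q ξ) (t : ℝ) (f : L2 d) :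
    freeFlow hP t (dilation hc f) = dilation hc (freeFlow hQ (B * t) f) := by
  have hphase : ∀ ξ, phase Q (B * t) (c⁻¹ • ξ) = phase P t ξ := fun ξ => by
    rw [phase, phase, mul_assoc, mul_left_comm, ← hPQ, smul_comm c, smul_inv_smul₀ hc.ne']
  refine (Lp.fourierTransformₗᵢ (Space d) ℂ).injective (Lp.ext ?_)
  change (𝓕 (freeFlow hP t (dilation hc f)) : L2 d) =ᵐ[volume]
    (𝓕 (dilation hc (freeFlow hQ (B * t) f)) : L2 d)
  filter_upwards [fourier_freeFlow hP t (dilation hc f), coeFn_fourier_dilation hc f,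
    coeFn_fourier_dilation hc (freeFlow hQ (B * t) f),
    ae_comp_smul (inv_pos.2 hc) (fourier_freeFlow hQ (B * t) f)] with ξ hflow hdil hdil' hflow'
  rw [hflow, hdil, hdil', hflow', hphase, mul_smul_comm]

lemma mapsTo_mul_Icc {T : ℝ} (hB : 0 < B) :
    Set.MapsTo (fun t => B * t) (Set.Icc 0 (T / B)) (Set.Icc 0 T) := fun _ ht =>
  ⟨mul_nonneg hB.le ht.1, (le_div_iff₀' hB).1 ht.2⟩

lemma nonlin_mul {A : ℝ} (hA : 0 ≤ A) (σ : ℝ) (z : ℂ) :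
    nonlin σ (A * z) = ((A * A ^ (2 * σ) : ℝ) : ℂ) * nonlin σ z := by
  rw [nonlin, nonlin, norm_mul, Complex.norm_real, Real.norm_of_nonneg hA,
    Real.mul_rpow hA (norm_nonneg _)]
  push_cast
  ring

lemma ContinuousInSobolev.dilate {r T : ℝ} (hr : 0 ≤ r) (hc₁ : 1 ≤ c) (A : ℂ) (hB : 0 < B)
    {u : ℝ → L2 d} (hu : ContinuousInSobolev r T u) :
    ContinuousInSobolev r (T / B) fun t => A • dilation hc (u (B * t)) := by
  set K := ‖A‖ₑ * ENNReal.ofReal (c ^ (r - (d : ℝ) / 2))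
  have hK : K ≠ ∞ := ENNReal.mul_ne_top enorm_ne_top ENNReal.ofReal_ne_top
  have hbound : ∀ f : L2 d, sobolevNorm r (A • dilation hc f) ≤
      K * sobolevNorm r f := fun f => by
    rw [sobolevNorm_smul, mul_assoc]
    gcongr
    exact sobolevNorm_dilation_le hc hr hc₁ f
  intro t₀ ht₀
  obtain ⟨hfin, hlim⟩ := hu _ (mapsTo_mul_Icc hB ht₀)
  refine ⟨(hbound _).trans_lt (ENNReal.mul_lt_top hK.lt_top hfin), ?_⟩
  have hmul : Tendsto (fun t => B * t) (𝓝[Set.Icc 0 (T / B)] t₀) (𝓝[Set.Icc 0 T] (B * t₀)) :=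
    (continuous_const_mul B).continuousWithinAt.tendsto_nhdsWithin (mapsTo_mul_Icc hB)
  have hupper := ENNReal.Tendsto.const_mul (hlim.comp hmul) (Or.inr hK)
  rw [mul_zero] at hupper
  refine tendsto_of_tendsto_of_tendsto_of_le_of_le tendsto_const_nhds hupper (fun _ => zero_le)
    fun t => ?_
  simp only
  rw [← smul_sub, ← map_sub]
  exact hbound _

lemma integral_freeFlow_dilation (hPQ : ∀ ξ, P (c • ξ) = B * Q ξ) {g : ℝ → L2 d} {t : ℝ}
    (hBt : 0 ≤ B * t) (hg : ContinuousOn g (Set.Icc 0 (B * t))) :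
    (B : ℂ) • ∫ τ in (0 : ℝ)..t, freeFlow hP (t - τ) (dilation hc (g (B * τ))) =
      dilation hc (∫ τ in (0 : ℝ)..B * t, freeFlow hQ (B * t - τ) (g τ)) := by
  have hint : IntervalIntegrable (fun τ => freeFlow hQ (B * t - τ) (g τ)) volume 0 (B * t) := by
    apply ContinuousOn.intervalIntegrable
    rw [Set.uIcc_of_le hBt]
    exact (continuous_freeFlow hQ).comp_continuousOn (f := fun τ => (B * t - τ, g τ))
      ((continuous_const.sub continuous_id).continuousOn.prodMk hg)
  have hsubst := intervalIntegral.smul_integral_comp_mul_left (a := 0) (b := t)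
    (fun τ => dilation hc (freeFlow hQ (B * t - τ) (g τ))) B
  rw [mul_zero] at hsubst
  rw [← ContinuousLinearMap.intervalIntegral_comp_comm _ hint, ← hsubst]
  simp only [freeFlow_dilation hc hP hQ hPQ, mul_sub]
  rfl

theorem IsSolution.dilate {lam σ A T : ℝ} (hA : 0 < A) (hc₁ : 1 ≤ c)
    (hPQ : ∀ ξ, P (c • ξ) = A ^ (2 * σ) * Q ξ) {a₀ : 𝓢(Space d, ℂ)} {u : ℝ → L2 d}
    (hu : IsSolution hQ lam σ a₀ T u) :
    IsSolution hP lam σ ((A : ℂ) • schwartzDilation hc a₀) (T / A ^ (2 * σ))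
      fun t => (A : ℂ) • dilation hc (u (A ^ (2 * σ) * t)) := by
  obtain ⟨⟨r, hr, hcont⟩, g, hg_cont, hg, hduhamel⟩ := hu
  have hr₀ : 0 ≤ r := le_trans (by positivity) hr.le
  set B : ℝ := A ^ (2 * σ)
  have hB : 0 < B := Real.rpow_pos_of_pos hA _
  refine ⟨⟨r, hr, hcont.dilate hc hr₀ hc₁ A hB⟩,
    fun t => ((A * B : ℝ) : ℂ) • dilation hc (g (B * t)), ?_,
    fun t ht => ?_, fun t ht => ?_⟩
  · exact ((continuous_const_smul ((A * B : ℝ) : ℂ)).comp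
      (dilation hc).continuous).comp_continuousOn
      (hg_cont.comp (continuous_const_mul B).continuousOn (mapsTo_mul_Icc hB))
  · filter_upwards [Lp.coeFn_smul ((A * B : ℝ) : ℂ) (dilation hc (g (B * t))),
      Lp.coeFn_smul (A : ℂ) (dilation hc (u (B * t))),
      coeFn_dilation hc (g (B * t)), coeFn_dilation hc (u (B * t)),
      ae_comp_smul hc (hg _ (mapsTo_mul_Icc hB ht))] with x hg_smul hu_smul hg_dil hu_dil hgu
    rw [hg_smul, hu_smul, Pi.smul_apply, Pi.smul_apply, hg_dil, hu_dil, hgu]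
    exact (nonlin_mul hA.le σ _).symm
  · have hBt := mapsTo_mul_Icc hB ht
    simp only
    rw [hduhamel _ hBt, map_sub, map_smul, smul_sub, toLp_smul_schwartzDilation,
      freeFlow_smul, freeFlow_dilation hc hP hQ hPQ, ← integral_freeFlow_dilation hc hP hQ hPQ hBt.1
        (hg_cont.mono (Set.Icc_subset_Icc_right hBt.2))]
    simp only [freeFlow_smul, intervalIntegral.integral_smul, Complex.ofReal_mul, smul_smul]
    congr 2
    ring

end Dilation

section NormInflation

variable {P : Space d → ℝ} {p : ℝ}

/-- The symbol `P` grows slower than `|ξ|^p` under dilations: `n^{-p} P(n ξ) → 0` for almost every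
`ξ`. After rescaling by `n`, the dispersive term of the equation then disappears in the limit. -/
def IsNegligibleUnderDilation (P : Space d → ℝ) (p : ℝ) : Prop :=
  ∀ᵐ ξ, Tendsto (fun n : ℕ => (n : ℝ) ^ (-p) * P ((n : ℝ) • ξ)) atTop (𝓝 0)

lemma tendsto_natCast_rpow_neg_mul (hp : 0 < p) (C : ℝ) :
    Tendsto (fun n : ℕ => (n : ℝ) ^ (-p) * C) atTop (𝓝 0) := by
  simpa using ((tendsto_rpow_neg_atTop hp).comp tendsto_natCast_atTop_atTop).mul_const C

lemma IsHomogeneousSymbol.isNegligibleUnderDilation {m : ℝ} (hP : IsHomogeneousSymbol P m)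
    (hmp : m < p) : IsNegligibleUnderDilation P p := by
  refine Eventually.of_forall fun ξ =>
    (tendsto_natCast_rpow_neg_mul (sub_pos.2 hmp) (P ξ)).congr' ?_
  filter_upwards [eventually_gt_atTop 0] with n hn
  have hn₀ : (0 : ℝ) < n := Nat.cast_pos.2 hn
  rw [hP ξ n hn₀, ← mul_assoc, ← Real.rpow_add hn₀, neg_sub, sub_eq_neg_add]

lemma isNegligibleUnderDilation_of_memLp_top (hP : MemLp P ∞ volume) (hp : 0 < p) :
    IsNegligibleUnderDilation P p := by
  set C := (eLpNorm P ∞ volume).toReal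
  have hC : ∀ᵐ ξ, ‖P ξ‖ ≤ C := by
    filter_upwards [enorm_ae_le_eLpNormEssSup P volume] with ξ hξ
    rw [← toReal_enorm]
    exact ENNReal.toReal_mono hP.2.ne (hξ.trans_eq eLpNorm_exponent_top.symm)
  have hdil : ∀ᵐ ξ, ∀ n : ℕ, 0 < n → ‖P ((n : ℝ) • ξ)‖ ≤ C :=
    ae_all_iff.2 fun n => eventually_imp_distrib_left.2 fun hn =>
      ae_comp_smul (Nat.cast_pos.2 hn) hC
  filter_upwards [hdil] with ξ hξ
  refine squeeze_zero_norm' ?_ (tendsto_natCast_rpow_neg_mul hp C)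
  filter_upwards [eventually_gt_atTop 0] with n hn
  rw [norm_mul, Real.norm_of_nonneg (by positivity)]
  gcongr
  exact hξ n hn

lemma exists_nat_half_lt_add_one {σ : ℝ}
    (hreg : (∃ n : ℕ, σ = n) ∨ ∃ r : ℕ, (d : ℝ) / 2 < r ∧ (r : ℝ) ≤ 2 * σ) :
    ∃ k : ℕ, (d : ℝ) / 2 < k + 1 ∧ ((∃ n : ℕ, σ = n) ∨ ((k + 1 : ℕ) : ℝ) ≤ 2 * σ) := by
  rcases hreg with hn | ⟨r, hr, hrσ⟩
  · exact ⟨d, by linarith [(Nat.cast_nonneg d : (0 : ℝ) ≤ d)], Or.inl hn⟩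
  · have hr₀ : (0 : ℝ) < r := lt_of_le_of_lt (by positivity) hr
    obtain ⟨k, rfl⟩ := Nat.exists_eq_succ_of_ne_zero (Nat.cast_pos.1 hr₀).ne'
    exact ⟨k, by exact_mod_cast hr, Or.inr hrσ⟩

lemma IsNegligibleUnderDilation.tendsto_inv_amplitude_mul {κ q σ : ℝ} (hκ : 0 ≤ κ)
    (hP : IsNegligibleUnderDilation P (2 * σ * q)) : ∀ᵐ ξ, Tendsto (fun n : ℕ =>
      ((κ * ((n : ℝ) + 1) ^ q) ^ (2 * σ))⁻¹ * P (((n : ℝ) + 1) • ξ)) atTop (𝓝 0) := by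
  filter_upwards [hP] with ξ hξ
  have hlim := (hξ.comp (tendsto_add_atTop_nat 1)).const_mul (κ ^ (2 * σ))⁻¹
  rw [mul_zero] at hlim
  refine hlim.congr fun n => ?_
  have hn : (0 : ℝ) ≤ (n : ℝ) + 1 := by positivity
  rw [Real.mul_rpow hκ (Real.rpow_nonneg hn q), ← Real.rpow_mul hn, mul_comm q, mul_inv,
    ← Real.rpow_neg hn]
  simp only [Function.comp_apply, Nat.cast_add, Nat.cast_one, mul_assoc]

lemma tendsto_amplitude_atTop {κ q σ : ℝ} (hκ : 0 < κ) (hq : 0 < q) (hσ : 0 < σ) :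
    Tendsto (fun n : ℕ => (κ * ((n : ℝ) + 1) ^ q) ^ (2 * σ)) atTop atTop :=
  (tendsto_rpow_atTop (by positivity)).comp (((tendsto_rpow_atTop hq).comp
    (tendsto_natCast_atTop_atTop.atTop_add tendsto_const_nhds)).const_mul_atTop hκ)

lemma ofReal_mul_rpow_mul_rpow {c κ q : ℝ} (hc : 0 < c) (hκ : 0 ≤ κ) :
    ‖((κ * c ^ q : ℝ) : ℂ)‖ₑ * ENNReal.ofReal (c ^ (-q)) = ENNReal.ofReal κ := by
  rw [← ofReal_norm, Complex.norm_real, Real.norm_of_nonneg (by positivity),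
    ← ENNReal.ofReal_mul (by positivity), mul_assoc, ← Real.rpow_add hc, add_neg_cancel,
    Real.rpow_zero, mul_one]

theorem exists_isSolution_of_isDispersionlessSolution {lam σ s T κ τ : ℝ} (hσ : 0 < σ)
    (hreg : (∃ n : ℕ, σ = n) ∨ ∃ r : ℕ, (d : ℝ) / 2 < r ∧ (r : ℝ) ≤ 2 * σ)
    (hP : AEMeasurable P volume) (hs : 0 ≤ s) (hsd : s < (d : ℝ) / 2)
    (hneg : IsNegligibleUnderDilation P (2 * σ * ((d : ℝ) / 2 - s)))
    {a₀ : 𝓢(Space d, ℂ)} {v : ℝ → L2 d} (hv : IsDispersionlessSolution lam σ (a₀.toLp 2 volume) v)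
    (hbdd : ∀ k : ℕ, ∃ R : ℝ, 0 ≤ R ∧ ∀ t ∈ Set.Icc 0 T, sobolevNorm k (v t) ≤ ENNReal.ofReal R)
    (hT : 0 < T) (hκ : 0 < κ) (hτ : 0 < τ) :
    ∃ (u₀ : 𝓢(Space d, ℂ)) (u : ℝ → L2 d) (t : ℝ), 0 < t ∧ t ≤ τ ∧ IsSolution hP lam σ u₀ t u ∧
      sobolevNorm s (u₀.toLp 2 volume) ≤ ENNReal.ofReal κ * sobolevNorm s (a₀.toLp 2 volume) ∧
      ENNReal.ofReal κ * homNorm s (v T) ≤ sobolevNorm s (u t) + ENNReal.ofReal κ := by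
  obtain ⟨k, hk, hkσ⟩ := exists_nat_half_lt_add_one hreg
  obtain ⟨R, hR, hvR⟩ := hbdd (k + 1)
  push_cast at hvR
  set q : ℝ := (d : ℝ) / 2 - s
  have hc (n : ℕ) : (0 : ℝ) < (n : ℝ) + 1 := n.cast_add_one_pos
  set A : ℕ → ℝ := fun n => κ * ((n : ℝ) + 1) ^ q
  have hQ (n : ℕ) :
      AEMeasurable (fun ξ => (A n ^ (2 * σ))⁻¹ * P (((n : ℝ) + 1) • ξ)) volume :=
    (hP.comp_quasiMeasurePreserving
      (Measure.quasiMeasurePreserving_smul volume (hc n).ne')).const_mul _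
  have hnear := eventually_exists_isSolution_near hσ hk hkσ hT.le hR hs (hsd.trans hk) one_pos hv
    hvR hQ (hneg.tendsto_inv_amplitude_mul hκ.le)
  have htime : ∀ᶠ n in atTop, T / A n ^ (2 * σ) ≤ τ :=
    (tendsto_const_nhds.div_atTop
      (tendsto_amplitude_atTop hκ (sub_pos.2 hsd) hσ)).eventually_le_const hτ
  obtain ⟨n, ⟨w, hw, hwv⟩, hn⟩ := (hnear.and htime).exists
  have hA : 0 < A n := mul_pos hκ (Real.rpow_pos_of_pos (hc n) q)
  have hB : 0 < A n ^ (2 * σ) := Real.rpow_pos_of_pos hA _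
  have hscale : ‖(A n : ℂ)‖ₑ * ENNReal.ofReal (((n : ℝ) + 1) ^ (s - (d : ℝ) / 2)) =
      ENNReal.ofReal κ := by
    rw [← neg_sub]
    exact ofReal_mul_rpow_mul_rpow (hc n) hκ.le
  have hc₁ : (1 : ℝ) ≤ (n : ℝ) + 1 := le_add_of_nonneg_left n.cast_nonneg
  refine ⟨_, _, T / A n ^ (2 * σ), div_pos hT hB, hn, hw.dilate (hc n) hP (hQ n) hA hc₁
    fun ξ => (mul_inv_cancel_left₀ hB.ne' _).symm, ?_, ?_⟩
  · rw [toLp_smul_schwartzDilation, sobolevNorm_smul, ← hscale, mul_assoc]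
    gcongr
    exact sobolevNorm_dilation_le (hc n) hs hc₁ _
  · have hclose : homNorm s (w T - v T) ≤ 1 :=
      (homNorm_le_sobolevNorm hs _).trans (hwv.trans_eq ENNReal.ofReal_one)
    rw [mul_div_cancel₀ _ hB.ne', sobolevNorm_smul]
    calc ENNReal.ofReal κ * homNorm s (v T)
        ≤ ENNReal.ofReal κ * (homNorm s (w T) + 1) := by
          gcongr
          exact (homNorm_le_add_sub hs (v T) (w T)).trans (by gcongr)
      _ = ‖(A n : ℂ)‖ₑ * (ENNReal.ofReal (((n : ℝ) + 1) ^ (s - (d : ℝ) / 2)) * homNorm s (w T)) +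
          ENNReal.ofReal κ := by rw [mul_add, mul_one, ← mul_assoc, hscale]
      _ ≤ _ := by
          gcongr
          exact le_sobolevNorm_dilation (hc n) hs _

theorem normInflation_of_forall_exists (hP : AEMeasurable P volume) {lam σ s : ℝ}
    (H : ∀ h : ℝ, 0 < h → ∃ (u₀ : 𝓢(Space d, ℂ)) (u : ℝ → L2 d) (t : ℝ), 0 < t ∧ t ≤ h ∧
      IsSolution hP lam σ u₀ t u ∧ sobolevNorm s (u₀.toLp 2 volume) ≤ ENNReal.ofReal h ∧
      ENNReal.ofReal h⁻¹ ≤ sobolevNorm s (u t)) :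
    NormInflation hP lam σ s := by
  choose! u₀ u t ht hth hu hu₀ hut using H
  have hid : Tendsto (fun h : ℝ => h) (𝓝[>] 0) (𝓝 0) := nhdsWithin_le_nhds
  have hpos : ∀ᶠ h : ℝ in 𝓝[>] 0, 0 < h := self_mem_nhdsWithin
  refine ⟨u₀, u, t, t, fun h hh => ⟨ht h hh.1, le_rfl, hu h hh.1⟩, ?_, ?_, ?_⟩
  · exact tendsto_of_tendsto_of_tendsto_of_le_of_le' tendsto_const_nhds
      (by simpa using ENNReal.tendsto_ofReal hid) (Eventually.of_forall fun _ => zero_le)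
      (hpos.mono hu₀)
  · exact squeeze_zero' (hpos.mono fun h hh => (ht h hh).le) (hpos.mono hth) hid
  · exact tendsto_of_tendsto_of_tendsto_of_le_of_le'
      (ENNReal.tendsto_ofReal_atTop.comp tendsto_inv_nhdsGT_zero) tendsto_const_nhds
      (hpos.mono hut) (Eventually.of_forall fun _ => le_top)

end NormInflation

end ModifiedDispersion

end

open ModifiedDispersion in
theorem theorem1_general {d : ℕ} {lam σ s : ℝ} (hlam : lam ≠ 0) (hσ : 0 < σ)
    (hreg : (∃ n : ℕ, σ = n) ∨ ∃ r : ℕ, (d : ℝ) / 2 < r ∧ (r : ℝ) ≤ 2 * σ)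
    {P : Space d → ℝ} (hP : AEMeasurable P volume)
    (hs : 0 < s) (hsd : s < (d : ℝ) / 2)
    (hneg : IsNegligibleUnderDilation P (2 * σ * ((d : ℝ) / 2 - s))) :
    NormInflation hP lam σ s := by
  have hd : 0 < d := by
    have : (0 : ℝ) < d := by linarith
    exact_mod_cast this
  obtain ⟨a₀, v, hv, hbdd, hunbdd⟩ :=
    exists_isDispersionlessSolution_homNorm_unbounded hd hlam hσ
  refine normInflation_of_forall_exists hP fun h hh => ?_
  have hN : sobolevNorm s (a₀.toLp 2 volume) ≠ ∞ := by
    rw [sobolevNorm_schwartz]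
    exact funSobolevNorm_schwartz_ne_top s a₀
  obtain ⟨κ, hκ, hκN⟩ := ENNReal.exists_nnreal_pos_mul_lt hN (ENNReal.ofReal_pos.2 hh).ne'
  have hκ₀ : (κ : ℝ≥0∞) ≠ 0 := ENNReal.coe_ne_zero.2 hκ.ne'
  obtain ⟨n, hn, hvn⟩ := hunbdd s hs ((κ : ℝ≥0∞)⁻¹ * (ENNReal.ofReal h⁻¹ + κ)) (by finiteness)
  obtain ⟨u₀, u, t, ht, hth, hu, hu₀, hut⟩ := exists_isSolution_of_isDispersionlessSolution hσ hreg
    hP hs.le hsd hneg hv (fun k => hbdd k n) (Nat.cast_pos.2 hn) (NNReal.coe_pos.2 hκ) hh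
  rw [ENNReal.ofReal_coe_nnreal] at hu₀ hut
  refine ⟨u₀, u, t, ht, hth, hu, hu₀.trans hκN.le, ?_⟩
  have hgrowth := (ENNReal.inv_mul_le_iff hκ₀ ENNReal.coe_ne_top).1 hvn.le
  exact (ENNReal.add_le_add_iff_right ENNReal.coe_ne_top).1 (hgrowth.trans hut)

theorem theorem1 (d : ℕ) (hd : 1 ≤ d) (lam : ℝ) (hlam : lam ≠ 0) (σ : ℝ) (hσ : 0 < σ)
    (hreg : (∃ n : ℕ, σ = n) ∨ ∃ r : ℕ, (d : ℝ) / 2 < r ∧ (r : ℝ) ≤ 2 * σ)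
    (P : ModifiedDispersion.Space d → ℝ) (hP : AEMeasurable P volume) :
    (∀ m : ℝ, 1 ≤ m → ModifiedDispersion.IsHomogeneousSymbol P m →
      0 < (d : ℝ) / 2 - m / (2 * σ) →
      ∀ s : ℝ, 0 < s → s < (d : ℝ) / 2 - m / (2 * σ) →
        ModifiedDispersion.NormInflation hP lam σ s) ∧
    (MemLp P ∞ volume →
      ∀ s : ℝ, 0 < s → s < (d : ℝ) / 2 →
        ModifiedDispersion.NormInflation hP lam σ s) := by
  refine ⟨fun m hm hhom _ s hs hsm => ?_, fun hbdd s hs hsd => ?_⟩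
  · have hsd : s < (d : ℝ) / 2 := hsm.trans_le (sub_le_self _ (by positivity))
    exact theorem1_general hlam hσ hreg hP hs hsd <| hhom.isNegligibleUnderDilation
      ((div_lt_iff₀' (by positivity)).1 (lt_sub_comm.1 hsm))
  · exact theorem1_general hlam hσ hreg hP hs hsd <|
      ModifiedDispersion.isNegligibleUnderDilation_of_memLp_top hbdd
        (mul_pos (by positivity) (sub_pos.2 hsd))
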